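/- Let $n\ge 3$, let $a_1<\dots<a_n$ be distinct real numbers (a generic point configuration, $d=2$), let $v_i=(a_i,1)\in\mathbb{R}^2$, and let $1\le k\le n-2$. Then the flip graph of reduced lifting hypertriangulations at level $k+1$ has diameter exactly $k(n-k-1)$; in particular it is connected. Here the notions are as follows. Let $\pi:[0,1]^n\to\mathbb{R}^2$, $\pi(x)=\sum_i x_iv_i$, and for disjoint $A,B\subseteq[n]$ let $F_{A,B}$ be the face of the cube given by $x_i=1$ for $i\in A$ and $x_i=0$ for $i\notin A\cup B$. - A *fine zonotopal tiling* is a collection $T$ of faces $F_{A,B}$ for which $(v_b)_{b\in B}$ is a basis of $\mathbb{R}^2$ (so $|B|=2$), whose images under $\pi$ cover $\pi([0,1]^n)$, and such that $\pi(F\cap F')=\pi(F)\cap\pi(F')$ for all $F,F'\in T$. Its *vertices* are the sets $S$ with $A\subseteq S\subseteq A\cup B$ for some $F_{A,B}\in T$. - A *circuit* is a pair $C=(C^+,C^-)$ of disjoint sets whose union is the support of a minimal linear dependence $\sum_i\alpha_iv_i=0$, with $\alpha_i>0$ on $C^+$ and $\alpha_i<0$ on $C^-$; put $-C=(C^-,C^+)$.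 A set $S$ orients $C$ positively if $C^+\subseteq S$ and $C^-\cap S=\emptyset$, and negatively if it orients $-C$ positively. Put $\sigma_T(C)=1$ (resp. $-1$) if some vertex of $T$ orients $C$ positively (resp. negatively) and no vertex orients it negatively (resp. positively). (Exactly one of the two cases always occurs.) Two tilings $T_1,T_2$ are related by a *flip* if for some circuit $C$ one has $\sigma_{T_1}(C)=-\sigma_{T_2}(C)$, while $\sigma_{T_1}(C')=\sigma_{T_2}(C')$ for all circuits $C'\ne\pm C$. - A *hypertriangulation at level $m$* is a chain of $m$-element subsets of $[n]$, starting at $\{1,\dots,m\}$ and ending at $\{n-m+1,\dots,n\}$, with steps $I\cup\{i\}\to I\cup\{j\}$, where $i,j\notin I$ and $i<j$. It is *lifting* if it is the $m$-th cross-section of some fine zonotopal tiling $T$, that is, its steps are exactly the steps $A\cup\{i\}\to A\cup\{j\}$ with $i<j$, $F_{A,\{i,j\}}\in T$ and $|A|=m-1$. Two different lifting hypertriangulations at level $m$ are related by a *flip* if they are the $m$-th cross-sections of two tilings related by a flip. - A lifting hypertriangulation at level $m$ is *reduced* if $|S_1\cap S_2\cap S_3|=m-2$ for any three consecutive vertices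 $S_1,S_2,S_3$. Every lifting hypertriangulation has a corresponding reduced one, obtained by repeatedly throwing away the middle one of three consecutive vertices that violate this condition. - The *flip graph of reduced lifting hypertriangulations at level $m$* has these as its vertices, and two different ones are adjacent if they correspond to two lifting hypertriangulations at level $m$ that are related by a flip. -/

import Mathlib

/-! Fine zonotopal tilings, circuits and flips for a vector configuration `v : Fin n → E`. -/

namespace HyperTri

section Tilings

variable {n : ℕ} {E : Type*} [AddCommGroup E] [Module ℝ E]

/-- The linear projection `π : ℝⁿ → E` with `π e_i = v_i`. -/
def proj (v : Fin n → E) (x : Fin n → ℝ) : E := ∑ i, x i • v i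

/-- The unit cube `[0,1]ⁿ`. -/
def cube (n : ℕ) : Set (Fin n → ℝ) := Set.Icc 0 1

/-- The zonotope of `v`, the Minkowski sum of the segments `[0, v_i]`. -/
def zonotope (v : Fin n → E) : Set E := proj v '' cube n

/-- The face `F_{A,B}` of the unit cube: `x_i = 1` for `i ∈ A` and `x_i = 0` for `i ∉ A ∪ B`. -/
def cubeFace (A B : Finset (Fin n)) : Set (Fin n → ℝ) :=
  {x | x ∈ cube n ∧ (∀ i ∈ A, x i = 1) ∧ ∀ i, i ∉ A ∪ B → x i = 0}

/-- The tile `Π_{A,B} = π(F_{A,B}) = ∑_{a ∈ A} v_a + ∑_{b ∈ B} [0, v_b]`. -/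
def tile (v : Fin n → E) (A B : Finset (Fin n)) : Set E := proj v '' cubeFace A B

/-- `T`, a collection of pairs `(A, B)` standing for the faces `F_{A,B}` of the cube, is a fine
zonotopal tiling of the zonotope of `v`. Every image is a full-dimensional parallelepiped, the
images cover the zonotope, and any two of them meet exactly in the image of the common face of the
two cube faces. As `π` is injective on each `F_{A,B}`, the last condition says in particular that
any two tiles meet in a common (possibly empty) face. -/
structure IsFineTiling (v : Fin n → E) (T : Set (Finset (Fin n) × Finset (Fin n))) : Prop where
  disjoint : ∀ p ∈ T, Disjoint p.1 p.2
  card_eq : ∀ p ∈ T, p.2.card = Module.finrank ℝ E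
  linearIndep : ∀ p ∈ T, LinearIndepOn ℝ v (p.2 : Set (Fin n))
  cover : ⋃ p ∈ T, tile v p.1 p.2 = zonotope v
  inter : ∀ p ∈ T, ∀ q ∈ T,
    proj v '' (cubeFace p.1 p.2 ∩ cubeFace q.1 q.2) = tile v p.1 p.2 ∩ tile v q.1 q.2

/-- The vertices of `T`: the sets `S` with `A ⊆ S ⊆ A ∪ B` for some tile `(A, B)` of `T`. -/
def vertices (T : Set (Finset (Fin n) × Finset (Fin n))) : Set (Finset (Fin n)) :=
  {S | ∃ p ∈ T, p.1 ⊆ S ∧ S ⊆ p.1 ∪ p.2}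

/-- `C = (C⁺, C⁻)` is a circuit of `v`: a minimal linear dependence, with its signs. -/
structure IsCircuit (v : Fin n → E) (C : Finset (Fin n) × Finset (Fin n)) : Prop where
  disjoint : Disjoint C.1 C.2
  nonempty : (C.1 ∪ C.2).Nonempty
  indep : ∀ i ∈ C.1 ∪ C.2, LinearIndepOn ℝ v (((C.1 ∪ C.2).erase i : Finset (Fin n)) : Set (Fin n))
  dep : ∃ α : Fin n → ℝ, (∀ i ∈ C.1, 0 < α i) ∧ (∀ i ∈ C.2, α i < 0) ∧
    (∀ i, i ∉ C.1 ∪ C.2 → α i = 0) ∧ ∑ i, α i • v i = 0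

/-- `S` orients `C` positively. It orients `C` negatively if it orients `C.swap = -C` positively. -/
def SetOrients (S : Finset (Fin n)) (C : Finset (Fin n) × Finset (Fin n)) : Prop :=
  C.1 ⊆ S ∧ Disjoint C.2 S

/-- A collection of sets orients `C` positively: some member orients `C` positively and none
orients `C` negatively. -/
def Orients (W : Set (Finset (Fin n))) (C : Finset (Fin n) × Finset (Fin n)) : Prop :=
  (∃ S ∈ W, SetOrients S C) ∧ ∀ S ∈ W, ¬ SetOrients S C.swap

open Classical in
/-- The sign `σ_T(C)`: `1` if `T` orients `C` positively, `-1` if `T` orients `C` negatively.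
(One of the two always holds for a fine zonotopal tiling; otherwise the value is `0`.) -/
noncomputable def sigma (T : Set (Finset (Fin n) × Finset (Fin n)))
    (C : Finset (Fin n) × Finset (Fin n)) : ℤ :=
  if Orients (vertices T) C then 1 else if Orients (vertices T) C.swap then -1 else 0

/-- There is a flip between the tilings `T₁` and `T₂`: they orient exactly one circuit
(up to sign) differently. -/
def IsFlip (v : Fin n → E) (T₁ T₂ : Set (Finset (Fin n) × Finset (Fin n))) : Prop :=
  ∃ C, IsCircuit v C ∧ sigma T₁ C = -sigma T₂ C ∧
    ∀ C', IsCircuit v C' → C' ≠ C → C' ≠ C.swap → sigma T₁ C' = sigma T₂ C'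

end Tilings

/-! Hypertriangulations for `d = 2`, that is, of points `a_1 < ... < a_n` on the line. -/

section Hyper

variable {n : ℕ}

/-- The lift `v_i = (a_i, 1)` of a point configuration on the line. -/
def lift (a : Fin n → ℝ) : Fin n → ℝ × ℝ := fun i => (a i, 1)

/-- A step `I ∪ {i} → I ∪ {j}` with `i < j` and `i, j ∉ I`. -/
def Step (S S' : Finset (Fin n)) : Prop :=
  ∃ (I : Finset (Fin n)) (i j : Fin n), i ∉ I ∧ j ∉ I ∧ i < j ∧ S = insert i I ∧ S' = insert j I

/-- A hypertriangulation at level `k` for `d = 2`: a monotone path, i.e. a chain of `k`-subsets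
from the set of the first `k` indices to the set of the last `k` indices, with monotone steps. -/
structure IsHypertriangulation (k : ℕ) (L : List (Finset (Fin n))) : Prop where
  head : L.head? = some (Finset.univ.filter fun i : Fin n => i.val < k)
  last : L.getLast? = some (Finset.univ.filter fun i : Fin n => n - k ≤ i.val)
  chain : L.IsChain Step

/-- The hypertriangulation `L` is the `k`-th cross-section of `T`. A tile `(A, {i, j})`, `i < j`,
crosses the height `k` in a segment if and only if `|A| = k - 1`, and the segment then goes from the
vertex `A ∪ {i}` to the vertex `A ∪ {j}`; these segments have to be the edges of the path `L`. -/
def IsCrossSection (T : Set (Finset (Fin n) × Finset (Fin n))) (k : ℕ)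
    (L : List (Finset (Fin n))) : Prop :=
  IsHypertriangulation k L ∧ ∀ S S' : Finset (Fin n), [S, S'] <:+: L ↔
    ∃ (A : Finset (Fin n)) (i j : Fin n), i < j ∧ (A, {i, j}) ∈ T ∧ A.card + 1 = k ∧
      S = insert i A ∧ S' = insert j A

/-- A lifting hypertriangulation at level `k`: the `k`-th cross-section of some fine zonotopal
tiling of the zonotope of the lifted configuration. -/
def IsLifting (a : Fin n → ℝ) (k : ℕ) (L : List (Finset (Fin n))) : Prop :=
  ∃ T, IsFineTiling (lift a) T ∧ IsCrossSection T k L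

/-- A flip between two different lifting hypertriangulations, induced by a zonotopal flip. -/
def LiftingFlip (a : Fin n → ℝ) (k : ℕ) (L L' : List (Finset (Fin n))) : Prop :=
  L ≠ L' ∧ ∃ T T', IsFineTiling (lift a) T ∧ IsFineTiling (lift a) T' ∧ IsFlip (lift a) T T' ∧
    IsCrossSection T k L ∧ IsCrossSection T' k L'

/-- A reduced lifting hypertriangulation at level `k`: any three consecutive vertices
`S₁, S₂, S₃` satisfy `|S₁ ∩ S₂ ∩ S₃| = k - 2`. -/
def IsReducedLifting (a : Fin n → ℝ) (k : ℕ) (L : List (Finset (Fin n))) : Prop :=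
  IsLifting a k L ∧
    ∀ S₁ S₂ S₃ : Finset (Fin n), [S₁, S₂, S₃] <:+: L → (S₁ ∩ S₂ ∩ S₃).card + 2 = k

/-- `L'` arises from `L` by throwing away the middle one of three consecutive vertices
`S₁, S₂, S₃` with `|S₁ ∩ S₂ ∩ S₃| ≠ k - 2`. -/
def Remove (k : ℕ) (L L' : List (Finset (Fin n))) : Prop :=
  ∃ (P Q : List (Finset (Fin n))) (S₁ S₂ S₃ : Finset (Fin n)),
    (S₁ ∩ S₂ ∩ S₃).card + 2 ≠ k ∧ L = P ++ [S₁, S₂, S₃] ++ Q ∧ L' = P ++ [S₁, S₃] ++ Q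

/-- `R` is the reduced lifting hypertriangulation corresponding to the lifting
hypertriangulation `L`. -/
def ReducesTo (a : Fin n → ℝ) (k : ℕ) (L R : List (Finset (Fin n))) : Prop :=
  Relation.ReflTransGen (Remove k) L R ∧ IsReducedLifting a k R

theorem IsFlip.symm {E : Type*} [AddCommGroup E] [Module ℝ E] {v : Fin n → E}
    {T₁ T₂ : Set (Finset (Fin n) × Finset (Fin n))} (h : IsFlip v T₁ T₂) : IsFlip v T₂ T₁ := by
  obtain ⟨C, hC, h1, h2⟩ := h
  exact ⟨C, hC, by omega, fun C' hC' h3 h4 => (h2 C' hC' h3 h4).symm⟩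

theorem LiftingFlip.symm {a : Fin n → ℝ} {k : ℕ} {L L' : List (Finset (Fin n))}
    (h : LiftingFlip a k L L') : LiftingFlip a k L' L := by
  obtain ⟨hne, T, T', hT, hT', hf, hL, hL'⟩ := h
  exact ⟨hne.symm, T', T, hT', hT, hf.symm, hL', hL⟩

/-- The flip graph of reduced lifting hypertriangulations at level `k`: two different ones are
adjacent if they are the reductions of two lifting hypertriangulations related by a flip. -/
def reducedFlipGraph (a : Fin n → ℝ) (k : ℕ) :
    SimpleGraph {R : List (Finset (Fin n)) // IsReducedLifting a k R} where
  Adj R R' := R ≠ R' ∧ ∃ L L', LiftingFlip a k L L' ∧ ReducesTo a k L R ∧ ReducesTo a k L' R'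
  symm := ⟨fun _ _ ⟨hne, L, L', hf, h1, h2⟩ => ⟨hne.symm, L', L, hf.symm, h2, h1⟩⟩
  loopless := ⟨fun _ h => h.1 rfl⟩

end Hyper

end HyperTri

/-!
The proof passes from tilings to words in the weak order on permutations. A monotone path from the
lowest to the highest point of the zonotope lists the indices `0, …, n - 1` in some order, that is,
it is a permutation, and pushing a path over a tile `(A, {i, j})` is an adjacent swap
`α i j β → α j i β` in which `α` lists `A`. A sequence of such swaps from the increasing to the
decreasing permutation is a *full walk*. The fine zonotopal tilings are exactly the sets of tiles of
full walks (`FullWalk.isFineTiling`, `IsFineTiling.exists_fullWalk`). For the second statement, a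
path through edges of the tiling that is not yet the right boundary of the zonotope has, to the
right of each of its edges that is not on that boundary, a tile of which the edge is a lower left or
an upper left edge. A lower left edge followed by an upper left edge belongs to the same tile, and
the path can be pushed over this tile.

Two moves transform full walks into each other: exchanging two independent swaps, which does not
change the tiling, and a braid move, which is a flip (`FullWalk.isFlip_of_braid`). The cross-section
at level `k + 1` is read off from the tiles with `|A| = k`. Its *weight* is the sum, over these
tiles, of the number of elements of `A` strictly between `i` and `j`. Discarding a vertex in a
reduction does not change the weight (`IsPath.removes`). A braid move over the hexagon with lowest
vertex `B` affects the level `k + 1` only if `|B| = k`, when it amounts to discarding a vertex, or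
if `|B| = k - 1`, when it changes the weight by exactly one (`FullWalk.move`). For an arbitrary flip
of tilings the weight changes by at most one (`FullWalk.weight_le_of_isFlip`): the order of the
swaps of a full walk determines the sets `A`, and a flip changes the orientation of one triple only.

There is a full walk of weight `0` to which every full walk can be brought by weight-lowering moves
(`exists_least_walk`), and a full walk of weight `k (n - k - 1)` that can be brought to every other
one in this way (`exists_greatest_walk`). These two walks give vertices of the flip graph at
distance at least `k (n - k - 1)`. For two arbitrary vertices of weights `w` and `w'`, the
routes through the least and through the greatest vertex have lengths at most `w + w'` and
`2 k (n - k - 1) - w - w'`, and the shorter one has length at most `k (n - k - 1)`.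

Reductions exist and are unique: vertices can be discarded in any order with the same result
(`IsPath.eq_reduceList`), and the path obtained by discarding a vertex is again the cross-section of
a full walk (`Walk.exists_levelPath_of_remove`).
-/

namespace HyperTri

open scoped List

variable {n : ℕ}

/-! ### Walks in the weak order -/

/-- A tile `(A, {i, j})` with `i < j`, recorded as the triple `(A, i, j)`. -/
abbrev Tile (n : ℕ) := Finset (Fin n) × Fin n × Fin n

/-- `Walk p ts q`: the list `q` arises from the list `p` by adjacent swaps `α i j β → α j i β` with
`i < j`. The list `ts` records for each swap the tile `(A, i, j)`, with `A` the set of entries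
of `α`. -/
inductive Walk : List (Fin n) → List (Tile n) → List (Fin n) → Prop
  | nil (p : List (Fin n)) : Walk p [] p
  | cons (α β : List (Fin n)) {i j : Fin n} {ts : List (Tile n)} {q : List (Fin n)} (hij : i < j)
      (h : Walk (α ++ j :: i :: β) ts q) : Walk (α ++ i :: j :: β) ((α.toFinset, i, j) :: ts) q

theorem Walk.single (α β : List (Fin n)) {i j : Fin n} (hij : i < j) :
    Walk (α ++ i :: j :: β) [(α.toFinset, i, j)] (α ++ j :: i :: β) :=
  .cons α β hij (.nil _)

theorem Walk.perm {p q : List (Fin n)} {ts : List (Tile n)} (h : Walk p ts q) : p.Perm q := by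
  induction h with
  | nil p => exact .refl _
  | cons α β hij h ih => exact (List.Perm.append_left α (.swap _ _ _)).trans ih

theorem Walk.append {p q r : List (Fin n)} {ts us : List (Tile n)} (h : Walk p ts q)
    (h' : Walk q us r) : Walk p (ts ++ us) r := by
  induction h with
  | nil p => exact h'
  | cons α β hij h ih => exact .cons α β hij (ih h')

theorem Walk.split {p q : List (Fin n)} {us ts : List (Tile n)} (h : Walk p (us ++ ts) q) :
    ∃ r, Walk p us r ∧ Walk r ts q := by
  induction us generalizing p with
  | nil => exact ⟨p, .nil _, h⟩
  | cons t us ih =>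
    cases h with
    | cons α β hij h =>
      obtain ⟨r, h1, h2⟩ := ih h
      exact ⟨r, .cons α β hij h1, h2⟩

theorem Walk.cons_inv {p q : List (Fin n)} {A : Finset (Fin n)} {i j : Fin n} {ts : List (Tile n)}
    (h : Walk p ((A, i, j) :: ts) q) : ∃ α β, p = α ++ i :: j :: β ∧ A = α.toFinset ∧ i < j ∧
      Walk (α ++ j :: i :: β) ts q := by
  cases h with
  | cons α β hij h => exact ⟨α, β, rfl, rfl, hij, h⟩

theorem Walk.nil_inv {p q : List (Fin n)} (h : Walk p [] q) : p = q := by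
  cases h; rfl

/-- Enlarge the set `A` of a tile by `B`. -/
def addBase (B : Finset (Fin n)) (t : Tile n) : Tile n := (B ∪ t.1, t.2)

theorem Walk.append_left (ξ : List (Fin n)) {p q : List (Fin n)} {ts : List (Tile n)}
    (h : Walk p ts q) : Walk (ξ ++ p) (ts.map (addBase ξ.toFinset)) (ξ ++ q) := by
  induction h with
  | nil p => exact .nil _
  | cons α β hij h ih =>
    have := Walk.cons (ξ ++ α) β hij (by simpa using ih)
    simpa [addBase] using this

theorem Walk.append_right (ζ : List (Fin n)) {p q : List (Fin n)} {ts : List (Tile n)}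
    (h : Walk p ts q) : Walk (p ++ ζ) ts (q ++ ζ) := by
  induction h with
  | nil p => exact .nil _
  | cons α β hij h ih =>
    have := Walk.cons α (β ++ ζ) hij (by simpa using ih)
    simpa using this

theorem Walk.mem_tile {p q : List (Fin n)} {ts : List (Tile n)} (h : Walk p ts q) (hp : p.Nodup)
    {A : Finset (Fin n)} {i j : Fin n} (ht : (A, i, j) ∈ ts) :
    i < j ∧ i ∉ A ∧ j ∉ A ∧ A.card + 2 ≤ p.length ∧ i ∈ p ∧ j ∈ p ∧ ∀ x ∈ A, x ∈ p := by
  induction h with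
  | nil p => simp at ht
  | @cons α β i' j' ts q hij h ih =>
    have hperm := List.Perm.append_left α (List.Perm.swap j' i' β)
    rcases List.mem_cons.1 ht with ht | ht
    · cases ht
      have := List.toFinset_card_le α
      simp [List.nodup_append] at hp
      simp
      grind
    · have := ih (hperm.nodup_iff.1 hp) ht
      simp at this ⊢
      grind

/-- Move an entry `x` to the left through `γ`, from the end to the front. -/
def moveLeft (x : Fin n) : List (Fin n) → List (Tile n)
  | [] => []
  | e :: γ => (moveLeft x γ).map (addBase {e}) ++ [(∅, e, x)]

/-- Move an entry `x` to the right through `δ`, from the front to the end. -/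
def moveRight (x : Fin n) : List (Fin n) → List (Tile n)
  | [] => []
  | e :: δ => (∅, x, e) :: (moveRight x δ).map (addBase {e})

theorem walk_moveLeft (x : Fin n) (γ : List (Fin n)) (h : ∀ e ∈ γ, e < x) :
    Walk (γ ++ [x]) (moveLeft x γ) (x :: γ) := by
  induction γ with
  | nil => exact .nil _
  | cons e γ ih =>
    have h1 := (ih fun e he => h e (by simp [he])).append_left [e]
    have h2 := Walk.single [] γ (h e (by simp))
    simpa [moveLeft] using h1.append h2

theorem walk_moveRight (x : Fin n) (δ : List (Fin n)) (h : ∀ e ∈ δ, x < e) :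
    Walk (x :: δ) (moveRight x δ) (δ ++ [x]) := by
  induction δ with
  | nil => exact .nil _
  | cons e δ ih =>
    have h1 := (ih fun e he => h e (by simp [he])).append_left [e]
    have h2 := Walk.single [] δ (h e (by simp))
    simpa [moveRight] using h2.append h1

/-! ### Inversions -/

theorem append_cons_inj_of_nodup {α β α' β' : List (Fin n)} {x : Fin n}
    (hp : (α ++ x :: β).Nodup) (h : α ++ x :: β = α' ++ x :: β') : α = α' ∧ β = β' := by
  have h1 : x ∉ α ∧ x ∉ β := by
    simp [List.nodup_append] at hp
    grind
  obtain ⟨h2, -, h3⟩ := (List.append_cons_inj_of_notMem h1.1 h1.2).1 h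
  exact ⟨h2, h3⟩

theorem not_sublist_pair_swap {p : List (Fin n)} (hp : p.Nodup) {a b : Fin n}
    (h : [a, b] <+ p) : ¬ [b, a] <+ p := by
  induction p with
  | nil => simp at h
  | cons c p ih =>
    intro h'
    rw [List.nodup_cons] at hp
    rw [List.sublist_cons_iff] at h h'
    simp at h h'
    have mem : ∀ {x y : Fin n}, [x, y] <+ p → x ∈ p ∧ y ∈ p := fun h =>
      ⟨h.subset (by simp), h.subset (by simp)⟩
    rcases h with h | ⟨rfl, h⟩ <;> rcases h' with h' | ⟨rfl, h'⟩
    · exact ih hp.2 h h'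
    · exact hp.1 (mem h).2
    · exact hp.1 (mem h').2
    · exact hp.1 h

theorem sublist_pair_or {p : List (Fin n)} {a b : Fin n} (ha : a ∈ p) (hb : b ∈ p) (hab : a ≠ b) :
    [a, b] <+ p ∨ [b, a] <+ p := by
  obtain ⟨s, t, rfl⟩ := List.append_of_mem ha
  simp [hab.symm] at hb
  rcases hb with hb | hb
  · right
    exact List.Sublist.append (l₁ := [b]) (l₂ := s) (by simpa) (by simp)
  · left
    exact List.Sublist.trans (by simpa) (List.sublist_append_right _ _)

theorem sublist_pair_append {p q : List (Fin n)} {a b : Fin n} :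
    [a, b] <+ p ++ q ↔ [a, b] <+ p ∨ [a, b] <+ q ∨ a ∈ p ∧ b ∈ q := by
  induction p with
  | nil => simp
  | cons c p ih =>
    rw [List.cons_append, List.sublist_cons_iff, List.sublist_cons_iff, ih]
    simp
    grind

theorem sublist_pair_cons {p : List (Fin n)} {a b c : Fin n} :
    [a, b] <+ c :: p ↔ [a, b] <+ p ∨ a = c ∧ b ∈ p := by
  rw [List.sublist_cons_iff]
  simp

theorem sublist_pair_of_swap {α β : List (Fin n)} {i j a b : Fin n}
    (h : [a, b] <+ α ++ i :: j :: β) (hab : ¬ (a = i ∧ b = j)) : [a, b] <+ α ++ j :: i :: β := by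
  simp only [sublist_pair_append, sublist_pair_cons, List.mem_cons] at h ⊢
  grind

/-- A walk only creates inversions, one for each of its tiles. -/
theorem Walk.inverted_iff {p q : List (Fin n)} {ts : List (Tile n)} (h : Walk p ts q)
    (hp : p.Nodup) {a b : Fin n} (hab : a < b) :
    [b, a] <+ q ↔ [b, a] <+ p ∨ (a, b) ∈ ts.map Prod.snd := by
  induction h with
  | nil p => simp
  | @cons α β i j ts q hij h ih =>
    have hperm := List.Perm.append_left α (List.Perm.swap j i β)
    rw [ih (hperm.nodup_iff.1 hp), List.map_cons, List.mem_cons, Prod.mk_inj]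
    by_cases hij' : a = i ∧ b = j
    · obtain ⟨rfl, rfl⟩ := hij'
      have : [b, a] <+ α ++ b :: a :: β := by
        simp
      simp [this]
    · have : [b, a] <+ α ++ j :: i :: β ↔ [b, a] <+ α ++ i :: j :: β := by
        refine ⟨fun h' => sublist_pair_of_swap h' (by grind), fun h' => sublist_pair_of_swap h' ?_⟩
        rintro ⟨rfl, rfl⟩
        exact absurd hij hab.asymm
      rw [this]
      tauto

theorem Walk.nodup_pairs {p q : List (Fin n)} {ts : List (Tile n)} (h : Walk p ts q)
    (hp : p.Nodup) : (ts.map Prod.snd).Nodup ∧ ∀ a b, (a, b) ∈ ts.map Prod.snd → [a, b] <+ p := by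
  induction h with
  | nil p => simp
  | @cons α β i j ts q hij h ih =>
    have hperm := List.Perm.append_left α (List.Perm.swap j i β)
    have hp' := hperm.nodup_iff.1 hp
    obtain ⟨h1, h2⟩ := ih hp'
    have hinv : [j, i] <+ α ++ j :: i :: β := by simp
    refine ⟨?_, ?_⟩
    · rw [List.map_cons, List.nodup_cons]
      exact ⟨fun h' => not_sublist_pair_swap hp' hinv (h2 _ _ h'), h1⟩
    · intro a b hab
      rw [List.map_cons, List.mem_cons, Prod.mk_inj] at hab
      rcases hab with ⟨rfl, rfl⟩ | hab
      · simp
      · refine sublist_pair_of_swap (h2 _ _ hab) ?_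
        rintro ⟨rfl, rfl⟩
        obtain ⟨t, ht, hte⟩ := List.mem_map.1 hab
        obtain ⟨A, i', j'⟩ := t
        cases hte
        exact (h.mem_tile hp' ht).1.asymm hij

/-- In the weak order, containment of inversion sets is realized by a walk. -/
theorem exists_walk {p q : List (Fin n)} (hpq : p.Perm q) (hp : p.Nodup)
    (h : ∀ a b, a < b → [b, a] <+ p → [b, a] <+ q) : ∃ ts, Walk p ts q := by
  induction q generalizing p with
  | nil => exact ⟨[], by rw [hpq.eq_nil]; exact .nil _⟩
  | cons c q ih =>
    have hq := hpq.nodup_iff.1 hp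
    obtain ⟨γ, δ, rfl⟩ := List.append_of_mem (hpq.mem_iff.2 (List.mem_cons_self ..))
    have hperm : (γ ++ δ).Perm q :=
      (List.perm_cons c).1 ((List.perm_middle.symm).trans hpq)
    have hlt : ∀ e ∈ γ, e < c := by
      intro e he
      by_contra hlt
      have hne : e ≠ c := by
        rintro rfl
        simp [List.nodup_append] at hp
        grind
      have h1 := h c e (lt_of_le_of_ne (not_lt.1 hlt) hne.symm) (by
        simp [sublist_pair_append, sublist_pair_cons, he])
      rw [sublist_pair_cons] at h1
      rw [List.nodup_cons] at hq
      rcases h1 with h1 | h1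
      · exact hq.1 (h1.subset (by simp))
      · exact hne h1.1
    have hsub : γ ++ δ <+ γ ++ c :: δ := List.Sublist.append_left (List.sublist_cons_self ..) _
    obtain ⟨ts, hts⟩ := ih hperm (hp.sublist hsub) (by
      intro a b hab h'
      have h2 := h a b hab (h'.trans hsub)
      rw [sublist_pair_cons] at h2
      rcases h2 with h2 | h2
      · exact h2
      · rw [List.nodup_cons, ← hperm.mem_iff, ← h2.1] at hq
        exact absurd (h'.subset (by simp)) hq.1)
    have h3 := (walk_moveLeft c γ hlt).append_right δ
    have h4 := hts.append_left [c]
    exact ⟨_, by simpa using h3.append h4⟩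

/-! ### Commutations and braid moves -/

/-- The tile `t` lies entirely above the tile `s`: the corresponding swaps act on disjoint pairs of
positions, the one of `s` being further to the left. -/
def Below (s t : Tile n) : Prop := insert s.2.1 (insert s.2.2 s.1) ⊆ t.1

/-- The elementary moves on the tile lists of walks: exchanging two consecutive swaps that act on
disjoint pairs of positions, and replacing a braid in which `i < j < l` are reversed starting with
the swap of `i, j` by the one starting with the swap of `j, l`. -/
inductive Move : List (Tile n) → List (Tile n) → Prop
  | comm (u v : List (Tile n)) {s t : Tile n} (h : Below s t ∨ Below t s) :
      Move (u ++ s :: t :: v) (u ++ t :: s :: v)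
  | braid (u v : List (Tile n)) (A : Finset (Fin n)) {i j l : Fin n} (hij : i < j) (hjl : j < l) :
      Move (u ++ (A, i, j) :: (insert j A, i, l) :: (A, j, l) :: v)
        (u ++ (insert i A, j, l) :: (A, i, l) :: (insert l A, i, j) :: v)

theorem Move.context (u v : List (Tile n)) {ts ts' : List (Tile n)} (h : Move ts ts') :
    Move (u ++ ts ++ v) (u ++ ts' ++ v) := by
  cases h with
  | comm u' v' h => simpa using Move.comm (u ++ u') (v' ++ v) h
  | braid u' v' A hij hjl => simpa using Move.braid (u ++ u') (v' ++ v) A hij hjl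

theorem Move.map_addBase (B : Finset (Fin n)) {ts ts' : List (Tile n)} (h : Move ts ts') :
    Move (ts.map (addBase B)) (ts'.map (addBase B)) := by
  cases h with
  | @comm u' v' s t h =>
    have h' : Below (addBase B s) (addBase B t) ∨ Below (addBase B t) (addBase B s) := by
      simp only [Below, addBase] at h ⊢
      grind
    simpa using Move.comm (u'.map (addBase B)) (v'.map (addBase B)) h'
  | braid u' v' A hij hjl =>
    simpa [addBase, Finset.union_insert] using
      Move.braid (u'.map (addBase B)) (v'.map (addBase B)) (B ∪ A) hij hjl

/-- Finite sequences of moves. -/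
abbrev Moves : List (Tile n) → List (Tile n) → Prop := Relation.ReflTransGen Move

theorem Moves.context (u v : List (Tile n)) {ts ts' : List (Tile n)} (h : Moves ts ts') :
    Moves (u ++ ts ++ v) (u ++ ts' ++ v) :=
  Relation.ReflTransGen.lift (fun ts => u ++ ts ++ v) (fun _ _ h => h.context u v) _ _ h

theorem Moves.append_left (u : List (Tile n)) {ts ts' : List (Tile n)} (h : Moves ts ts') :
    Moves (u ++ ts) (u ++ ts') := by
  simpa using h.context u []

theorem Moves.append_right (v : List (Tile n)) {ts ts' : List (Tile n)} (h : Moves ts ts') :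
    Moves (ts ++ v) (ts' ++ v) := by
  simpa using h.context [] v

theorem Moves.map_addBase (B : Finset (Fin n)) {ts ts' : List (Tile n)} (h : Moves ts ts') :
    Moves (ts.map (addBase B)) (ts'.map (addBase B)) :=
  Relation.ReflTransGen.lift _ (fun _ _ h => h.map_addBase B) _ _ h

theorem Moves.pass_right {s : Tile n} {us : List (Tile n)}
    (h : ∀ t ∈ us, Below s t ∨ Below t s) : Moves (s :: us) (us ++ [s]) := by
  induction us with
  | nil => exact .refl
  | cons t us ih =>
    exact .head (Move.comm [] us (h t (by simp)))
      (Moves.append_left [t] (ih fun t ht => h t (by simp [ht])))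

theorem Moves.pass_left {s : Tile n} {us : List (Tile n)}
    (h : ∀ t ∈ us, Below s t ∨ Below t s) : Moves (us ++ [s]) (s :: us) := by
  induction us with
  | nil => exact .refl
  | cons t us ih =>
    exact (Moves.append_left [t] (ih fun t ht => h t (by simp [ht]))).tail
      (Move.comm [] us (h t (by simp)).symm)

theorem Walk.comm {p q : List (Fin n)} (hp : p.Nodup) {s t : Tile n} {v : List (Tile n)}
    (h : Walk p (s :: t :: v) q) (hst : Below s t ∨ Below t s) : Walk p (t :: s :: v) q := by
  obtain ⟨A, i, j⟩ := s
  obtain ⟨A', i', j'⟩ := t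
  obtain ⟨α, β, rfl, rfl, hij, h1⟩ := h.cons_inv
  obtain ⟨α', β', he, rfl, hij', h2⟩ := h1.cons_inv
  simp only [Below] at hst
  -- The second swap involves neither of the positions of the first one.
  rw [List.append_eq_append_iff] at he
  rcases he with ⟨ζ, h3, h4⟩ | ⟨ζ, h3, h4⟩
  · rcases ζ with _ | ⟨a, _ | ⟨b, ζ⟩⟩
    · simp at h3 h4
      subst h3
      simp [List.nodup_append] at hp
      rcases hst with hst | hst
      · have := hst (Finset.mem_insert_self _ _)
        simp at this
        grind
      · have := hst (Finset.mem_insert_self _ _)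
        simp at this
        grind
    · simp at h3 h4
      subst h3
      simp [List.nodup_append] at hp
      rcases hst with hst | hst
      · have := hst (Finset.mem_insert_self _ _)
        simp at this
        grind
      · have := hst (Finset.mem_insert_self _ _)
        simp at this
        grind
    · simp at h3 h4
      obtain ⟨rfl, rfl, rfl⟩ := h4
      subst h3
      have e : (α ++ j :: i :: ζ).toFinset = (α ++ i :: j :: ζ).toFinset := by ext; simp; tauto
      rw [e]
      have h5 := Walk.cons α (ζ ++ j' :: i' :: β') hij (by simpa using h2)
      have h6 := Walk.cons (α ++ i :: j :: ζ) β' hij' (by simpa using h5)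
      simpa using h6
  · rcases ζ with _ | ⟨a, _ | ⟨b, ζ⟩⟩
    · simp at h3 h4
      subst h3
      simp [List.nodup_append] at hp
      rcases hst with hst | hst
      · have := hst (Finset.mem_insert_self _ _)
        simp at this
        grind
      · have := hst (Finset.mem_insert_self _ _)
        simp at this
        grind
    · simp at h3 h4
      subst h3
      simp [List.nodup_append] at hp
      rcases hst with hst | hst
      · have := hst (x := j) (by simp)
        simp at this
        grind
      · have := hst (x := j') (by simp)
        simp at this
        grind
    · simp at h3 h4
      obtain ⟨rfl, rfl, rfl⟩ := h4
      subst h3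
      have e : (α' ++ i' :: j' :: ζ).toFinset = (α' ++ j' :: i' :: ζ).toFinset := by
        ext; simp; tauto
      rw [e]
      have h5 := Walk.cons (α' ++ j' :: i' :: ζ) β hij (by simpa using h2)
      have h6 := Walk.cons α' (ζ ++ i :: j :: β) hij' (by simpa using h5)
      simpa using h6

theorem Walk.braid {p q : List (Fin n)} (hp : p.Nodup) {A : Finset (Fin n)} {i j l : Fin n}
    {v : List (Tile n)} (h : Walk p ((A, i, j) :: (insert j A, i, l) :: (A, j, l) :: v) q) :
    Walk p ((insert i A, j, l) :: (A, i, l) :: (insert l A, i, j) :: v) q := by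
  obtain ⟨α, β, rfl, rfl, hij, h1⟩ := h.cons_inv
  obtain ⟨α', β', he, hA, hil, h2⟩ := h1.cons_inv
  obtain ⟨α₃, β₃, he₃, hA₃, hjl, h3⟩ := h2.cons_inv
  have hp1 := ((List.Perm.swap j i β).append_left α).nodup_iff.1 hp
  obtain ⟨rfl, rfl⟩ := append_cons_inj_of_nodup (α := α ++ [j]) (by simpa using hp1)
    (by simpa using he)
  have hp2 := ((List.Perm.swap l i β').append_left (α ++ [j])).nodup_iff.1 (by simpa using hp1)
  obtain ⟨rfl, h4⟩ := append_cons_inj_of_nodup (α := α) (by simpa using hp2)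
    (by simpa using he₃)
  obtain ⟨-, rfl⟩ := List.cons_eq_cons.1 h4
  have h5 := Walk.cons (α ++ [l]) β' hij (by simpa using h3)
  have h6 := Walk.cons α (j :: β') hil (by simpa using h5)
  have h7 := Walk.cons (α ++ [i]) β' hjl (by simpa using h6)
  have e : ∀ x, (α ++ [x]).toFinset = insert x α.toFinset := by
    intro x; ext; simp
  simpa [e] using h7

theorem Walk.move {p q : List (Fin n)} (hp : p.Nodup) {ts ts' : List (Tile n)} (h : Walk p ts q)
    (hm : Move ts ts') : Walk p ts' q := by
  cases hm with
  | comm u v hst =>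
    obtain ⟨r, h1, h2⟩ := h.split
    exact h1.append (h2.comm (h1.perm.nodup_iff.1 hp) hst)
  | braid u v A hij hjl =>
    obtain ⟨r, h1, h2⟩ := h.split
    exact h1.append (h2.braid (h1.perm.nodup_iff.1 hp))

/-! ### Normal forms of walks -/

theorem moveLeft_append (x : Fin n) (α β : List (Fin n)) :
    moveLeft x (α ++ β) = (moveLeft x β).map (addBase α.toFinset) ++ moveLeft x α := by
  induction α with
  | nil =>
    have : addBase (∅ : Finset (Fin n)) = id := by
      ext1 t; simp [addBase]
    simp [moveLeft, this]
  | cons e α ih =>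
    have : addBase (insert e α.toFinset) = addBase {e} ∘ addBase α.toFinset := by
      ext1 t; simp [addBase]
    simp [moveLeft, ih, this]

theorem moveRight_append (x : Fin n) (α β : List (Fin n)) :
    moveRight x (α ++ β) = moveRight x α ++ (moveRight x β).map (addBase α.toFinset) := by
  induction α with
  | nil =>
    have : addBase (∅ : Finset (Fin n)) = id := by
      ext1 t; simp [addBase]
    simp [moveRight, this]
  | cons e α ih =>
    have : addBase (insert e α.toFinset) = addBase {e} ∘ addBase α.toFinset := by
      ext1 t; simp [addBase]
    simp [moveRight, ih, this]

theorem mem_moveLeft {x : Fin n} {γ : List (Fin n)} {t : Tile n} (h : t ∈ moveLeft x γ) :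
    t.1 ⊆ γ.toFinset ∧ t.2.1 ∈ γ ∧ t.2.2 = x := by
  induction γ generalizing t with
  | nil => simp [moveLeft] at h
  | cons e γ ih =>
    simp only [moveLeft, List.mem_append, List.mem_map, List.mem_singleton] at h
    rcases h with ⟨t, ht, rfl⟩ | rfl
    · have := ih ht
      simp [addBase]
      grind
    · simp

theorem mem_moveRight {x : Fin n} {γ : List (Fin n)} {t : Tile n} (h : t ∈ moveRight x γ) :
    t.1 ⊆ γ.toFinset ∧ t.2.1 = x ∧ t.2.2 ∈ γ := by
  induction γ generalizing t with
  | nil => simp [moveRight] at h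
  | cons e γ ih =>
    simp only [moveRight, List.mem_cons, List.mem_map] at h
    rcases h with rfl | ⟨t, ht, rfl⟩
    · simp
    · have := ih ht
      simp [addBase]
      grind

theorem moveLeft_pair (x : Fin n) (α β : List (Fin n)) (i j : Fin n) :
    moveLeft x (α ++ i :: j :: β) =
      (moveLeft x β).map (addBase (insert i (insert j α.toFinset))) ++
        (insert i α.toFinset, j, x) :: (α.toFinset, i, x) :: moveLeft x α := by
  have : addBase (insert i (insert j α.toFinset)) =
      addBase α.toFinset ∘ addBase {i} ∘ addBase {j} := by
    ext1 t; simp [addBase]; grind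
  simp [moveLeft_append, moveLeft, this]
  simp [addBase]

theorem moveRight_pair (x : Fin n) (α β : List (Fin n)) (i j : Fin n) :
    moveRight x (α ++ i :: j :: β) =
      moveRight x α ++ (α.toFinset, x, i) :: (insert i α.toFinset, x, j) ::
      (moveRight x β).map (addBase (insert i (insert j α.toFinset))) := by
  have : addBase (insert i (insert j α.toFinset)) =
      addBase α.toFinset ∘ addBase {i} ∘ addBase {j} := by
    ext1 t; simp [addBase]; grind
  simp [moveRight_append, moveRight, this]
  simp [addBase]

theorem below_addBase {s t : Tile n} {B : Finset (Fin n)}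
    (h : insert s.2.1 (insert s.2.2 s.1) ⊆ B) : Below s (addBase B t) :=
  h.trans Finset.subset_union_left

theorem below_of_mem_moveLeft {x : Fin n} {γ : List (Fin n)} {s t : Tile n}
    (ht : t ∈ moveLeft x γ) (h : insert x γ.toFinset ⊆ s.1) : Below t s := by
  obtain ⟨h1, h2, h3⟩ := mem_moveLeft ht
  rw [Below, h3]
  rw [Finset.insert_subset_iff] at h
  exact Finset.insert_subset (h.2 (by simpa)) (Finset.insert_subset h.1 (h1.trans h.2))

theorem below_of_mem_moveRight {x : Fin n} {γ : List (Fin n)} {B : Finset (Fin n)} {s t : Tile n}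
    (ht : t ∈ (moveRight x γ).map (addBase B)) (h : insert x (B ∪ γ.toFinset) ⊆ s.1) :
    Below t s := by
  obtain ⟨t', ht', rfl⟩ := List.mem_map.1 ht
  obtain ⟨h1, h2, h3⟩ := mem_moveRight ht'
  rw [Below, addBase, h2]
  rw [Finset.insert_subset_iff, Finset.union_subset_iff] at h
  exact Finset.insert_subset h.1 (Finset.insert_subset (h.2.2 (by simpa))
    (Finset.union_subset h.2.1 (h1.trans h.2.2)))

/-- Every walk that brings its largest entry `x` to the front can be transformed, by commutations
and by braid moves in one direction only, into a walk that starts with all the swaps of `x`: a swap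
not involving `x` is moved past the later swaps of `x` one by one. -/
theorem Walk.normalize_max {x : Fin n} {ts : List (Tile n)} :
    ∀ {γ δ ε : List (Fin n)}, Walk (γ ++ x :: δ) ts (x :: ε) → (γ ++ x :: δ).Nodup →
      (∀ e ∈ γ ++ δ, e < x) → ∃ us, Walk (γ ++ δ) us ε ∧
        Moves ts (moveLeft x γ ++ us.map (addBase {x})) := by
  induction ts with
  | nil =>
    intro γ δ ε h hp hx
    rcases γ with _ | ⟨e, γ⟩
    · obtain rfl : δ = ε := by simpa using h.nil_inv
      exact ⟨[], .nil _, by simpa [moveLeft] using .refl⟩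
    · have := hx e (by simp)
      have := h.nil_inv
      grind
  | cons t ts ih =>
    intro γ δ ε h hp hx
    obtain ⟨A, i, j⟩ := t
    obtain ⟨α, β, he, rfl, hij, h1⟩ := h.cons_inv
    have hp1 := ((List.Perm.swap j i β).append_left α).nodup_iff.1 (he ▸ hp)
    have hxm : x ∈ α ++ i :: j :: β := by simp [← he]
    have hxi : x ≠ i := by
      rintro rfl
      have : j ∈ γ ++ x :: δ := by simp [he]
      simp at this hx
      grind
    simp only [List.mem_append, List.mem_cons, hxi, false_or] at hxm
    rcases hxm with hxm | rfl | hxm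
    · obtain ⟨α₁, α₂, rfl⟩ := List.append_of_mem hxm
      obtain ⟨rfl, rfl⟩ := append_cons_inj_of_nodup hp
        (by simpa using he : γ ++ x :: δ = α₁ ++ x :: (α₂ ++ i :: j :: β))
      obtain ⟨us, hus, hmv⟩ := ih (γ := γ) (δ := α₂ ++ j :: i :: β) (by simpa using h1)
        (by simpa using hp1) (by simp at hx ⊢; grind)
      refine ⟨((γ ++ α₂).toFinset, i, j) :: us,
        by simpa using Walk.cons (γ ++ α₂) β hij (by simpa using hus), ?_⟩
      refine (Moves.append_left [_] hmv).trans ?_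
      have e : ((γ ++ x :: α₂).toFinset, i, j) = addBase {x} ((γ ++ α₂).toFinset, i, j) := by
        simp [addBase]
      rw [List.map_cons, ← e]
      have := Moves.pass_right (s := ((γ ++ x :: α₂).toFinset, i, j)) (us := moveLeft x γ)
        fun t ht => .inr (below_of_mem_moveLeft ht (by intro y; simp; tauto))
      simpa using this.append_right _
    · obtain ⟨rfl, rfl⟩ := append_cons_inj_of_nodup hp
        (by simpa using he : γ ++ x :: δ = (α ++ [i]) ++ x :: β)
      obtain ⟨us, hus, hmv⟩ := ih (γ := α) (δ := i :: δ) (by simpa using h1)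
        (by simpa using hp1) (by simpa using hx)
      refine ⟨us, by simpa using hus, ?_⟩
      simpa [moveLeft_append, moveLeft, addBase] using Moves.append_left [(α.toFinset, i, x)] hmv
    · obtain ⟨β₁, β₂, rfl⟩ := List.append_of_mem hxm
      obtain ⟨rfl, rfl⟩ := append_cons_inj_of_nodup hp
        (by simpa using he : γ ++ x :: δ = (α ++ i :: j :: β₁) ++ x :: β₂)
      obtain ⟨us, hus, hmv⟩ := ih (γ := α ++ j :: i :: β₁) (δ := δ) (by simpa using h1)
        (by simpa using hp1) (by simp at hx ⊢; grind)
      refine ⟨(α.toFinset, i, j) :: us, by simpa using Walk.cons α (β₁ ++ δ) hij (by simpa using hus), ?_⟩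
      refine (Moves.append_left [_] hmv).trans ?_
      have hjx : j < x := hx j (by simp)
      rw [moveLeft_pair, moveLeft_pair, Finset.insert_comm j i]
      set A := α.toFinset with hA
      set P := (moveLeft x β₁).map (addBase (insert i (insert j A)))
      have h2 := Moves.pass_right (s := (A, i, j)) (us := P) (by
        intro t ht
        obtain ⟨t, ht, rfl⟩ := List.mem_map.1 ht
        exact .inl (below_addBase (by intro y; simp)))
      have h3 := Moves.pass_right (s := (insert x A, i, j)) (us := moveLeft x α)
        fun t ht => .inr (below_of_mem_moveLeft ht subset_rfl)
      have h4 := Move.braid P (moveLeft x α ++ us.map (addBase {x})) A hij hjx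
      have h5 := Moves.append_right ((insert j A, i, x) :: (A, j, x) ::
        (moveLeft x α ++ us.map (addBase {x}))) h2
      have h6 := Moves.context (P ++ [(insert i A, j, x), (A, i, x)]) (us.map (addBase {x})) h3
      have e : addBase {x} (A, i, j) = (insert x A, i, j) := by simp [addBase]
      rw [List.map_cons, e]
      simp only [List.append_assoc, List.cons_append, List.nil_append] at h4 h5 h6 ⊢
      exact (h5.tail h4).trans h6

/-- Every walk that brings its smallest entry `x` to the end can be transformed into a walk that
starts with all the swaps of `x`; the braid moves used all go in the direction opposite to those in
`Walk.normalize_max`. -/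
theorem Walk.normalize_min {x : Fin n} {ts : List (Tile n)} :
    ∀ {γ δ ε : List (Fin n)}, Walk (γ ++ x :: δ) ts (ε ++ [x]) → (γ ++ x :: δ).Nodup →
      (∀ e ∈ γ ++ δ, x < e) → ∃ us, Walk (γ ++ δ) us ε ∧
        Moves ((moveRight x δ).map (addBase γ.toFinset) ++ us) ts := by
  induction ts with
  | nil =>
    intro γ δ ε h hp hx
    have h1 := h.nil_inv
    obtain ⟨rfl, rfl⟩ := append_cons_inj_of_nodup hp h1
    exact ⟨[], by simpa using .nil _, by simpa [moveRight] using .refl⟩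
  | cons t ts ih =>
    intro γ δ ε h hp hx
    obtain ⟨A, i, j⟩ := t
    obtain ⟨α, β, he, rfl, hij, h1⟩ := h.cons_inv
    have hp1 := ((List.Perm.swap j i β).append_left α).nodup_iff.1 (he ▸ hp)
    have hxm : x ∈ α ++ i :: j :: β := by simp [← he]
    have hxj : x ≠ j := by
      rintro rfl
      have : i ∈ γ ++ x :: δ := by simp [he]
      simp at this hx
      grind
    simp only [List.mem_append, List.mem_cons, hxj, false_or] at hxm
    rcases hxm with hxm | rfl | hxm
    · obtain ⟨α₁, α₂, rfl⟩ := List.append_of_mem hxm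
      obtain ⟨rfl, rfl⟩ := append_cons_inj_of_nodup hp
        (by simpa using he : γ ++ x :: δ = α₁ ++ x :: (α₂ ++ i :: j :: β))
      obtain ⟨us, hus, hmv⟩ := ih (γ := γ) (δ := α₂ ++ j :: i :: β) (by simpa using h1)
        (by simpa using hp1) (by simp at hx ⊢; grind)
      refine ⟨((γ ++ α₂).toFinset, i, j) :: us,
        by simpa using Walk.cons (γ ++ α₂) β hij (by simpa using hus), ?_⟩
      refine Relation.ReflTransGen.trans ?_ (Moves.append_left [_] hmv)
      have hxi : x < i := hx i (by simp)
      rw [moveRight_pair, moveRight_pair, Finset.insert_comm j i]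
      set A := (γ ++ α₂).toFinset with hA
      have e1 : γ.toFinset ∪ α₂.toFinset = A := by simp [hA]
      have e2 : (γ ++ x :: α₂).toFinset = insert x A := by ext; simp [hA]
      simp only [List.map_append, List.map_cons, addBase, e1, e2, Finset.union_insert]
      set P := (moveRight x α₂).map (addBase γ.toFinset)
      set Q := ((moveRight x β).map (addBase (insert i (insert j α₂.toFinset)))).map
        (addBase γ.toFinset)
      have h2 := Moves.pass_left (s := (A, i, j)) (us := Q) (by
        intro t ht
        obtain ⟨t', ht', rfl⟩ := List.mem_map.1 ht
        obtain ⟨t, -, rfl⟩ := List.mem_map.1 ht'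
        left
        rw [Below, addBase, addBase, ← Finset.union_assoc]
        refine subset_trans ?_ Finset.subset_union_left
        simp only [Finset.union_insert, e1]
        intro y; simp)
      have h3 := Moves.pass_left (s := (insert x A, i, j)) (us := P)
        fun t ht => .inr (below_of_mem_moveRight ht (by rw [e1]))
      have h4 := Move.braid P (Q ++ us) A hxi hij
      have h5 := Moves.context (P ++ [(A, x, i), (insert i A, x, j)]) us h2
      have h6 := Moves.append_right ((A, x, j) :: (insert j A, x, i) :: (Q ++ us)) h3
      simp only [List.append_assoc, List.cons_append, List.nil_append] at h4 h5 h6 ⊢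
      exact (h5.tail h4).trans h6
    · obtain ⟨rfl, rfl⟩ := append_cons_inj_of_nodup hp he
      obtain ⟨us, hus, hmv⟩ := ih (γ := γ ++ [j]) (δ := β) (by simpa using h1)
        (by simpa using hp1) (by simpa using hx)
      refine ⟨us, by simpa using hus, ?_⟩
      have e : addBase (insert j γ.toFinset) = addBase γ.toFinset ∘ addBase {j} := by
        ext1 t; simp [addBase]
      have e' : (γ ++ [j]).toFinset = insert j γ.toFinset := by ext; simp
      rw [e', e] at hmv
      simpa [moveRight, addBase] using Moves.append_left [(γ.toFinset, x, j)] hmv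
    · obtain ⟨β₁, β₂, rfl⟩ := List.append_of_mem hxm
      obtain ⟨rfl, rfl⟩ := append_cons_inj_of_nodup hp
        (by simpa using he : γ ++ x :: δ = (α ++ i :: j :: β₁) ++ x :: β₂)
      obtain ⟨us, hus, hmv⟩ := ih (γ := α ++ j :: i :: β₁) (δ := δ) (by simpa using h1)
        (by simpa using hp1) (by simp at hx ⊢; grind)
      refine ⟨(α.toFinset, i, j) :: us,
        by simpa using Walk.cons α (β₁ ++ δ) hij (by simpa using hus), ?_⟩
      refine Relation.ReflTransGen.trans ?_ (Moves.append_left [_] hmv)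
      have e : (α ++ i :: j :: β₁).toFinset = (α ++ j :: i :: β₁).toFinset := by
        ext; simp; tauto
      rw [e]
      have := Moves.pass_left (s := (α.toFinset, i, j))
        (us := (moveRight x δ).map (addBase (α ++ j :: i :: β₁).toFinset)) (by
        intro t ht
        obtain ⟨t, ht, rfl⟩ := List.mem_map.1 ht
        exact .inl (below_addBase (by intro y; simp; tauto)))
      simpa using this.append_right us

/-! ### The weight of a walk and its extreme values -/

/-- The number of `y ∈ A` with `i < y < j` for a tile `(A, i, j)` with `|A| = k`; tiles at other
heights have weight `0`. -/
def tileWeight (k : ℕ) (t : Tile n) : ℕ :=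
  if t.1.card = k then (t.1.filter fun y => t.2.1 < y ∧ y < t.2.2).card else 0

/-- The total weight of the tiles `(A, i, j)` with `|A| = k`. -/
def weight (k : ℕ) (ts : List (Tile n)) : ℕ := (ts.map (tileWeight k)).sum

theorem mem_moveLeft_lt {x : Fin n} {γ : List (Fin n)} (hγ : γ.Pairwise (· < ·)) {t : Tile n}
    (ht : t ∈ moveLeft x γ) : ∀ y ∈ t.1, y < t.2.1 := by
  induction γ generalizing t with
  | nil => simp [moveLeft] at ht
  | cons e γ ih =>
    rw [List.pairwise_cons] at hγ
    simp only [moveLeft, List.mem_append, List.mem_map, List.mem_singleton] at ht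
    rcases ht with ⟨s, hs, rfl⟩ | rfl
    · intro y hy
      simp only [addBase, Finset.mem_union, Finset.mem_singleton] at hy
      rcases hy with rfl | hy
      · exact hγ.1 _ (mem_moveLeft hs).2.1
      · exact ih hγ.2 hs y hy
    · simp

theorem addBase_empty : addBase (∅ : Finset (Fin n)) = id := by
  ext1 t; simp [addBase]

/-- A walk from an increasing list to its reverse to which all others can be transformed by
commutations and braid moves: the largest entry moves to the front first, then the next one and so
on. -/
theorem exists_least_walk (l : List (Fin n)) (hl : l.Pairwise (· > ·)) :
    ∃ c, Walk l.reverse c l ∧ (∀ t ∈ c, ∀ y ∈ t.1, ¬ (t.2.1 < y ∧ y < t.2.2)) ∧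
      ∀ ts, Walk l.reverse ts l → Moves ts c := by
  induction l with
  | nil =>
    refine ⟨[], .nil _, by simp, fun ts h => ?_⟩
    cases ts with
    | nil => exact .refl
    | cons t ts =>
      obtain ⟨α, β, h, -⟩ := h.cons_inv
      simp at h
  | cons x r ih =>
    rw [List.pairwise_cons] at hl
    obtain ⟨c, hc, hct, hmv⟩ := ih hl.2
    have hnd : r.Nodup := hl.2.imp fun h => h.ne'
    have hlt : ∀ e ∈ r.reverse, e < x := by simpa using hl.1
    refine ⟨moveLeft x r.reverse ++ c.map (addBase {x}), ?_, ?_, ?_⟩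
    · simpa using (walk_moveLeft x _ hlt).append (hc.append_left [x])
    · intro t ht y hy
      rcases List.mem_append.1 ht with ht | ht
      · have := mem_moveLeft_lt (List.pairwise_reverse.2 hl.2) ht y hy
        exact fun h => h.1.asymm this
      · obtain ⟨s, hs, rfl⟩ := List.mem_map.1 ht
        obtain ⟨A, i, j⟩ := s
        simp only [addBase, Finset.mem_union, Finset.mem_singleton] at hy ⊢
        rcases hy with rfl | hy
        · have := hc.mem_tile (by simpa) hs
          exact fun h => h.2.asymm (hlt _ this.2.2.2.2.2.1)
        · exact hct _ hs y hy
    · intro ts hts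
      have hnd' : (r.reverse ++ x :: []).Nodup := by
        simpa [List.nodup_append, hnd] using fun a ha => (hl.1 a ha).ne
      obtain ⟨us, hus, hmv'⟩ := Walk.normalize_max (γ := r.reverse) (δ := []) (ε := r)
        (by simpa using hts) hnd' (by simpa using hl.1)
      exact hmv'.trans (Moves.append_left _ ((hmv us (by simpa using hus)).map_addBase _))

theorem weight_moveRight (k : ℕ) {x : Fin n} (δ : List (Fin n)) (B : Finset (Fin n))
    (hδ : δ.Pairwise (· < ·)) (hB : ∀ y ∈ B, x < y ∧ ∀ e ∈ δ, y < e) (hx : ∀ e ∈ δ, x < e) :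
    weight k ((moveRight x δ).map (addBase B)) =
      if B.card ≤ k ∧ k < B.card + δ.length then k else 0 := by
  induction δ generalizing B with
  | nil => simp [moveRight, weight]
  | cons e δ ih =>
    rw [List.pairwise_cons] at hδ
    have he : e ∉ B := fun h => ((hB e h).2 e (by simp)).false
    have hcard : (insert e B).card = B.card + 1 := Finset.card_insert_of_notMem he
    have h1 := ih (insert e B) hδ.2 (by
      intro y hy
      rcases Finset.mem_insert.1 hy with rfl | hy
      · exact ⟨hx _ (by simp), hδ.1⟩
      · exact ⟨(hB y hy).1, fun e' he' => (hB y hy).2 e' (by simp [he'])⟩)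
      fun e' he' => hx e' (by simp [he'])
    have h2 : addBase B ∘ addBase {e} = addBase (insert e B) := by
      ext1 t; simp [addBase]
    have h3 : B.filter (fun y => x < y ∧ y < e) = B :=
      Finset.filter_true_of_mem fun y hy => ⟨(hB y hy).1, (hB y hy).2 e (by simp)⟩
    rw [moveRight, List.map_cons, List.map_map, h2, weight, List.map_cons, List.sum_cons]
    rw [weight] at h1
    rw [h1, hcard]
    simp only [tileWeight, addBase, Finset.union_empty, h3, List.length_cons]
    split_ifs <;> omega

/-- A walk from an increasing list to its reverse which can be transformed to all others by
commutations and braid moves: the smallest entry moves to the end first, then the next one and so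
on. In each tile `(A, i, j)` of it, `A` consists of the entries between `i` and `j`. -/
theorem exists_greatest_walk (k : ℕ) (l : List (Fin n)) (hl : l.Pairwise (· < ·)) :
    ∃ c, Walk l c l.reverse ∧ weight k c = k * (l.length - k - 1) ∧
      ∀ ts, Walk l ts l.reverse → Moves c ts := by
  induction l with
  | nil =>
    refine ⟨[], .nil _, by simp [weight], fun ts h => ?_⟩
    cases ts with
    | nil => exact .refl
    | cons t ts =>
      obtain ⟨α, β, h, -⟩ := h.cons_inv
      simp at h
  | cons x r ih =>
    rw [List.pairwise_cons] at hl
    obtain ⟨c, hc, hcw, hmv⟩ := ih hl.2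
    have hnd : r.Nodup := hl.2.imp fun h => h.ne
    refine ⟨moveRight x r ++ c, ?_, ?_, ?_⟩
    · simpa using (walk_moveRight x _ hl.1).append (hc.append_right [x])
    · have h1 := weight_moveRight k (x := x) r ∅ hl.2 (by simp) hl.1
      rw [addBase_empty, List.map_id] at h1
      have h2 : weight k (moveRight x r ++ c) = weight k (moveRight x r) + weight k c := by
        simp [weight]
      rw [h2, h1, hcw]
      simp only [Finset.card_empty, zero_le, true_and, zero_add, List.length_cons]
      split_ifs with h
      · obtain ⟨d, hd⟩ := Nat.exists_eq_add_of_lt h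
        rw [show r.length + 1 - k - 1 = (r.length - k - 1) + 1 by omega]
        ring
      · rw [show r.length - k - 1 = 0 by omega, show r.length + 1 - k - 1 = 0 by omega,
          zero_add]
    · intro ts hts
      have hnd' : ([] ++ x :: r).Nodup := by
        simpa [hnd] using fun h => (hl.1 x h).false
      obtain ⟨us, hus, hmv'⟩ := Walk.normalize_min (γ := []) (δ := r) (ε := r.reverse)
        (by simpa using hts) hnd' (by simpa using hl.1)
      rw [List.toFinset_nil, addBase_empty, List.map_id] at hmv'
      exact (Moves.append_left _ (hmv us (by simpa using hus))).trans hmv'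

/-! ### Cross-sections of walks -/

/-- The vertex of the path at level `m` to which a tile leads, if it crosses that level. -/
def tileTop (m : ℕ) (t : Tile n) : Option (Finset (Fin n)) :=
  if t.1.card + 1 = m then some (insert t.2.2 t.1) else none

/-- The path at level `m` of a walk that starts at `p` and has tiles `ts`: the successive sets of
the first `m` entries. -/
def levelPath (m : ℕ) (p : List (Fin n)) (ts : List (Tile n)) : List (Finset (Fin n)) :=
  (p.take m).toFinset :: ts.filterMap (tileTop m)

theorem toFinset_take_swap {m : ℕ} {α β : List (Fin n)} {i j : Fin n} (h : α.length + 1 ≠ m) :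
    ((α ++ i :: j :: β).take m).toFinset = ((α ++ j :: i :: β).take m).toFinset := by
  rcases lt_or_gt_of_ne h with h | h
  · obtain ⟨d, rfl⟩ : ∃ d, m = α.length + (d + 2) := ⟨m - (α.length + 2), by omega⟩
    ext
    simp [List.take_append]
    tauto
  · have : m - α.length = 0 := by omega
    simp [List.take_append, this]

theorem toFinset_take_length {m : ℕ} {α β : List (Fin n)} {i : Fin n} (h : α.length + 1 = m) :
    ((α ++ i :: β).take m).toFinset = insert i α.toFinset := by
  subst h
  have : List.take (α.length + 1) α = α := List.take_of_length_le (by omega)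
  ext
  simp [List.take_append, this]

theorem levelPath_cons_of_ne {m : ℕ} {α β : List (Fin n)} {i j : Fin n} {ts : List (Tile n)}
    (hp : (α ++ i :: j :: β).Nodup) (h : α.length + 1 ≠ m) :
    levelPath m (α ++ i :: j :: β) ((α.toFinset, i, j) :: ts) =
      levelPath m (α ++ j :: i :: β) ts := by
  have : α.toFinset.card = α.length := List.toFinset_card_of_nodup (List.nodup_append.1 hp).1
  rw [levelPath, levelPath, toFinset_take_swap h, List.filterMap_cons_none]
  simp [tileTop, this, h]

theorem levelPath_cons_of_eq {m : ℕ} {α β : List (Fin n)} {i j : Fin n} {ts : List (Tile n)}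
    (hp : (α ++ i :: j :: β).Nodup) (h : α.length + 1 = m) :
    levelPath m (α ++ i :: j :: β) ((α.toFinset, i, j) :: ts) =
      insert i α.toFinset :: levelPath m (α ++ j :: i :: β) ts := by
  have : α.toFinset.card = α.length := List.toFinset_card_of_nodup (List.nodup_append.1 hp).1
  rw [levelPath, levelPath, toFinset_take_length h, toFinset_take_length h,
    List.filterMap_cons_some]
  simp [tileTop, this, h]

/-- Induction along the path at level `m` of a walk. -/
theorem Walk.levelPath_induction {m : ℕ} {q : List (Fin n)}
    {P : List (Tile n) → List (Finset (Fin n)) → Prop}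
    (nil : P [] [(q.take m).toFinset])
    (skip : ∀ A i j ts L, i < j → i ∉ A → j ∉ A → A.card + 1 ≠ m → P ts L → P ((A, i, j) :: ts) L)
    (step : ∀ A i j ts L, i < j → i ∉ A → j ∉ A → A.card + 1 = m →
      P ts (insert j A :: L) → P ((A, i, j) :: ts) (insert i A :: insert j A :: L))
    {p : List (Fin n)} {ts : List (Tile n)} (h : Walk p ts q) (hp : p.Nodup) :
    P ts (levelPath m p ts) := by
  induction h with
  | nil p => exact nil
  | @cons α β i j ts q hij h ih =>
    have hp' := ((List.Perm.swap j i β).append_left α).nodup_iff.1 hp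
    have hcard : α.toFinset.card = α.length := List.toFinset_card_of_nodup (List.nodup_append.1 hp).1
    obtain ⟨-, hi, hj, -⟩ := (Walk.single α β hij).mem_tile hp (List.mem_singleton_self _)
    by_cases hm : α.length + 1 = m
    · rw [levelPath_cons_of_eq hp hm]
      have h1 := ih nil hp'
      rw [levelPath, toFinset_take_length hm] at h1 ⊢
      exact step _ _ _ _ _ hij hi hj (by omega) h1
    · rw [levelPath_cons_of_ne hp hm]
      exact skip _ _ _ _ _ hij hi hj (by omega) (ih nil hp')

theorem Walk.getLast?_levelPath {m : ℕ} {p q : List (Fin n)} {ts : List (Tile n)}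
    (h : Walk p ts q) (hp : p.Nodup) :
    (levelPath m p ts).getLast? = some (q.take m).toFinset :=
  h.levelPath_induction (P := fun _ L => L.getLast? = some (q.take m).toFinset) (by simp)
    (fun _ _ _ _ _ _ _ _ _ h => h) (fun _ _ _ _ _ _ _ _ _ h => by simpa using h) hp

theorem Walk.isChain_levelPath {m : ℕ} {p q : List (Fin n)} {ts : List (Tile n)}
    (h : Walk p ts q) (hp : p.Nodup) : (levelPath m p ts).IsChain Step :=
  h.levelPath_induction (P := fun _ L => L.IsChain Step) (by simp)
    (fun _ _ _ _ _ _ _ _ _ h => h)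
    (fun A i j _ _ hij hi hj _ h => List.isChain_cons_cons.2 ⟨⟨A, i, j, hi, hj, hij, rfl, rfl⟩, h⟩)
    hp

theorem Walk.card_levelPath {m : ℕ} {p q : List (Fin n)} {ts : List (Tile n)}
    (h : Walk p ts q) (hp : p.Nodup) (hm : m ≤ p.length) :
    ∀ S ∈ levelPath m p ts, S.card = m :=
  h.levelPath_induction (P := fun _ L => ∀ S ∈ L, S.card = m)
    (by
      have h1 := (h.perm.nodup_iff.1 hp).sublist (List.take_sublist m q)
      have h2 := h.perm.length_eq
      simp [List.toFinset_card_of_nodup h1]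
      omega)
    (fun _ _ _ _ _ _ _ _ _ h => h)
    (fun A i j _ _ hij hi hj hA h => by
      simp only [List.mem_cons, forall_eq_or_imp] at h ⊢
      exact ⟨by rw [Finset.card_insert_of_notMem hi, hA], h⟩)
    hp

theorem pair_infix_cons_cons {β : Type*} {a b S S' : β} {L : List β} :
    [S, S'] <:+: a :: b :: L ↔ S = a ∧ S' = b ∨ [S, S'] <:+: b :: L := by
  rw [List.infix_cons_iff]
  simp

theorem Walk.infix_levelPath_iff {m : ℕ} {p q : List (Fin n)} {ts : List (Tile n)}
    (h : Walk p ts q) (hp : p.Nodup) {S S' : Finset (Fin n)} :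
    [S, S'] <:+: levelPath m p ts ↔
      ∃ A i j, (A, i, j) ∈ ts ∧ A.card + 1 = m ∧ S = insert i A ∧ S' = insert j A := by
  refine h.levelPath_induction (P := fun ts L => [S, S'] <:+: L ↔
    ∃ A i j, (A, i, j) ∈ ts ∧ A.card + 1 = m ∧ S = insert i A ∧ S' = insert j A) ?_ ?_ ?_ hp
  · simp only [List.not_mem_nil, false_and, exists_false, iff_false]
    intro h
    simpa using h.length_le
  · intro A i j ts L _ _ _ hA ih
    rw [ih]
    refine ⟨fun ⟨B, x, y, h1, h2⟩ => ⟨B, x, y, .tail _ h1, h2⟩, fun ⟨B, x, y, h1, h2⟩ => ?_⟩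
    rcases List.mem_cons.1 h1 with h1 | h1
    · cases h1
      exact absurd h2.1 hA
    · exact ⟨B, x, y, h1, h2⟩
  · intro A i j ts L _ _ _ hA ih
    rw [pair_infix_cons_cons, ih]
    constructor
    · rintro (⟨h1, h2⟩ | ⟨B, x, y, h1, h2⟩)
      · exact ⟨A, i, j, .head _, hA, h1, h2⟩
      · exact ⟨B, x, y, .tail _ h1, h2⟩
    · rintro ⟨B, x, y, h1, h2⟩
      rcases List.mem_cons.1 h1 with h1 | h1
      · cases h1
        exact .inl h2.2
      · exact .inr ⟨B, x, y, h1, h2⟩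

/-- The number of elements common to `S` and `S'` that lie between the two elements exchanged in a
step from `S` to `S'`. -/
def stepWeight (S S' : Finset (Fin n)) : ℕ :=
  ((S ∩ S').filter fun y => (∃ i ∈ S \ S', i < y) ∧ ∃ j ∈ S' \ S, y < j).card

/-- The total weight of the steps of a path. -/
def pathWeight : List (Finset (Fin n)) → ℕ
  | S :: S' :: L => stepWeight S S' + pathWeight (S' :: L)
  | _ => 0

theorem insert_inter_insert {A : Finset (Fin n)} {i j : Fin n} (hij : i ≠ j) :
    insert i A ∩ insert j A = A := by
  ext; simp; grind

theorem stepWeight_insert {A : Finset (Fin n)} {i j : Fin n} (hi : i ∉ A) (hj : j ∉ A)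
    (hij : i < j) :
    stepWeight (insert i A) (insert j A) = (A.filter fun y => i < y ∧ y < j).card := by
  rw [stepWeight, insert_inter_insert hij.ne]
  congr 1
  ext y
  simp
  grind

theorem Walk.pathWeight_levelPath {k : ℕ} {p q : List (Fin n)} {ts : List (Tile n)}
    (h : Walk p ts q) (hp : p.Nodup) : pathWeight (levelPath (k + 1) p ts) = weight k ts := by
  refine h.levelPath_induction (P := fun ts L => pathWeight L = weight k ts) ?_ ?_ ?_ hp
  · simp [pathWeight, weight]
  · intro A i j ts L _ _ _ hA ih
    rw [ih]
    simp [weight, tileWeight]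
    grind
  · intro A i j ts L hij hi hj hA ih
    rw [pathWeight, ih, stepWeight_insert hi hj hij]
    simp [weight, tileWeight]
    grind

/-! ### Cross-sections of tilings are unique -/

/-- The collection of tiles recorded by a walk. -/
def tilesOf (ts : List (Tile n)) : Set (Finset (Fin n) × Finset (Fin n)) :=
  {p | ∃ t ∈ ts, p = (t.1, {t.2.1, t.2.2})}

theorem pair_eq_pair_of_lt {i j i' j' : Fin n} (h : i < j) (h' : i' < j')
    (he : ({i, j} : Finset (Fin n)) = {i', j'}) : i = i' ∧ j = j' := by
  have h1 : i = i' ∨ i = j' := by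
    have : i ∈ ({i', j'} : Finset (Fin n)) := he ▸ by simp
    simpa using this
  have h2 : j = i' ∨ j = j' := by
    have : j ∈ ({i', j'} : Finset (Fin n)) := he ▸ by simp
    simpa using this
  omega

theorem Walk.mem_tilesOf_iff {p q : List (Fin n)} {ts : List (Tile n)} (h : Walk p ts q)
    (hp : p.Nodup) {A : Finset (Fin n)} {i j : Fin n} (hij : i < j) :
    (A, {i, j}) ∈ tilesOf ts ↔ (A, i, j) ∈ ts := by
  constructor
  · rintro ⟨⟨A', i', j'⟩, ht, he⟩
    rw [Prod.mk_inj] at he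
    obtain ⟨rfl, rfl⟩ := pair_eq_pair_of_lt hij (h.mem_tile hp ht).1 he.2
    exact he.1 ▸ ht
  · exact fun ht => ⟨_, ht, rfl⟩

/-- A walk from the identity permutation to its reverse. -/
def FullWalk (ts : List (Tile n)) : Prop := Walk (List.finRange n) ts (List.finRange n).reverse

theorem toFinset_take_finRange (m : ℕ) :
    ((List.finRange n).take m).toFinset = Finset.univ.filter fun i : Fin n => i.val < m := by
  ext x
  simp only [List.mem_toFinset, List.mem_take_iff_getElem, Finset.mem_filter, Finset.mem_univ,
    true_and]
  constructor
  · rintro ⟨i, hi, rfl⟩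
    simp at hi ⊢
    omega
  · exact fun h => ⟨x, by simp; omega, by simp⟩

theorem toFinset_take_finRange_reverse (m : ℕ) :
    ((List.finRange n).reverse.take m).toFinset =
      Finset.univ.filter fun i : Fin n => n - m ≤ i.val := by
  ext x
  simp only [List.take_reverse, List.mem_toFinset, List.mem_reverse, List.mem_drop_iff_getElem,
    Finset.mem_filter, Finset.mem_univ, true_and]
  constructor
  · rintro ⟨i, hi, rfl⟩
    simp
  · intro h
    exact ⟨x - (n - m), by simp; omega, by ext; simp; omega⟩

/-- The path of a walk at level `m` is the cross-section of the corresponding tiling. -/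
theorem FullWalk.isCrossSection {ts : List (Tile n)} (h : FullWalk ts) (m : ℕ) :
    IsCrossSection (tilesOf ts) m (levelPath m (List.finRange n) ts) := by
  have hp := List.nodup_finRange n
  refine ⟨⟨?_, ?_, h.isChain_levelPath hp⟩, fun S S' => ?_⟩
  · simp [levelPath, toFinset_take_finRange]
  · rw [h.getLast?_levelPath hp, toFinset_take_finRange_reverse]
  · rw [h.infix_levelPath_iff hp]
    constructor
    · rintro ⟨A, i, j, ht, h1⟩
      have hij := (h.mem_tile hp ht).1
      exact ⟨A, i, j, hij, (h.mem_tilesOf_iff hp hij).2 ht, h1⟩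
    · rintro ⟨A, i, j, hij, ht, h1⟩
      exact ⟨A, i, j, (h.mem_tilesOf_iff hp hij).1 ht, h1⟩

theorem Step.sum_lt {S S' : Finset (Fin n)} (h : Step S S') :
    ∑ i ∈ S, i.val < ∑ i ∈ S', i.val := by
  obtain ⟨I, i, j, hi, hj, hij, rfl, rfl⟩ := h
  rw [Finset.sum_insert hi, Finset.sum_insert hj]
  have : i.val < j.val := hij
  omega

theorem nodup_of_isChain_step {L : List (Finset (Fin n))} (h : L.IsChain Step) : L.Nodup := by
  have : L.IsChain fun S S' => ∑ i ∈ S, i.val < ∑ i ∈ S', i.val := h.imp fun _ _ h => h.sum_lt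
  have htr : IsTrans (Finset (Fin n)) fun S S' => ∑ i ∈ S, i.val < ∑ i ∈ S', i.val :=
    ⟨fun _ _ _ => lt_trans⟩
  exact (List.isChain_iff_pairwise.1 this).imp fun h h' => by simp [h'] at h

theorem eq_of_pair_infix_iff {β : Type*} {L L' : List β} (hL : L.Nodup) (hL' : L'.Nodup)
    (h0 : L.head? = L'.head?) (h : ∀ S S', [S, S'] <:+: L ↔ [S, S'] <:+: L') : L = L' := by
  induction L generalizing L' with
  | nil =>
    cases L' with
    | nil => rfl
    | cons => simp at h0
  | cons x l ih =>
    obtain ⟨l', rfl⟩ : ∃ l', L' = x :: l' := by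
      cases L' with
      | nil => simp at h0
      | cons y l' => exact ⟨l', by simpa using h0.symm⟩
    rcases l with _ | ⟨y, l⟩
    · rcases l' with _ | ⟨y, l'⟩
      · rfl
      · exact absurd ((h x y).2 (pair_infix_cons_cons.2 (.inl ⟨rfl, rfl⟩)))
          fun h => by simpa using h.length_le
    · have h1 := (h x y).1 (pair_infix_cons_cons.2 (.inl ⟨rfl, rfl⟩))
      rcases l' with _ | ⟨y', l'⟩
      · exact absurd h1 fun h => by simpa using h.length_le
      · rw [List.nodup_cons] at hL hL'
        obtain rfl : y = y' := by
          rcases pair_infix_cons_cons.1 h1 with h1 | h1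
          · exact h1.2
          · exact absurd (h1.subset (by simp)) hL'.1
        rw [ih hL.2 hL'.2 rfl]
        intro S S'
        by_cases hS : S = x
        · subst hS
          exact iff_of_false (fun h => hL.1 (h.subset (by simp)))
            fun h => hL'.1 (h.subset (by simp))
        · have := h S S'
          rw [pair_infix_cons_cons, pair_infix_cons_cons] at this
          simpa [hS] using this

theorem IsCrossSection.unique {T : Set (Finset (Fin n) × Finset (Fin n))} {m : ℕ}
    {L L' : List (Finset (Fin n))} (h : IsCrossSection T m L) (h' : IsCrossSection T m L') :
    L = L' :=
  eq_of_pair_infix_iff (nodup_of_isChain_step h.1.chain) (nodup_of_isChain_step h'.1.chain)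
    (h.1.head.trans h'.1.head.symm) fun S S' => (h.2 S S').trans (h'.2 S S').symm

theorem FullWalk.eq_levelPath {ts : List (Tile n)} (h : FullWalk ts) {m : ℕ}
    {L : List (Finset (Fin n))} (hL : IsCrossSection (tilesOf ts) m L) :
    L = levelPath m (List.finRange n) ts :=
  hL.unique (h.isCrossSection m)

/-! ### Reduction of paths -/

/-- A path through `m`-element sets. -/
def IsPath (m : ℕ) (L : List (Finset (Fin n))) : Prop := L.IsChain Step ∧ ∀ S ∈ L, S.card = m

theorem FullWalk.isPath {ts : List (Tile n)} (h : FullWalk ts) {m : ℕ} (hm : m ≤ n) :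
    IsPath m (levelPath m (List.finRange n) ts) :=
  ⟨h.isChain_levelPath (List.nodup_finRange n),
    h.card_levelPath (List.nodup_finRange n) (by simpa using hm)⟩

theorem IsPath.tail {m : ℕ} {S : Finset (Fin n)} {L : List (Finset (Fin n))}
    (h : IsPath m (S :: L)) : IsPath m L :=
  ⟨h.1.tail, fun S' hS' => h.2 S' (by simp [hS'])⟩

theorem isPath_cons_cons {m : ℕ} {S S' : Finset (Fin n)} {L : List (Finset (Fin n))} :
    IsPath m (S :: S' :: L) ↔ S.card = m ∧ Step S S' ∧ IsPath m (S' :: L) := by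
  simp only [IsPath, List.isChain_cons_cons, List.forall_mem_cons]
  tauto

/-- Two consecutive steps `A ∪ {i} → A ∪ {j} → A ∪ {l}` with the same `A`. -/
def SameBase (S₁ S₂ S₃ : Finset (Fin n)) : Prop :=
  ∃ (A : Finset (Fin n)) (i j l : Fin n), i ∉ A ∧ j ∉ A ∧ l ∉ A ∧ i < j ∧ j < l ∧
    S₁ = insert i A ∧ S₂ = insert j A ∧ S₃ = insert l A

theorem SameBase.inter {S₁ S₂ S₃ : Finset (Fin n)} (h : SameBase S₁ S₂ S₃) :
    S₁ ∩ S₂ = S₂ ∩ S₃ ∧ S₁ ∩ S₃ = S₂ ∩ S₃ := by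
  obtain ⟨A, i, j, l, -, -, -, hij, hjl, rfl, rfl, rfl⟩ := h
  rw [insert_inter_insert hij.ne, insert_inter_insert hjl.ne, insert_inter_insert (hij.trans hjl).ne]
  exact ⟨rfl, rfl⟩

theorem SameBase.step {S₁ S₂ S₃ : Finset (Fin n)} (h : SameBase S₁ S₂ S₃) : Step S₁ S₃ := by
  obtain ⟨A, i, j, l, hi, -, hl, hij, hjl, rfl, rfl, rfl⟩ := h
  exact ⟨A, i, l, hi, hl, hij.trans hjl, rfl, rfl⟩

theorem sameBase_iff {m : ℕ} {S₁ S₂ S₃ : Finset (Fin n)} (h12 : Step S₁ S₂) (h23 : Step S₂ S₃)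
    (hm : S₂.card = m) : (SameBase S₁ S₂ S₃ ↔ (S₁ ∩ S₂ ∩ S₃).card + 2 ≠ m) ∧
      (SameBase S₁ S₂ S₃ ↔ S₁ ∩ S₂ = S₂ ∩ S₃) := by
  obtain ⟨A, i, j, hi, hj, hij, rfl, rfl⟩ := h12
  obtain ⟨B, j', l, hj', hl, hjl, h2, rfl⟩ := h23
  have h3 : insert i A ∩ insert j A = A := insert_inter_insert hij.ne
  have h4 : insert j A ∩ insert l B = B := by rw [h2]; exact insert_inter_insert hjl.ne
  have h5 : insert i A ∩ insert j A ∩ insert l B = A ∩ B := by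
    rw [h3]
    conv_rhs => rw [← h4, ← Finset.inter_assoc,
      Finset.inter_eq_left.2 (Finset.subset_insert j A)]
  have hAm : A.card + 1 = m := by rw [← hm, Finset.card_insert_of_notMem hj]
  rw [h5, h3, h4]
  by_cases hjj : j = j'
  · subst hjj
    obtain rfl : A = B := by
      rw [← Finset.erase_insert hj, h2, Finset.erase_insert hj']
    have hS : SameBase (insert i A) (insert j A) (insert l A) :=
      ⟨A, i, j, l, hi, hj, hl, hij, hjl, rfl, rfl, rfl⟩
    simp [hS]
    omega
  · have hjA : j' ∈ A := by
      have : j' ∈ insert j A := h2 ▸ Finset.mem_insert_self _ _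
      simpa [Ne.symm hjj] using this
    have hAB : A ∩ B = A.erase j' := by
      ext x
      have := Finset.ext_iff.1 h2 x
      simp at this ⊢
      grind
    have hcard : (A ∩ B).card + 1 = A.card := by
      rw [hAB]; exact Finset.card_erase_add_one hjA
    have hne : A ≠ B := by
      rintro rfl
      exact hj' hjA
    have hS : ¬ SameBase (insert i A) (insert j A) (insert l B) := by
      intro h
      have := h.inter.1
      rw [h3, h4] at this
      exact hne this
    simp [hS, hne]
    omega

/-- Removing redundant vertices keeps a path a path, and keeps its weight. -/
theorem IsPath.remove {m : ℕ} {L L' : List (Finset (Fin n))} (h : IsPath m L)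
    (hr : Remove m L L') : IsPath m L' ∧ pathWeight L' = pathWeight L := by
  obtain ⟨P, Q, S₁, S₂, S₃, hc, rfl, rfl⟩ := hr
  induction P with
  | nil =>
    simp only [List.nil_append, List.cons_append, isPath_cons_cons] at h ⊢
    obtain ⟨h1, h12, h2, h23, h3⟩ := h
    have hS := ((sameBase_iff h12 h23 h2).1).2 hc
    refine ⟨⟨h1, hS.step, h3⟩, ?_⟩
    obtain ⟨A, i, j, l, hi, hj, hl, hij, hjl, rfl, rfl, rfl⟩ := hS
    rw [pathWeight, pathWeight, pathWeight, stepWeight_insert hi hj hij,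
      stepWeight_insert hj hl hjl, stepWeight_insert hi hl (hij.trans hjl), ← add_assoc,
      ← Finset.card_union_of_disjoint]
    · congr 2
      ext y
      have : y ∈ A → y ≠ j := fun h h' => hj (h' ▸ h)
      simp only [Finset.mem_filter, Finset.mem_union]
      grind
    · rw [Finset.disjoint_filter]
      exact fun y _ h1 h2 => h1.2.asymm h2.1
  | cons S P ih =>
    obtain ⟨h1, h2⟩ := ih h.tail
    rcases P with _ | ⟨S', P⟩ <;>
    · simp only [List.cons_append, List.nil_append, isPath_cons_cons, pathWeight] at h h1 h2 ⊢
      refine ⟨⟨h.1, h.2.1, h1⟩, ?_⟩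
      rw [h2]

theorem IsPath.removes {m : ℕ} {L L' : List (Finset (Fin n))} (h : IsPath m L)
    (hr : Relation.ReflTransGen (Remove m) L L') :
    IsPath m L' ∧ pathWeight L' = pathWeight L := by
  induction hr with
  | refl => exact ⟨h, rfl⟩
  | tail _ hr ih =>
    obtain ⟨h1, h2⟩ := ih.1.remove hr
    exact ⟨h1, h2.trans ih.2⟩

/-- Put `S` in front of a reduced path, removing the second vertex if it becomes redundant. -/
def consReduced (m : ℕ) (S : Finset (Fin n)) : List (Finset (Fin n)) → List (Finset (Fin n))
  | S₂ :: S₃ :: L => if (S ∩ S₂ ∩ S₃).card + 2 = m then S :: S₂ :: S₃ :: L else S :: S₃ :: L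
  | L => S :: L

/-- The reduced path corresponding to a path. -/
def reduceList (m : ℕ) : List (Finset (Fin n)) → List (Finset (Fin n))
  | [] => []
  | S :: L => consReduced m S (reduceList m L)

theorem IsPath.reduceList {m : ℕ} {S : Finset (Fin n)} {L : List (Finset (Fin n))}
    (h : IsPath m (S :: L)) : ∃ L', HyperTri.reduceList m (S :: L) = S :: L' ∧ IsPath m (S :: L') := by
  induction L generalizing S with
  | nil => exact ⟨[], rfl, h⟩
  | cons S₂ L ih =>
    rw [isPath_cons_cons] at h
    obtain ⟨L', h1, h2⟩ := ih h.2.2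
    rw [HyperTri.reduceList, h1]
    rcases L' with _ | ⟨S₃, L'⟩
    · exact ⟨[S₂], rfl, isPath_cons_cons.2 ⟨h.1, h.2.1, h2⟩⟩
    · rw [consReduced]
      split_ifs with hc
      · exact ⟨_, rfl, isPath_cons_cons.2 ⟨h.1, h.2.1, h2⟩⟩
      · rw [isPath_cons_cons] at h2
        exact ⟨_, rfl, isPath_cons_cons.2
          ⟨h.1, ((sameBase_iff h.2.1 h2.2.1 h2.1).1.2 hc).step, h2.2.2⟩⟩

/-- The reduced path does not depend on the order in which vertices are removed. -/
theorem IsPath.reduceList_eq_of_remove {m : ℕ} {L L' : List (Finset (Fin n))} (h : IsPath m L)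
    (hr : Remove m L L') : HyperTri.reduceList m L = HyperTri.reduceList m L' := by
  obtain ⟨P, Q, S₁, S₂, S₃, hc, rfl, rfl⟩ := hr
  induction P with
  | nil =>
    simp only [List.nil_append, List.cons_append, isPath_cons_cons] at h ⊢
    obtain ⟨h1, h12, h2, h23, h3⟩ := h
    have hS := ((sameBase_iff h12 h23 h2).1).2 hc
    obtain ⟨L, hL, hL'⟩ := h3.reduceList
    change consReduced m S₁ (consReduced m S₂ (HyperTri.reduceList m (S₃ :: Q))) =
      consReduced m S₁ (HyperTri.reduceList m (S₃ :: Q))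
    rw [hL]
    rcases L with _ | ⟨S₄, L⟩
    · simp only [consReduced, hc, if_false]
    · rw [isPath_cons_cons] at hL'
      obtain ⟨h3', h34, -⟩ := hL'
      obtain ⟨e1, e2⟩ := sameBase_iff h23 h34 h3'
      obtain ⟨e3, e4⟩ := sameBase_iff hS.step h34 h3'
      rw [hS.inter.2, ← e2, e1] at e4
      by_cases h234 : (S₂ ∩ S₃ ∩ S₄).card + 2 = m
      · have h134 : (S₁ ∩ S₃ ∩ S₄).card + 2 = m := by
          by_contra h'
          exact (e4.1 (e3.2 h')) h234
        simp only [consReduced, h234, h134, hc, if_true, if_false]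
      · have h134 : (S₁ ∩ S₃ ∩ S₄).card + 2 ≠ m := e3.1 (e4.2 h234)
        have hS' := e1.2 h234
        have h124 : (S₁ ∩ S₂ ∩ S₄).card + 2 ≠ m := by
          refine (sameBase_iff h12 hS'.step h2).1.1 ((sameBase_iff h12 hS'.step h2).2.2 ?_)
          rw [hS.inter.1, hS'.inter.2, hS'.inter.1]
        simp only [consReduced, h234, h134, h124, if_false]
  | cons S P ih =>
    simp only [List.cons_append] at h ih ⊢
    rw [HyperTri.reduceList, HyperTri.reduceList, ih h.tail]

theorem reduceList_eq_self {m : ℕ} {L : List (Finset (Fin n))}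
    (h : ∀ S₁ S₂ S₃, [S₁, S₂, S₃] <:+: L → (S₁ ∩ S₂ ∩ S₃).card + 2 = m) : reduceList m L = L := by
  induction L with
  | nil => rfl
  | cons S L ih =>
    rw [reduceList, ih fun S₁ S₂ S₃ h' => h _ _ _ (List.infix_cons h')]
    rcases L with _ | ⟨S₂, _ | ⟨S₃, L⟩⟩
    · rfl
    · rfl
    · rw [consReduced, if_pos (h S S₂ S₃ ⟨[], L, by simp⟩)]

theorem IsPath.eq_reduceList {m : ℕ} {L R : List (Finset (Fin n))} (h : IsPath m L)
    (hr : Relation.ReflTransGen (Remove m) L R)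
    (hR : ∀ S₁ S₂ S₃, [S₁, S₂, S₃] <:+: R → (S₁ ∩ S₂ ∩ S₃).card + 2 = m) :
    R = HyperTri.reduceList m L := by
  induction hr using Relation.ReflTransGen.head_induction_on with
  | refl => exact (reduceList_eq_self hR).symm
  | head hr _ ih => rw [h.reduceList_eq_of_remove hr, ih (h.remove hr).1]

/-! ### Reduced paths are paths of walks -/

/-- A walk without swaps at the positions `m`, `m + 1` acts separately on the first `m` entries and
on the remaining ones. -/
theorem Walk.split_at_level {m : ℕ} {p q : List (Fin n)} {ts : List (Tile n)} (h : Walk p ts q)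
    (hp : p.Nodup) (hts : ∀ t ∈ ts, t.1.card + 1 ≠ m) {p₁ p₂ : List (Fin n)} (he : p = p₁ ++ p₂)
    (hm : p₁.length = m) : ∃ q₁ q₂, q = q₁ ++ q₂ ∧ (∃ us, Walk p₁ us q₁) ∧ ∃ us, Walk p₂ us q₂ := by
  induction h generalizing p₁ p₂ with
  | nil p => exact ⟨p₁, p₂, he, ⟨_, .nil _⟩, ⟨_, .nil _⟩⟩
  | @cons α β i j ts q hij h ih =>
    have hp' := ((List.Perm.swap j i β).append_left α).nodup_iff.1 hp
    have hcard : α.toFinset.card = α.length := List.toFinset_card_of_nodup (List.nodup_append.1 hp).1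
    rw [List.forall_mem_cons] at hts
    have hα : α.length + 1 ≠ m := by simpa [hcard] using hts.1
    have he' := he
    rw [List.append_eq_append_iff] at he'
    rcases he' with ⟨ζ, h3, h4⟩ | ⟨ζ, h3, h4⟩
    · rcases ζ with _ | ⟨a, _ | ⟨b, ζ⟩⟩
      · simp only [List.append_nil, List.nil_append] at h3 h4
        subst h3 h4
        obtain ⟨q₁, q₂, h5, h6, us, h7⟩ := ih hp' hts.2 rfl hm
        exact ⟨q₁, q₂, h5, h6, _, .cons [] β hij h7⟩
      · simp [h3] at hm
        omega
      · simp only [List.cons_append, List.cons.injEq] at h4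
        obtain ⟨rfl, rfl, rfl⟩ := h4
        subst h3
        obtain ⟨q₁, q₂, h5, ⟨us, h6⟩, h7⟩ := ih hp' hts.2 (p₁ := α ++ j :: i :: ζ) (p₂ := p₂)
          (by simp) (by simpa using hm)
        exact ⟨q₁, q₂, h5, ⟨_, .cons α ζ hij h6⟩, h7⟩
    · subst h3 h4
      obtain ⟨q₁, q₂, h5, h6, us, h7⟩ := ih hp' hts.2 (p₁ := p₁) (p₂ := ζ ++ j :: i :: β)
        (by simp) hm
      exact ⟨q₁, q₂, h5, h6, _, .cons ζ β hij h7⟩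

theorem Walk.sublist_of_lt {p q : List (Fin n)} {ts : List (Tile n)} (h : Walk p ts q)
    (hp : p.Nodup) {a b : Fin n} (hab : a < b) (hs : [b, a] <+ p) : [b, a] <+ q :=
  (h.inverted_iff hp hab).2 (.inl hs)

theorem filterMap_eq_nil_of_card {m : ℕ} {ts : List (Tile n)} (h : ∀ t ∈ ts, t.1.card + 1 ≠ m) :
    ts.filterMap (tileTop m) = [] := by
  rw [List.filterMap_eq_nil_iff]
  intro t ht
  simp [tileTop, h t ht]

/-- Let the entry `j` at position `m` replace `i` and later be replaced by `l`, with the same set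
of `m - 1` entries in front. Then the walk can be rearranged such that `l` replaces `i` directly
at position `m`: after rearranging the front part and bringing `l` next to `i, j`, one reverses
`i, j, l` by a braid that starts with the swap of `j` and `l`. -/
theorem exists_walk_bypass {m : ℕ} {α α' β β' : List (Fin n)} {i j l : Fin n}
    {ts : List (Tile n)} (hp : (α ++ j :: i :: β).Nodup) (hα : α.length + 1 = m)
    (h : Walk (α ++ j :: i :: β) ts (α' ++ j :: l :: β')) (hts : ∀ t ∈ ts, t.1.card + 1 ≠ m)
    (hα' : α'.length + 1 = m) (hij : i < j) (hjl : j < l) :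
    ∃ us, Walk (α ++ i :: j :: β) us (α' ++ l :: j :: β') ∧
      us.filterMap (tileTop m) = [insert l α'.toFinset] := by
  obtain ⟨q₁, q₂, he, ⟨us₁, h₁⟩, us₂, h₂⟩ := h.split_at_level hp hts
    (p₁ := α ++ [j]) (p₂ := i :: β) (by simp) (by simpa using hα)
  have hq₁ : q₁.length = m := by
    rw [← h₁.perm.length_eq]
    simpa using hα
  obtain ⟨rfl, rfl⟩ : α' ++ [j] = q₁ ∧ l :: β' = q₂ :=
    List.append_inj (by simpa using he) (by simp [hq₁, hα'])
  have hp₁ : (α ++ [j]).Nodup := hp.sublist (by simp)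
  have hp₂ : (i :: β).Nodup := hp.sublist
    ((List.sublist_cons_self j _).trans (List.sublist_append_right α _))
  have hnd₁ := h₁.perm.nodup_iff.1 hp₁
  have hnd₂ := h₂.perm.nodup_iff.1 hp₂
  have hnd := h.perm.nodup_iff.1 hp
  -- The front part.
  obtain ⟨ws₁, hw₁⟩ : ∃ ws, Walk α ws α' := by
    have hperm : α.Perm α' := (List.perm_append_right_iff [j]).1 h₁.perm
    refine exists_walk hperm (hp₁.sublist (by simp)) fun a b hab hs => ?_
    have h3 := h₁.sublist_of_lt hp₁ hab (hs.trans (by simp))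
    rw [sublist_pair_append] at h3
    rcases h3 with h3 | h3 | h3
    · exact h3
    · simpa using h3.length_le
    · have h4 : a ∈ α := hs.subset (by simp)
      have h5 : a = j := by simpa using h3.2
      subst h5
      simp [List.nodup_append] at hp₁
      exact absurd rfl (hp₁.2 a h4)
  have hil : i ≠ l := (hij.trans hjl).ne
  have hiβ : i ∈ β' := by
    have : i ∈ l :: β' := h₂.perm.mem_iff.1 (by simp)
    simpa [hil] using this
  obtain ⟨δ₁, δ₂, rfl⟩ := List.append_of_mem hiβ
  have hperm₂ : β.Perm (l :: (δ₁ ++ δ₂)) := by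
    refine (List.perm_cons i).1 (h₂.perm.trans ?_)
    exact (List.perm_middle (l₁ := l :: δ₁) (l₂ := δ₂) (a := i))
  obtain ⟨ws₂, hw₂⟩ : ∃ ws, Walk β ws (l :: (δ₁ ++ δ₂)) := by
    refine exists_walk hperm₂ (List.nodup_cons.1 hp₂).2 fun a b hab hs => ?_
    have h3 := h₂.sublist_of_lt hp₂ hab (hs.trans (List.sublist_cons_self ..))
    have ha : a ∈ β := hs.subset (by simp)
    have hb : b ∈ β := hs.subset (by simp)
    rw [List.nodup_cons] at hp₂
    have hai : a ≠ i := fun h => hp₂.1 (h ▸ ha)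
    have hbi : b ≠ i := fun h => hp₂.1 (h ▸ hb)
    simp only [sublist_pair_append, sublist_pair_cons, List.mem_cons, List.mem_append] at h3 ⊢
    tauto
  have hδ : ∀ a ∈ δ₁ ++ δ₂, a ∈ β ∧ a ≠ l := by
    intro a ha
    refine ⟨hperm₂.mem_iff.2 (by simp at ha ⊢; tauto), ?_⟩
    rintro rfl
    simp at hnd₂ ha
    grind
  obtain ⟨ws₃, hw₃⟩ : ∃ ws, Walk (i :: (δ₁ ++ δ₂)) ws (δ₁ ++ i :: δ₂) := by
    refine exists_walk List.perm_middle.symm ?_ fun a b hab hs => ?_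
    · rw [← List.nodup_middle]
      exact (List.nodup_cons.1 hnd₂).2
    · rw [sublist_pair_cons] at hs
      rcases hs with hs | ⟨rfl, ha⟩
      · exact hs.trans (List.Sublist.append_left (List.sublist_cons_self ..) _)
      · have h3 := h₂.sublist_of_lt hp₂ hab (sublist_pair_cons.2 (.inr ⟨rfl, (hδ a ha).1⟩))
        rw [sublist_pair_cons] at h3
        exact h3.resolve_right fun h => hil h.1
  have e1 : Walk (α ++ i :: j :: β) ws₁ (α' ++ i :: j :: β) := hw₁.append_right _
  have e2 := hw₂.append_left (α' ++ [i, j])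
  have e3 := Walk.single (α' ++ [i]) (δ₁ ++ δ₂) hjl
  have e4 := Walk.single α' (j :: (δ₁ ++ δ₂)) (hij.trans hjl)
  have e5 := Walk.single (α' ++ [l]) (δ₁ ++ δ₂) hij
  have e6 := hw₃.append_left (α' ++ [l, j])
  have hnd' : α'.Nodup := hnd₁.sublist (by simp)
  have hα'c : α'.toFinset.card = α'.length := List.toFinset_card_of_nodup hnd'
  have hmem : i ∉ α' ∧ j ∉ α' ∧ l ∉ α' := by
    simp [List.nodup_append] at hnd
    grind
  have hc2 : ∀ x y, x ∉ α' → y ∉ α' → x ≠ y → (α' ++ [x, y]).toFinset.card = m + 1 := by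
    intro x y hx hy hxy
    rw [List.toFinset_card_of_nodup]
    · simp; omega
    · simp [List.nodup_append, hnd', hxy]
      grind
  have hc1 : ∀ x, x ∉ α' → (α' ++ [x]).toFinset.card = m := by
    intro x hx
    rw [List.toFinset_card_of_nodup]
    · simp; omega
    · simp [List.nodup_append, hnd']
      grind
  simp only [List.append_assoc, List.cons_append, List.nil_append] at e2 e3 e5 e6
  refine ⟨_, e1.append (e2.append (e3.append (e4.append (e5.append e6)))), ?_⟩
  have f1 : ws₁.filterMap (tileTop m) = [] := filterMap_eq_nil_of_card fun t ht => by
    have := (hw₁.mem_tile (hp₁.sublist (by simp)) ht).2.2.2.1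
    omega
  have f2 : ∀ x y, x ∉ α' → y ∉ α' → x ≠ y → ∀ ws : List (Tile n),
      (ws.map (addBase (α' ++ [x, y]).toFinset)).filterMap (tileTop m) = [] := by
    intro x y hx hy hxy ws
    refine filterMap_eq_nil_of_card fun t ht => ?_
    obtain ⟨s, -, rfl⟩ := List.mem_map.1 ht
    have := Finset.card_le_card (Finset.subset_union_left : _ ⊆ (α' ++ [x, y]).toFinset ∪ s.1)
    rw [hc2 x y hx hy hxy] at this
    simp only [addBase]
    omega
  have g1 : tileTop m ((α' ++ [i]).toFinset, j, l) = none := by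
    rw [tileTop, if_neg]
    simp only [hc1 i hmem.1]
    omega
  have g2 : tileTop m ((α' ++ [l]).toFinset, i, j) = none := by
    rw [tileTop, if_neg]
    simp only [hc1 l hmem.2.2]
    omega
  have g3 : tileTop m (α'.toFinset, i, l) = some (insert l α'.toFinset) := by
    rw [tileTop, if_pos (by simp only; omega)]
  simp only [List.filterMap_append, f1, f2 i j hmem.1 hmem.2.1 hij.ne,
    f2 l j hmem.2.2 hmem.2.1 hjl.ne', List.filterMap_cons, List.filterMap_nil, g1, g2, g3]
  rfl

/-- A redundant vertex of the path of a walk at level `m` can be removed by changing the walk. -/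
theorem Walk.exists_levelPath_of_remove {m : ℕ} {p q : List (Fin n)} {ts : List (Tile n)}
    (h : Walk p ts q) (hp : p.Nodup) {P Q : List (Finset (Fin n))} {S₁ S₂ S₃ : Finset (Fin n)}
    (hL : levelPath m p ts = P ++ [S₁, S₂, S₃] ++ Q) (hS : SameBase S₁ S₂ S₃) :
    ∃ us, Walk p us q ∧ levelPath m p us = P ++ [S₁, S₃] ++ Q := by
  obtain ⟨F, hF⟩ : ∃ F, P ++ [S₁] = (p.take m).toFinset :: F := by
    rcases P with _ | ⟨S, P⟩
    · simp only [levelPath, List.nil_append, List.cons_append, List.cons.injEq] at hL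
      exact ⟨[], by rw [hL.1]; rfl⟩
    · simp only [levelPath, List.cons_append, List.cons.injEq] at hL
      exact ⟨P ++ [S₁], by rw [hL.1]; rfl⟩
  have hfm : ts.filterMap (tileTop m) = F ++ S₂ :: S₃ :: Q := by
    have : P ++ [S₁, S₂, S₃] ++ Q = (P ++ [S₁]) ++ S₂ :: S₃ :: Q := by simp
    rw [levelPath, this, hF] at hL
    simpa using hL
  rw [List.filterMap_eq_append_iff] at hfm
  obtain ⟨u₀, w₀, rfl, hu₀, hw₀⟩ := hfm
  rw [List.filterMap_eq_cons_iff] at hw₀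
  obtain ⟨N₁, t₁, w₁, rfl, hN₁, ht₁, hw₁⟩ := hw₀
  rw [List.filterMap_eq_cons_iff] at hw₁
  obtain ⟨N₂, t₂, v, rfl, hN₂, ht₂, hv⟩ := hw₁
  obtain ⟨A₁, i, j⟩ := t₁
  obtain ⟨A₂, j', l⟩ := t₂
  have hN₂' : ∀ t ∈ N₂, t.1.card + 1 ≠ m := fun t ht h => by simpa [tileTop, h] using hN₂ t ht
  have hN₁' : N₁.filterMap (tileTop m) = [] := List.filterMap_eq_nil_iff.2 hN₁
  simp only [tileTop] at ht₁ ht₂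
  split_ifs at ht₁ with hA₁
  split_ifs at ht₂ with hA₂
  rw [Option.some_inj] at ht₁ ht₂
  obtain ⟨r₁, h₁, h'⟩ := Walk.split (us := u₀ ++ N₁) (by simpa using h)
  obtain ⟨α, β, rfl, rfl, hij, h'⟩ := h'.cons_inv
  obtain ⟨r₂, h₂, h'⟩ := h'.split
  obtain ⟨α', β', rfl, rfl, hjl, h₃⟩ := h'.cons_inv
  have hnd₁ := h₁.perm.nodup_iff.1 hp
  have hnd₁' := ((List.Perm.swap j i β).append_left α).nodup_iff.1 hnd₁
  have hnd₂ := h₂.perm.nodup_iff.1 hnd₁'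
  have hα : α.length + 1 = m := by
    rw [← hA₁, List.toFinset_card_of_nodup (List.nodup_append.1 hnd₁).1]
  have hα' : α'.length + 1 = m := by
    rw [← hA₂, List.toFinset_card_of_nodup (List.nodup_append.1 hnd₂).1]
  have hm₁ := (Walk.single α β hij).mem_tile hnd₁ (List.mem_singleton_self _)
  have hm₂ := (Walk.single α' β' hjl).mem_tile hnd₂ (List.mem_singleton_self _)
  -- The vertices of the path before the two steps.
  have hv₁ : insert i α.toFinset = S₁ := by
    have := h₁.getLast?_levelPath (m := m) hp
    rw [levelPath, List.filterMap_append, hu₀, hN₁', List.append_nil, ← hF,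
      toFinset_take_length hα] at this
    simpa using this.symm
  have hv₂ : insert j' α'.toFinset = S₂ := by
    have := h₂.getLast?_levelPath (m := m) hnd₁'
    rw [levelPath, filterMap_eq_nil_of_card hN₂', toFinset_take_length hα,
      toFinset_take_length hα'] at this
    simpa [ht₁] using this.symm
  have hbase := hS.inter.1
  rw [← ht₂, ← hv₁] at hbase
  nth_rw 1 [← ht₁] at hbase
  rw [← hv₂, insert_inter_insert hij.ne, insert_inter_insert hjl.ne] at hbase
  obtain rfl : j = j' := by
    have : j ∈ insert j' α'.toFinset := by rw [hv₂, ← ht₁]; simp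
    rw [Finset.mem_insert, ← hbase] at this
    exact this.resolve_right hm₁.2.2.1
  obtain ⟨us, hus, hfm⟩ := exists_walk_bypass hnd₁' hα h₂ hN₂' hα' hij hjl
  refine ⟨u₀ ++ N₁ ++ (us ++ v), h₁.append (hus.append h₃), ?_⟩
  have : P ++ [S₁, S₃] ++ Q = (P ++ [S₁]) ++ S₃ :: Q := by simp
  rw [this, hF, levelPath]
  simp [hu₀, hN₁', hfm, hv, ht₂]

/-- The reduced path corresponding to the path of a walk is again the path of a walk. -/
theorem FullWalk.exists_reduced {m : ℕ} (hm : m ≤ n) {ts : List (Tile n)} (h : FullWalk ts) :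
    ∃ us, FullWalk us ∧ Relation.ReflTransGen (Remove m) (levelPath m (List.finRange n) ts)
      (levelPath m (List.finRange n) us) ∧
      ∀ S₁ S₂ S₃, [S₁, S₂, S₃] <:+: levelPath m (List.finRange n) us →
        (S₁ ∩ S₂ ∩ S₃).card + 2 = m := by
  induction hN : (levelPath m (List.finRange n) ts).length using Nat.strong_induction_on
    generalizing ts with
  | _ N ih =>
    by_cases hred : ∀ S₁ S₂ S₃, [S₁, S₂, S₃] <:+: levelPath m (List.finRange n) ts →
        (S₁ ∩ S₂ ∩ S₃).card + 2 = m
    · exact ⟨ts, h, .refl, hred⟩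
    · push Not at hred
      obtain ⟨S₁, S₂, S₃, ⟨P, Q, hPQ⟩, hc⟩ := hred
      have hpath := h.isPath hm
      have hS : SameBase S₁ S₂ S₃ := by
        have hch : [S₁, S₂, S₃].IsChain Step := by
          refine hpath.1.infix ⟨P, Q, hPQ⟩
        simp only [List.isChain_cons_cons, List.isChain_singleton, and_true] at hch
        refine ((sameBase_iff hch.1 hch.2 (hpath.2 S₂ ?_)).1).2 hc
        rw [← hPQ]
        simp
      obtain ⟨us, hus, hL⟩ := h.exists_levelPath_of_remove (List.nodup_finRange n) hPQ.symm hS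
      obtain ⟨vs, hvs, hr, hred⟩ := ih _ (by rw [← hN, hL, ← hPQ]; simp) hus rfl
      exact ⟨vs, hvs, .head ⟨P, Q, S₁, S₂, S₃, hc, hPQ.symm, hL⟩ hr, hred⟩

/-! ### The order in which pairs are reversed -/

/-- The time at which a walk with tiles `ts` reverses the pair `a < b`. -/
def time (ts : List (Tile n)) (a b : Fin n) : ℕ := (ts.map Prod.snd).idxOf (a, b)

theorem pair_sublist_finRange {a b : Fin n} (h : a < b) : [a, b] <+ List.finRange n := by
  rcases sublist_pair_or (List.mem_finRange a) (List.mem_finRange b) h.ne with h' | h'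
  · exact h'
  · have := (List.pairwise_lt_finRange n).sublist h'
    simp at this
    exact absurd this h.asymm

theorem not_pair_sublist_finRange {a b : Fin n} (h : a < b) : ¬ [b, a] <+ List.finRange n :=
  not_sublist_pair_swap (List.nodup_finRange n) (pair_sublist_finRange h)

theorem FullWalk.mem_pairs_iff {ts : List (Tile n)} (h : FullWalk ts) {a b : Fin n} :
    (a, b) ∈ ts.map Prod.snd ↔ a < b := by
  have hp := List.nodup_finRange n
  constructor
  · intro hab
    obtain ⟨⟨A, i, j⟩, ht, he⟩ := List.mem_map.1 hab
    cases he
    exact (h.mem_tile hp ht).1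
  · intro hab
    refine ((h.inverted_iff hp hab).1 ?_).resolve_left (not_pair_sublist_finRange hab)
    simpa using (pair_sublist_finRange hab).reverse

theorem FullWalk.nodup_pairs {ts : List (Tile n)} (h : FullWalk ts) : (ts.map Prod.snd).Nodup :=
  (Walk.nodup_pairs h (List.nodup_finRange n)).1

theorem FullWalk.time_inj {ts : List (Tile n)} (h : FullWalk ts) {a b c d : Fin n} (hab : a < b)
    (he : time ts a b = time ts c d) : a = c ∧ b = d := by
  simpa using (List.idxOf_inj (h.mem_pairs_iff.2 hab)).1 he

theorem mem_pairs_iff_time_lt {us vs : List (Tile n)} (a b : Fin n) :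
    (a, b) ∈ us.map Prod.snd ↔ time (us ++ vs) a b < us.length := by
  rw [time, List.map_append]
  by_cases hab : (a, b) ∈ us.map Prod.snd
  · rw [List.idxOf_append_of_mem hab]
    simpa [hab] using List.idxOf_lt_length_iff.2 hab
  · rw [List.idxOf_append_of_notMem hab]
    simp [hab]

/-- The order in a permutation that occurs along a full walk. -/
theorem FullWalk.inverted_iff_time_lt {us vs : List (Tile n)} {p : List (Fin n)}
    (hu : Walk (List.finRange n) us p) {a b : Fin n} (hab : a < b) :
    [b, a] <+ p ↔ time (us ++ vs) a b < us.length := by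
  rw [hu.inverted_iff (List.nodup_finRange n) hab, mem_pairs_iff_time_lt (vs := vs)]
  simp [not_pair_sublist_finRange hab]

theorem Walk.mem_of_finRange {us : List (Tile n)} {p : List (Fin n)}
    (hu : Walk (List.finRange n) us p) (x : Fin n) : x ∈ p :=
  hu.perm.mem_iff.1 (List.mem_finRange x)

theorem FullWalk.split_at_tile {ts : List (Tile n)} (h : FullWalk ts) {A : Finset (Fin n)}
    {i l : Fin n} (ht : (A, i, l) ∈ ts) : ∃ us vs α β, ts = us ++ (A, i, l) :: vs ∧
      A = α.toFinset ∧ i < l ∧ Walk (List.finRange n) us (α ++ i :: l :: β) ∧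
      Walk (List.finRange n) (us ++ [(A, i, l)]) (α ++ l :: i :: β) ∧ us.length = time ts i l := by
  obtain ⟨us, vs, rfl⟩ := List.append_of_mem ht
  obtain ⟨p, h1, h2⟩ := Walk.split h
  obtain ⟨α, β, rfl, rfl, hil, h2⟩ := h2.cons_inv
  refine ⟨us, vs, α, β, rfl, rfl, hil, h1, h1.append (.single α β hil), ?_⟩
  have hnd := h.nodup_pairs
  rw [List.map_append, List.map_cons, List.nodup_middle, List.nodup_cons] at hnd
  rw [time, List.map_append, List.map_cons, List.idxOf_append_of_notMem fun h => hnd.1 (by simp [h])]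
  simp

theorem FullWalk.exists_tile {ts : List (Tile n)} (h : FullWalk ts) {i l : Fin n} (hil : i < l) :
    ∃ A, (A, i, l) ∈ ts := by
  obtain ⟨⟨A, i', l'⟩, ht, he⟩ := List.mem_map.1 (h.mem_pairs_iff.2 hil)
  cases he
  exact ⟨A, ht⟩

theorem sublist_pair_iff_of_ne {α β : List (Fin n)} {i l x : Fin n}
    (hp : (α ++ i :: l :: β).Nodup) (hx : x ∈ α ++ i :: l :: β) (hxi : x ≠ i) (hxl : x ≠ l) :
    (x ∈ α ↔ [x, i] <+ α ++ i :: l :: β) ∧ (x ∈ α ↔ [x, l] <+ α ++ i :: l :: β) ∧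
    (x ∈ α ↔ ¬ [i, x] <+ α ++ i :: l :: β) ∧ (x ∈ α ↔ ¬ [l, x] <+ α ++ i :: l :: β) := by
  have h1 : x ∈ α → [x, i] <+ α ++ i :: l :: β := fun h => by simp [sublist_pair_append, h]
  have h2 : x ∈ α → [x, l] <+ α ++ i :: l :: β := fun h => by simp [sublist_pair_append, h]
  have h3 : x ∉ α → x ∈ β := fun h => by simpa [hxi, hxl, h] using hx
  have h4 : x ∉ α → [i, x] <+ α ++ i :: l :: β := fun h => by
    simp [h3 h]
  have h5 : x ∉ α → [l, x] <+ α ++ i :: l :: β := fun h => by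
    simp [h3 h]
  have h6 := not_sublist_pair_swap hp (a := x) (b := i)
  have h7 := not_sublist_pair_swap hp (a := x) (b := l)
  tauto

/-- The three pairs of a triple `a < b < c` are reversed in lexicographic order or in the opposite
order, and this determines which of the three elements lie below the tiles of the two others. -/
theorem FullWalk.triple {ts : List (Tile n)} (h : FullWalk ts) {a b c : Fin n} (hab : a < b)
    (hbc : b < c) {A B C : Finset (Fin n)} (hA : (A, b, c) ∈ ts) (hB : (B, a, c) ∈ ts)
    (hC : (C, a, b) ∈ ts) :
    time ts a b < time ts a c ∧ time ts a c < time ts b c ∧ a ∉ A ∧ b ∈ B ∧ c ∉ C ∨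
    time ts b c < time ts a c ∧ time ts a c < time ts a b ∧ a ∈ A ∧ b ∉ B ∧ c ∈ C := by
  have hac := hab.trans hbc
  have key : ∀ {D : Finset (Fin n)} {i l x : Fin n}, (D, i, l) ∈ ts → x ≠ i → x ≠ l →
      (x < i → (x ∈ D ↔ ¬ time ts x i < time ts i l)) ∧
      (x < l → (x ∈ D ↔ ¬ time ts x l < time ts i l)) ∧
      (i < x → (x ∈ D ↔ time ts i x < time ts i l)) ∧
      (l < x → (x ∈ D ↔ time ts l x < time ts i l)) := by
    intro D i l x ht hxi hxl
    obtain ⟨us, vs, α, β, hts, rfl, hil, hu, -, hlen⟩ := h.split_at_tile ht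
    obtain ⟨h1, h2, h3, h4⟩ := sublist_pair_iff_of_ne
      (hu.perm.nodup_iff.1 (List.nodup_finRange n)) (hu.mem_of_finRange x) hxi hxl
    have hinv : ∀ {y z : Fin n}, y < z → ([z, y] <+ α ++ i :: l :: β ↔ time ts y z < time ts i l) := by
      intro y z hyz
      rw [← hlen, hts]
      exact FullWalk.inverted_iff_time_lt hu hyz
    rw [List.mem_toFinset]
    exact ⟨fun hlt => by rw [h3, hinv hlt], fun hlt => by rw [h4, hinv hlt],
      fun hlt => by rw [h1, hinv hlt], fun hlt => by rw [h2, hinv hlt]⟩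
  have k1 := key hA hab.ne hac.ne
  have k2 := key hB hab.ne' hbc.ne
  have k3 := key hC hac.ne' hbc.ne'
  have e1 := (k1.1 hab).symm.trans (k1.2.1 hac)
  have e2 := (k2.2.1 hbc).symm.trans (k2.2.2.1 hab)
  have e3 := (k3.2.2.1 hac).symm.trans (k3.2.2.2 hbc)
  have n1 : time ts a b ≠ time ts a c := fun he => hbc.ne (h.time_inj hab he).2
  have n2 : time ts a c ≠ time ts b c := fun he => hab.ne (h.time_inj hac he).1
  rw [k1.1 hab, k2.2.2.1 hab, k3.2.2.1 hac]
  omega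

/-- Every vertex of the tiling of a walk is the set of the first entries of a permutation along the
walk, and so it separates the pairs reversed before some time `N` from those reversed later. -/
theorem FullWalk.vertex {ts : List (Tile n)} (h : FullWalk ts) {S : Finset (Fin n)}
    (hS : S ∈ vertices (tilesOf ts)) : ∃ N, ∀ a b, a < b →
      (a ∈ S → b ∉ S → N ≤ time ts a b) ∧ (b ∈ S → a ∉ S → time ts a b < N) := by
  have key : ∀ {us vs : List (Tile n)} {s t : List (Fin n)}, ts = us ++ vs →
      Walk (List.finRange n) us (s ++ t) → ∀ a b, a < b →
      (a ∈ s.toFinset → b ∉ s.toFinset → us.length ≤ time ts a b) ∧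
      (b ∈ s.toFinset → a ∉ s.toFinset → time ts a b < us.length) := by
    intro us vs s t hts hu a b hab
    have hbef : ∀ {x y : Fin n}, x ∈ s.toFinset → y ∉ s.toFinset → [x, y] <+ s ++ t := by
      intro x y hx hy
      rw [List.mem_toFinset] at hx hy
      rw [sublist_pair_append]
      have := hu.mem_of_finRange y
      simp [hy] at this
      exact .inr (.inr ⟨hx, this⟩)
    have h1 := FullWalk.inverted_iff_time_lt (vs := vs) hu hab
    rw [← hts] at h1
    refine ⟨fun ha hb => ?_, fun hb ha => h1.1 (hbef hb ha)⟩
    rw [← not_lt, ← h1]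
    exact not_sublist_pair_swap (hu.perm.nodup_iff.1 (List.nodup_finRange n)) (hbef ha hb)
  obtain ⟨p, ⟨⟨A, i, l⟩, ht, rfl⟩, hAS, hSA⟩ := hS
  obtain ⟨us, vs, α, β, hts, rfl, hil, hu, hu', -⟩ := h.split_at_tile ht
  have hsub : ∀ x ∈ S, x ∈ α ∨ x = i ∨ x = l := fun x hx => by
    have := hSA hx
    simp at this
    tauto
  have hsup : ∀ x ∈ α, x ∈ S := fun x hx => hAS (by simpa using hx)
  by_cases hi : i ∈ S
  · by_cases hl : l ∈ S
    · have : S = (α ++ [i, l]).toFinset := by ext x; simp; grind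
      exact this ▸ ⟨_, key hts (by simpa using hu)⟩
    · have : S = (α ++ [i]).toFinset := by ext x; simp; grind
      exact this ▸ ⟨_, key hts (t := l :: β) (by simpa using hu)⟩
  · by_cases hl : l ∈ S
    · have : S = (α ++ [l]).toFinset := by ext x; simp; grind
      exact this ▸ ⟨_, key (us := us ++ [(α.toFinset, i, l)]) (by simpa using hts) (t := i :: β)
        (by simpa using hu')⟩
    · have : S = α.toFinset := by ext x; simp; grind
      exact this ▸ ⟨_, key hts (t := i :: l :: β) hu⟩

theorem FullWalk.sigma_eq {ts : List (Tile n)} (h : FullWalk ts) {a b c : Fin n} (hab : a < b)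
    (hbc : b < c) : sigma (tilesOf ts) ({a, c}, {b}) =
      if time ts a b < time ts b c then -1 else 1 := by
  have hac := hab.trans hbc
  obtain ⟨A, hA⟩ := h.exists_tile hbc
  obtain ⟨B, hB⟩ := h.exists_tile hac
  obtain ⟨C, hC⟩ := h.exists_tile hab
  have hmem := h.mem_tile (List.nodup_finRange n) hB
  have hpos : time ts a b < time ts b c →
      ∀ S ∈ vertices (tilesOf ts), ¬ SetOrients S (({a, c}, {b}) : Finset (Fin n) × Finset (Fin n)) := by
    rintro hlt S hS ⟨h1, h2⟩
    obtain ⟨N, hN⟩ := h.vertex hS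
    simp [Finset.insert_subset_iff] at h1 h2
    have := (hN a b hab).1 h1.1 h2
    have := (hN b c hbc).2 h1.2 h2
    omega
  have hneg : ¬ time ts a b < time ts b c →
      ∀ S ∈ vertices (tilesOf ts), ¬ SetOrients S (({b}, {a, c}) : Finset (Fin n) × Finset (Fin n)) := by
    rintro hlt S hS ⟨h1, h2⟩
    obtain ⟨N, hN⟩ := h.vertex hS
    simp at h1 h2
    have := (hN a b hab).2 h1 h2.1
    have := (hN b c hbc).1 h1 h2.2
    omega
  rw [sigma]
  rcases h.triple hab hbc hA hB hC with ⟨h1, h2, h3, h4, h5⟩ | ⟨h1, h2, h3, h4, h5⟩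
  · have hlt := h1.trans h2
    rw [if_neg, if_pos, if_pos hlt]
    · refine ⟨⟨B, ⟨_, ⟨_, hB, rfl⟩, subset_rfl, Finset.subset_union_left⟩, ?_⟩, hpos hlt⟩
      simpa [SetOrients, hmem.2.1, hmem.2.2.1] using h4
    · rintro ⟨⟨S, hS, hS'⟩, -⟩
      exact hpos hlt S hS hS'
  · have hlt := (h1.trans h2).not_gt
    rw [if_pos, if_neg hlt]
    refine ⟨⟨B ∪ {a, c}, ⟨_, ⟨_, hB, rfl⟩, Finset.subset_union_left, subset_rfl⟩, ?_⟩, hneg hlt⟩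
    refine ⟨Finset.subset_union_right, ?_⟩
    simp [h4, hab.ne', hbc.ne]

theorem FullWalk.sigma_swap {ts : List (Tile n)} (h : FullWalk ts) {a b c : Fin n} (hab : a < b)
    (hbc : b < c) : sigma (tilesOf ts) ({b}, {a, c}) = - sigma (tilesOf ts) ({a, c}, {b}) := by
  have hs : ∀ C, Orients (vertices (tilesOf ts)) C → ¬ Orients (vertices (tilesOf ts)) C.swap :=
    fun C h1 h2 => by
      obtain ⟨⟨S, hS, hS'⟩, -⟩ := h1
      exact h2.2 S hS hS'
  have h1 := h.sigma_eq hab hbc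
  have h2 := hs ({a, c}, {b})
  simp only [sigma, Prod.swap_prod_mk] at h1 h2 ⊢
  split_ifs at h1 ⊢ <;> simp_all

/-! ### Circuits of points on a line -/

theorem sum_smul_lift {a α : Fin n → ℝ} :
    ∑ i, α i • lift a i = (∑ i, α i * a i, ∑ i, α i) := by
  ext <;> simp [lift, Prod.fst_sum, Prod.snd_sum]

theorem linearIndepOn_lift_pair {a : Fin n → ℝ} (ha : StrictMono a) {i j : Fin n} (hij : i ≠ j) :
    LinearIndepOn ℝ (lift a) {i, j} := by
  rw [linearIndepOn_pair_iff _ hij (by simp [lift])]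
  intro c hc
  simp only [lift, Prod.smul_mk, smul_eq_mul, mul_one, Prod.mk.injEq] at hc
  rw [hc.2, one_mul] at hc
  exact hij (ha.injective hc.1)

theorem exists_lt_lt_of_card_eq_three {s : Finset (Fin n)} (hs : s.card = 3) :
    ∃ i j l, i < j ∧ j < l ∧ s = {i, j, l} := by
  refine ⟨s.orderEmbOfFin hs 0, s.orderEmbOfFin hs 1, s.orderEmbOfFin hs 2, by simp, by simp, ?_⟩
  ext x
  rw [← Finset.mem_coe, ← s.range_orderEmbOfFin hs, Set.mem_range]
  simp [Fin.exists_fin_succ, eq_comm]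

theorem isCircuit_lift {a : Fin n → ℝ} (ha : StrictMono a) {i j l : Fin n} (hij : i < j)
    (hjl : j < l) : IsCircuit (lift a) ({i, l}, {j}) := by
  have hil := hij.trans hjl
  have h1 := ha hij
  have h2 := ha hjl
  refine ⟨by simp [hij.ne', hjl.ne], ⟨i, by simp⟩, ?_, ?_⟩
  · have key : ∀ {s : Finset (Fin n)} (x y : Fin n), x ≠ y → s ⊆ {x, y} →
        LinearIndepOn ℝ (lift a) (s : Set (Fin n)) := fun x y hxy hs =>
      (linearIndepOn_lift_pair ha hxy).mono (by simpa [Set.subset_def, Finset.subset_iff] using hs)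
    intro x hx
    simp only [Finset.mem_union, Finset.mem_insert, Finset.mem_singleton] at hx
    rcases hx with (rfl | rfl) | rfl
    · exact key l j hjl.ne' fun y hy => by simp at hy ⊢; tauto
    · exact key i j hij.ne fun y hy => by simp at hy ⊢; tauto
    · exact key i l hil.ne fun y hy => by simp at hy ⊢; tauto
  · refine ⟨fun x => if x = i then a l - a j else if x = l then a j - a i else
      if x = j then a i - a l else 0, ?_, ?_, ?_, ?_⟩
    · simp [hil.ne', h1, h2]
    · simp [hij.ne', hjl.ne, h1.trans h2]
    · intro x hx
      simp at hx
      grind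
    · rw [sum_smul_lift]
      have hsum : ∀ f : Fin n → ℝ, ∑ x, (if x = i then a l - a j else if x = l then a j - a i else
          if x = j then a i - a l else 0) * f x =
          (a l - a j) * f i + (a j - a i) * f l + (a i - a l) * f j := by
        intro f
        rw [← Finset.sum_subset (Finset.subset_univ {i, l, j})]
        · rw [Finset.sum_insert (by simp [hil.ne, hij.ne]), Finset.sum_insert (by simp [hjl.ne']),
            Finset.sum_singleton]
          simp [hil.ne', hij.ne', hjl.ne]
          ring
        · intro x _ hx
          simp at hx
          simp [hx]
      have h3 := hsum fun _ => 1
      simp only [mul_one] at h3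
      rw [hsum, h3]
      ext
      · simp; ring
      · simp

/-- The circuits of distinct points on a line are the triples, the middle point having the opposite
sign of the two others. -/
theorem IsCircuit.eq_triple {a : Fin n → ℝ} (ha : StrictMono a)
    {C : Finset (Fin n) × Finset (Fin n)} (hC : IsCircuit (lift a) C) :
    ∃ i j l, i < j ∧ j < l ∧ (C = ({i, l}, {j}) ∨ C = ({j}, {i, l})) := by
  obtain ⟨α, h1, h2, h3, h4⟩ := hC.dep
  have hne : ∀ i ∈ C.1 ∪ C.2, α i ≠ 0 := by
    intro i hi
    rcases Finset.mem_union.1 hi with hi | hi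
    · exact (h1 i hi).ne'
    · exact (h2 i hi).ne
  rw [sum_smul_lift, Prod.mk_eq_zero] at h4
  have hsub : ∀ f : Fin n → ℝ, ∑ i, α i * f i = ∑ i ∈ C.1 ∪ C.2, α i * f i := by
    intro f
    rw [← Finset.sum_subset (Finset.subset_univ (C.1 ∪ C.2))]
    intro x _ hx
    rw [h3 x hx, zero_mul]
  have hs0 : ∑ i ∈ C.1 ∪ C.2, α i = 0 := by
    have := hsub fun _ => 1
    simp only [mul_one] at this
    rw [← this, h4.2]
  have hs1 : ∑ i ∈ C.1 ∪ C.2, α i * a i = 0 := by rw [← hsub, h4.1]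
  have hcard : (C.1 ∪ C.2).card = 3 := by
    have hle : (C.1 ∪ C.2).card ≤ 3 := by
      obtain ⟨i, hi⟩ := hC.nonempty
      have h5 := (hC.indep i hi).linearIndependent.fintype_card_le_finrank
      simp only [Module.finrank_prod, Module.finrank_self, Finset.coe_sort_coe, Fintype.card_coe] at h5
      have h6 := Finset.card_erase_add_one hi
      omega
    have hpos := hC.nonempty.card_pos
    have h1' : (C.1 ∪ C.2).card ≠ 1 := by
      intro h
      obtain ⟨x, hx⟩ := Finset.card_eq_one.1 h
      rw [hx, Finset.sum_singleton] at hs0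
      exact hne x (by simp [hx]) hs0
    have h2' : (C.1 ∪ C.2).card ≠ 2 := by
      intro h
      obtain ⟨x, y, hxy, hx⟩ := Finset.card_eq_two.1 h
      rw [hx, Finset.sum_pair hxy] at hs0 hs1
      have h5 : α x * (a x - a y) = 0 := by linear_combination hs1 - a y * hs0
      rcases mul_eq_zero.1 h5 with h5 | h5
      · exact hne x (by simp [hx]) h5
      · exact hxy (ha.injective (sub_eq_zero.1 h5))
    omega
  obtain ⟨i, j, l, hij, hjl, hs⟩ := exists_lt_lt_of_card_eq_three hcard
  refine ⟨i, j, l, hij, hjl, ?_⟩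
  have hil := hij.trans hjl
  have hsum : ∀ f : Fin n → ℝ, ∑ x ∈ C.1 ∪ C.2, f x = f i + f j + f l := by
    intro f
    rw [hs, Finset.sum_insert (by simp [hil.ne, hij.ne]), Finset.sum_pair hjl.ne, add_assoc]
  rw [hsum] at hs0 hs1
  have hi := ha hij
  have hl := ha hjl
  have e1 : α i * (a j - a i) = α l * (a l - a j) := by linear_combination a j * hs0 - hs1
  have hmem : ∀ x, x ∈ C.1 ∨ x ∈ C.2 ↔ x = i ∨ x = j ∨ x = l := by
    intro x
    rw [← Finset.mem_union, hs]
    simp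
  have hdis : ∀ x, x ∈ C.1 → x ∉ C.2 := fun x hx => Finset.disjoint_left.1 hC.disjoint hx
  have hs1 : ∀ x, 0 < α x → x ∉ C.2 := fun x hx h => (h2 x h).not_gt hx
  have hs2 : ∀ x, α x < 0 → x ∉ C.1 := fun x hx h => (h1 x h).not_gt hx
  have hmi := (hmem i).2 (by simp)
  have hmj := (hmem j).2 (by simp)
  have hml := (hmem l).2 (by simp)
  rcases hmi with hi' | hi'
  · have hpi := h1 i hi'
    have hpl : 0 < α l := by
      have : 0 < α l * (a l - a j) := e1 ▸ mul_pos hpi (sub_pos.2 hi)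
      exact pos_of_mul_pos_left this (sub_pos.2 hl).le
    have hpj : α j < 0 := by linarith
    left
    ext x
    · have := hmem x
      have := hs1 l hpl
      have := hs2 j hpj
      simp
      grind
    · have := hmem x
      have := hs1 l hpl
      have := hs2 j hpj
      simp
      grind
  · have hpi := h2 i hi'
    have hpl : α l < 0 := by
      have : α l * (a l - a j) < 0 := e1 ▸ mul_neg_of_neg_of_pos hpi (sub_pos.2 hi)
      exact neg_of_mul_neg_left this (sub_pos.2 hl).le
    have hpj : 0 < α j := by linarith
    right
    ext x
    · have := hmem x
      have := hs2 l hpl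
      have := hs1 j hpj
      simp
      grind
    · have := hmem x
      have := hs2 l hpl
      have := hs1 j hpj
      simp
      grind

/-! ### Flips -/

theorem FullWalk.tile_unique {ts : List (Tile n)} (h : FullWalk ts) {A A' : Finset (Fin n)}
    {a b : Fin n} (hA : (A, a, b) ∈ ts) (hA' : (A', a, b) ∈ ts) : A = A' := by
  have := List.inj_on_of_nodup_map h.nodup_pairs hA hA' rfl
  simpa using this

theorem FullWalk.weight_eq_sum {ts : List (Tile n)} (h : FullWalk ts)
    {A : Fin n → Fin n → Finset (Fin n)} (hA : ∀ a b, a < b → (A a b, a, b) ∈ ts) (k : ℕ) :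
    weight k ts = ∑ p ∈ Finset.univ.filter (fun p : Fin n × Fin n => p.1 < p.2),
      tileWeight k (A p.1 p.2, p) := by
  have h1 : (Finset.univ.filter fun p : Fin n × Fin n => p.1 < p.2) =
      (ts.map Prod.snd).toFinset := by
    ext ⟨a, b⟩
    rw [List.mem_toFinset, h.mem_pairs_iff]
    simp
  rw [h1, List.sum_toFinset _ h.nodup_pairs, List.map_map, weight]
  congr 1
  refine List.map_congr_left fun t ht => ?_
  obtain ⟨B, a, b⟩ := t
  have hab := (h.mem_tile (List.nodup_finRange n) ht).1
  rw [Function.comp_apply, h.tile_unique ht (hA a b hab)]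

/-- The change of the weight when a hexagon with lowest vertex `B` is flipped. -/
theorem tileWeight_braid (k : ℕ) {B : Finset (Fin n)} {i j l : Fin n} (hij : i < j) (hjl : j < l)
    (hi : i ∉ B) (hj : j ∉ B) (hl : l ∉ B) :
    tileWeight k (B, i, j) + tileWeight k (insert j B, i, l) + tileWeight k (B, j, l) =
      tileWeight k (insert l B, i, j) + tileWeight k (B, i, l) + tileWeight k (insert i B, j, l) +
        if B.card + 1 = k then 1 else 0 := by
  have e1 : (B.filter fun y => i < y ∧ y < l).card =
      (B.filter fun y => i < y ∧ y < j).card + (B.filter fun y => j < y ∧ y < l).card := by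
    rw [← Finset.card_union_of_disjoint]
    · congr 1
      ext y
      have : y ∈ B → y ≠ j := fun h h' => hj (h' ▸ h)
      simp only [Finset.mem_filter, Finset.mem_union]
      grind
    · rw [Finset.disjoint_filter]
      exact fun y _ h1 h2 => h1.2.asymm h2.1
  have e2 : ((insert j B).filter fun y => i < y ∧ y < l).card =
      (B.filter fun y => i < y ∧ y < l).card + 1 := by
    rw [Finset.filter_insert, if_pos ⟨hij, hjl⟩, Finset.card_insert_of_notMem (by simp [hj])]
  have e3 : (insert l B).filter (fun y => i < y ∧ y < j) = B.filter fun y => i < y ∧ y < j := by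
    rw [Finset.filter_insert, if_neg fun h => h.2.asymm hjl]
  have e4 : (insert i B).filter (fun y => j < y ∧ y < l) = B.filter fun y => j < y ∧ y < l := by
    rw [Finset.filter_insert, if_neg fun h => h.1.asymm hij]
  simp only [tileWeight, Finset.card_insert_of_notMem hi, Finset.card_insert_of_notMem hj,
    Finset.card_insert_of_notMem hl, e1, e2, e3, e4]
  split_ifs <;> omega

theorem FullWalk.mem_iff_time_lt {ts : List (Tile n)} (h : FullWalk ts) {a b c : Fin n}
    (hab : a < b) (hbc : b < c) {A B C : Finset (Fin n)} (hA : (A, b, c) ∈ ts)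
    (hB : (B, a, c) ∈ ts) (hC : (C, a, b) ∈ ts) :
    (a ∈ A ↔ ¬ time ts a b < time ts b c) ∧ (b ∈ B ↔ time ts a b < time ts b c) ∧
      (c ∈ C ↔ ¬ time ts a b < time ts b c) := by
  rcases h.triple hab hbc hA hB hC with ⟨h1, h2, h3, h4, h5⟩ | ⟨h1, h2, h3, h4, h5⟩
  · simp [h3, h4, h5, h1.trans h2]
  · simp [h3, h4, h5, (h1.trans h2).le]

theorem FullWalk.time_triple {ts : List (Tile n)} (h : FullWalk ts) {a b c : Fin n} (hab : a < b)
    (hbc : b < c) : time ts a b < time ts a c ∧ time ts a c < time ts b c ∨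
      time ts b c < time ts a c ∧ time ts a c < time ts a b := by
  obtain ⟨A, hA⟩ := h.exists_tile hbc
  obtain ⟨B, hB⟩ := h.exists_tile (hab.trans hbc)
  obtain ⟨C, hC⟩ := h.exists_tile hab
  have := h.triple hab hbc hA hB hC
  tauto

/-- The four triples of a quadruple, in lexicographic order, change their orientation at most
once. -/
theorem FullWalk.quadruple {ts : List (Tile n)} (h : FullWalk ts) {a b c d : Fin n} (hab : a < b)
    (hbc : b < c) (hcd : c < d) {s₁ s₂ s₃ s₄ : Prop}
    (e₁ : s₁ = (time ts a b < time ts b c) := by rfl)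
    (e₂ : s₂ = (time ts a b < time ts b d) := by rfl)
    (e₃ : s₃ = (time ts a c < time ts c d) := by rfl)
    (e₄ : s₄ = (time ts b c < time ts c d) := by rfl) :
    (¬ (s₁ ∧ ¬ s₂ ∧ s₃) ∧ ¬ (¬ s₁ ∧ s₂ ∧ ¬ s₃)) ∧ (¬ (s₁ ∧ ¬ s₂ ∧ s₄) ∧ ¬ (¬ s₁ ∧ s₂ ∧ ¬ s₄)) ∧
      (¬ (s₁ ∧ ¬ s₃ ∧ s₄) ∧ ¬ (¬ s₁ ∧ s₃ ∧ ¬ s₄)) ∧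
      (¬ (s₂ ∧ ¬ s₃ ∧ s₄) ∧ ¬ (¬ s₂ ∧ s₃ ∧ ¬ s₄)) := by
  subst e₁ e₂ e₃ e₄
  have t1 := h.time_triple hab hbc
  have t2 := h.time_triple hab (hbc.trans hcd)
  have t3 := h.time_triple (hab.trans hbc) hcd
  have t4 := h.time_triple hbc hcd
  refine ⟨⟨?_, ?_⟩, ⟨?_, ?_⟩, ⟨?_, ?_⟩, ⟨?_, ?_⟩⟩ <;> rintro ⟨r1, r2, r3⟩ <;> omega

set_option maxHeartbeats 1000000 in
/-- If two full walks orient exactly one triple differently, then their tilings differ only by the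
two tilings of a hexagon, and the weight changes accordingly. -/
theorem FullWalk.weight_of_triple {ts ts' : List (Tile n)} (h : FullWalk ts) (h' : FullWalk ts')
    {i j l : Fin n} (hij : i < j) (hjl : j < l) (hs : time ts i j < time ts j l)
    (hs' : ¬ time ts' i j < time ts' j l)
    (hother : ∀ a b c, a < b → b < c → ¬ (a = i ∧ b = j ∧ c = l) →
      (time ts a b < time ts b c ↔ time ts' a b < time ts' b c)) (k : ℕ) :
    ∃ e ≤ 1, weight k ts = weight k ts' + e := by
  have hil := hij.trans hjl
  choose! A hA using fun a b => h.exists_tile (i := a) (l := b)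
  choose! A' hA' using fun a b => h'.exists_tile (i := a) (l := b)
  have tr := fun a b c (hab : a < b) (hbc : b < c) =>
    h.mem_iff_time_lt hab hbc (hA b c hbc) (hA a c (hab.trans hbc)) (hA a b hab)
  have tr' := fun a b c (hab : a < b) (hbc : b < c) =>
    h'.mem_iff_time_lt hab hbc (hA' b c hbc) (hA' a c (hab.trans hbc)) (hA' a b hab)
  have hself : ∀ a b, a < b → a ∉ A a b ∧ b ∉ A a b := fun a b hab =>
    have := h.mem_tile (List.nodup_finRange n) (hA a b hab)
    ⟨this.2.1, this.2.2.1⟩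
  have hself' : ∀ a b, a < b → a ∉ A' a b ∧ b ∉ A' a b := fun a b hab =>
    have := h'.mem_tile (List.nodup_finRange n) (hA' a b hab)
    ⟨this.2.1, this.2.2.1⟩
  have t0 := tr i j l hij hjl
  have t0' := tr' i j l hij hjl
  -- Membership in the sets of the two tilings can only differ for the triple `i, j, l`.
  have hmem : ∀ a b x, a < b → ¬ (x = i ∧ a = j ∧ b = l) → ¬ (a = i ∧ x = j ∧ b = l) →
      ¬ (a = i ∧ b = j ∧ x = l) → (x ∈ A a b ↔ x ∈ A' a b) := by
    intro a b x hab n1 n2 n3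
    by_cases hxa : x = a
    · simp [hxa, (hself a b hab).1, (hself' a b hab).1]
    by_cases hxb : x = b
    · simp [hxb, (hself a b hab).2, (hself' a b hab).2]
    rcases lt_or_gt_of_ne hxa with hxa | hxa
    · rw [(tr x a b hxa hab).1, (tr' x a b hxa hab).1, hother x a b hxa hab n1]
    · rcases lt_or_gt_of_ne hxb with hxb | hxb
      · rw [(tr a x b hxa hxb).2.1, (tr' a x b hxa hxb).2.1, hother a x b hxa hxb n2]
      · rw [(tr a b x hab hxb).2.2, (tr' a b x hab hxb).2.2, hother a b x hab hxb n3]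
  have hsame : ∀ a b, a < b → ¬ (a = i ∧ b = j) → ¬ (a = i ∧ b = l) → ¬ (a = j ∧ b = l) →
      A a b = A' a b := fun a b hab n1 n2 n3 => by
    ext x
    exact hmem a b x hab (fun h => n3 h.2) (fun h => n2 ⟨h.1, h.2.2⟩) (fun h => n1 ⟨h.1, h.2.1⟩)
  -- The tiles on the pairs from `i, j, l` have the same set up to these three elements: the four
  -- triples of a quadruple change their orientation at most once, in both walks.
  have hfour : ∀ x, x ≠ i → x ≠ j → x ≠ l → (x ∈ A i j ↔ x ∈ A i l) ∧ (x ∈ A i j ↔ x ∈ A j l) := by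
    intro x hxi hxj hxl
    rcases lt_or_gt_of_ne hxi with hi | hi
    · rw [(tr x i j hi hij).1, (tr x i l hi hil).1, (tr x j l (hi.trans hij) hjl).1]
      have q := h.quadruple hi hij hjl
      have q' := h'.quadruple hi hij hjl
      rw [← hother x i j hi hij (by tauto), ← hother x i l hi hil (by tauto),
        ← hother x j l (hi.trans hij) hjl (by tauto)] at q'
      clear * - q q' hs hs'
      grind
    rcases lt_or_gt_of_ne hxj with hj | hj
    · rw [(tr i x j hi hj).2.1, (tr i x l hi (hj.trans hjl)).2.1, (tr x j l hj hjl).1]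
      have q := h.quadruple hi hj hjl
      have q' := h'.quadruple hi hj hjl
      rw [← hother i x j hi hj (by tauto), ← hother i x l hi (hj.trans hjl) (by tauto),
        ← hother x j l hj hjl (by tauto)] at q'
      clear * - q q' hs hs'
      grind
    rcases lt_or_gt_of_ne hxl with hl | hl
    · rw [(tr i j x hij hj).2.2, (tr i x l hi hl).2.1, (tr j x l hj hl).2.1]
      have q := h.quadruple hij hj hl
      have q' := h'.quadruple hij hj hl
      rw [← hother i j x hij hj (by tauto), ← hother i x l hi hl (by tauto),
        ← hother j x l hj hl (by tauto)] at q'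
      clear * - q q' hs hs'
      grind
    · rw [(tr i j x hij hj).2.2, (tr i l x hil hl).2.2, (tr j l x hjl hl).2.2]
      have q := h.quadruple hij hjl hl
      have q' := h'.quadruple hij hjl hl
      rw [← hother i j x hij hj (by tauto), ← hother i l x hil hl (by tauto),
        ← hother j l x hjl hl (by tauto)] at q'
      clear * - q q' hs hs'
      grind
  have m1 : i ∉ A i j ∧ j ∉ A i j ∧ l ∉ A i j :=
    ⟨(hself i j hij).1, (hself i j hij).2, by rw [t0.2.2]; exact not_not.2 hs⟩
  have hB1 : A i l = insert j (A i j) := by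
    ext x
    have := hself i l hil
    have := hfour x
    grind
  have hB2 : A j l = A i j := by
    ext x
    have := hself j l hjl
    have := hfour x
    grind
  have hB3 : A' i j = insert l (A i j) := by
    ext x
    have := hself' i j hij
    have := hmem i j x hij
    grind
  have hB4 : A' i l = A i j := by
    ext x
    have := hself' i l hil
    have := hmem i l x hil
    have := hfour x
    grind
  have hB5 : A' j l = insert i (A i j) := by
    ext x
    have := hself' j l hjl
    have := hmem j l x hjl
    have := hfour x
    grind
  refine ⟨if (A i j).card + 1 = k then 1 else 0, by split_ifs <;> omega, ?_⟩
  rw [h.weight_eq_sum hA, h'.weight_eq_sum hA']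
  have hsub : ({(i, j), (i, l), (j, l)} : Finset (Fin n × Fin n)) ⊆
      Finset.univ.filter fun p : Fin n × Fin n => p.1 < p.2 := by
    simp [Finset.insert_subset_iff, hij, hjl, hil]
  rw [← Finset.sum_sdiff hsub, ← Finset.sum_sdiff hsub, add_assoc]
  congr 1
  · refine Finset.sum_congr rfl fun p hp => ?_
    obtain ⟨a, b⟩ := p
    simp only [Finset.mem_sdiff, Finset.mem_filter, Finset.mem_univ, true_and, Finset.mem_insert,
      Finset.mem_singleton, Prod.mk_inj, not_or] at hp
    rw [hsame a b hp.1 hp.2.1 hp.2.2.1 hp.2.2.2]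
  · have hsum : ∀ f : Fin n × Fin n → ℕ, ∑ p ∈ ({(i, j), (i, l), (j, l)} : Finset (Fin n × Fin n)),
        f p = f (i, j) + f (i, l) + f (j, l) := by
      intro f
      rw [Finset.sum_insert (by simp [hjl.ne, hij.ne]), Finset.sum_pair (by simp [hij.ne]),
        add_assoc]
    rw [hsum, hsum, hB1, hB2, hB3, hB4, hB5]
    exact tileWeight_braid k hij hjl m1.1 m1.2.1 m1.2.2

/-- A flip changes the weight by at most one. -/
theorem FullWalk.weight_le_of_isFlip {a : Fin n → ℝ} (ha : StrictMono a) {ts ts' : List (Tile n)}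
    (h : FullWalk ts) (h' : FullWalk ts') (hf : IsFlip (lift a) (tilesOf ts) (tilesOf ts'))
    (k : ℕ) : weight k ts ≤ weight k ts' + 1 := by
  obtain ⟨C, hC, h1, h2⟩ := hf
  obtain ⟨i, j, l, hij, hjl, hCe⟩ := hC.eq_triple ha
  have e1 : sigma (tilesOf ts) ({i, l}, {j}) = - sigma (tilesOf ts') ({i, l}, {j}) := by
    rcases hCe with rfl | rfl
    · exact h1
    · rw [h.sigma_swap hij hjl, h'.sigma_swap hij hjl] at h1
      omega
  have hother : ∀ a b c, a < b → b < c → ¬ (a = i ∧ b = j ∧ c = l) →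
      (time ts a b < time ts b c ↔ time ts' a b < time ts' b c) := by
    intro x y z hxy hyz hne
    have hne' : ∀ {u : Fin n}, ¬ (({x, z}, {y}) : Finset (Fin n) × Finset (Fin n)) = ({u}, {i, l}) := by
      intro u he
      have h3 := congrArg (fun p => p.1.card) he
      simp [Finset.card_pair (hxy.trans hyz).ne] at h3
    have hne'' : ¬ (({x, z}, {y}) : Finset (Fin n) × Finset (Fin n)) = ({i, l}, {j}) := by
      intro he
      rw [Prod.mk_inj, Finset.singleton_inj] at he
      obtain ⟨rfl, rfl⟩ := pair_eq_pair_of_lt (hxy.trans hyz) (hij.trans hjl) he.1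
      exact hne ⟨rfl, he.2, rfl⟩
    have h3 := h2 ({x, z}, {y}) (isCircuit_lift ha hxy hyz)
      (by rcases hCe with rfl | rfl; exacts [hne'', hne'])
      (by rcases hCe with rfl | rfl; exacts [hne', hne''])
    rw [h.sigma_eq hxy hyz, h'.sigma_eq hxy hyz] at h3
    clear * - h3
    split_ifs at h3 <;> omega
  rw [h.sigma_eq hij hjl, h'.sigma_eq hij hjl] at e1
  by_cases hs : time ts i j < time ts j l
  · have hs' : ¬ time ts' i j < time ts' j l := by
      intro hs'
      rw [if_pos hs, if_pos hs'] at e1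
      omega
    obtain ⟨e, he, hw⟩ := h.weight_of_triple h' hij hjl hs hs' hother k
    omega
  · have hs' : time ts' i j < time ts' j l := by
      by_contra hs'
      rw [if_neg hs, if_neg hs'] at e1
      omega
    obtain ⟨e, he, hw⟩ := h'.weight_of_triple h hij hjl hs' hs
      (fun a b c hab hbc hne => (hother a b c hab hbc hne).symm) k
    omega

/-- A braid move is a flip of the corresponding tilings. -/
theorem FullWalk.isFlip_of_braid {a : Fin n → ℝ} (ha : StrictMono a) {us vs : List (Tile n)}
    {A : Finset (Fin n)} {i j l : Fin n} (hij : i < j) (hjl : j < l)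
    (h : FullWalk (us ++ (A, i, j) :: (insert j A, i, l) :: (A, j, l) :: vs))
    (h' : FullWalk (us ++ (insert i A, j, l) :: (A, i, l) :: (insert l A, i, j) :: vs)) :
    IsFlip (lift a) (tilesOf (us ++ (A, i, j) :: (insert j A, i, l) :: (A, j, l) :: vs))
      (tilesOf (us ++ (insert i A, j, l) :: (A, i, l) :: (insert l A, i, j) :: vs)) := by
  have hil := hij.trans hjl
  have hnd := h.nodup_pairs
  have hnd' := h'.nodup_pairs
  simp only [List.map_append, List.map_cons] at hnd hnd'
  have hU : (i, j) ∉ us.map Prod.snd ∧ (i, l) ∉ us.map Prod.snd ∧ (j, l) ∉ us.map Prod.snd := by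
    rw [List.nodup_append] at hnd
    exact ⟨fun h => hnd.2.2 _ h _ (by simp) rfl, fun h => hnd.2.2 _ h _ (by simp) rfl,
      fun h => hnd.2.2 _ h _ (by simp) rfl⟩
  obtain ⟨u1, u2, u3⟩ := hU
  set ts := us ++ (A, i, j) :: (insert j A, i, l) :: (A, j, l) :: vs with hts
  set ts' := us ++ (insert i A, j, l) :: (A, i, l) :: (insert l A, i, j) :: vs with hts'
  set N := us.length with hN
  have t1 : time ts i j = N ∧ time ts i l = N + 1 ∧ time ts j l = N + 2 := by
    simp only [time, hts, List.map_append, List.map_cons]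
    rw [List.idxOf_append_of_notMem u1, List.idxOf_append_of_notMem u2,
      List.idxOf_append_of_notMem u3]
    simp [hij.ne, hjl.ne]
    simp [hN]
  have t2 : time ts' j l = N ∧ time ts' i l = N + 1 ∧ time ts' i j = N + 2 := by
    simp only [time, hts', List.map_append, List.map_cons]
    rw [List.idxOf_append_of_notMem u1, List.idxOf_append_of_notMem u2,
      List.idxOf_append_of_notMem u3]
    simp [hij.ne', hjl.ne']
    simp [hN]
  have t3 : ∀ x y, ¬ (x = i ∧ y = j) → ¬ (x = i ∧ y = l) → ¬ (x = j ∧ y = l) →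
      time ts x y = time ts' x y ∧ (time ts x y < N ∨ N + 3 ≤ time ts x y) := by
    intro x y n1 n2 n3
    simp only [time, hts, hts', List.map_append, List.map_cons]
    by_cases hxy : (x, y) ∈ us.map Prod.snd
    · rw [List.idxOf_append_of_mem hxy, List.idxOf_append_of_mem hxy]
      refine ⟨rfl, .inl ?_⟩
      simpa using List.idxOf_lt_length_iff.2 hxy
    · rw [List.idxOf_append_of_notMem hxy, List.idxOf_append_of_notMem hxy]
      have n1' : (i, j) ≠ (x, y) := by simpa [eq_comm] using n1
      have n2' : (i, l) ≠ (x, y) := by simpa [eq_comm] using n2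
      have n3' : (j, l) ≠ (x, y) := by simpa [eq_comm] using n3
      rw [List.idxOf_cons_ne _ n1', List.idxOf_cons_ne _ n2', List.idxOf_cons_ne _ n3',
        List.idxOf_cons_ne _ n3', List.idxOf_cons_ne _ n2', List.idxOf_cons_ne _ n1']
      refine ⟨rfl, .inr ?_⟩
      simp only [List.length_map]
      omega
  have key : ∀ x y z, x < y → y < z → ¬ (x = i ∧ y = j ∧ z = l) →
      sigma (tilesOf ts) ({x, z}, {y}) = sigma (tilesOf ts') ({x, z}, {y}) := by
    intro x y z hxy hyz hne
    rw [h.sigma_eq hxy hyz, h'.sigma_eq hxy hyz]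
    congr 1
    have c : ∀ x y, (x = i ∧ y = j) ∨ (x = i ∧ y = l) ∨ (x = j ∧ y = l) ∨
        time ts x y = time ts' x y ∧ (time ts x y < N ∨ N + 3 ≤ time ts x y) := by
      intro x y
      have := t3 x y
      tauto
    obtain ⟨p1, p2, p3⟩ := t1
    obtain ⟨q1, q2, q3⟩ := t2
    have c1 := c x y
    have c2 := c y z
    rcases c1 with ⟨rfl, rfl⟩ | ⟨rfl, rfl⟩ | ⟨rfl, rfl⟩ | ⟨c1, c3⟩
    · rcases c2 with ⟨e1, e2⟩ | ⟨e1, e2⟩ | ⟨e1, e2⟩ | ⟨d1, d2⟩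
      · exact absurd e1 hij.ne'
      · exact absurd e1 hij.ne'
      · exact absurd ⟨rfl, rfl, e2⟩ hne
      · rw [eq_iff_iff]; omega
    · rcases c2 with ⟨e1, e2⟩ | ⟨e1, e2⟩ | ⟨e1, e2⟩ | ⟨d1, d2⟩
      · exact absurd e1 hil.ne'
      · exact absurd e1 hil.ne'
      · exact absurd e1 hjl.ne'
      · rw [eq_iff_iff]; omega
    · rcases c2 with ⟨e1, e2⟩ | ⟨e1, e2⟩ | ⟨e1, e2⟩ | ⟨d1, d2⟩
      · exact absurd e1 hil.ne'
      · exact absurd e1 hil.ne'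
      · exact absurd e1 hjl.ne'
      · rw [eq_iff_iff]; omega
    · rcases c2 with ⟨rfl, rfl⟩ | ⟨rfl, rfl⟩ | ⟨rfl, rfl⟩ | ⟨d1, d2⟩ <;> rw [eq_iff_iff] <;> omega
  refine ⟨({i, l}, {j}), isCircuit_lift ha hij hjl, ?_, ?_⟩
  · rw [h.sigma_eq hij hjl, h'.sigma_eq hij hjl, if_pos (by omega), if_neg (by omega)]
  · intro C hC n1 n2
    obtain ⟨x, y, z, hxy, hyz, rfl | rfl⟩ := hC.eq_triple ha
    · exact key x y z hxy hyz fun ⟨e1, e2, e3⟩ => n1 (by rw [e1, e2, e3])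
    · rw [h.sigma_swap hxy hyz, h'.sigma_swap hxy hyz, key x y z hxy hyz]
      rintro ⟨rfl, rfl, rfl⟩
      exact n2 rfl

/-! ### The effect of a move on the level paths -/

theorem tilesOf_comm (us vs : List (Tile n)) (s t : Tile n) :
    tilesOf (us ++ s :: t :: vs) = tilesOf (us ++ t :: s :: vs) := by
  ext p
  simp only [tilesOf, Set.mem_ofPred_eq, List.mem_append, List.mem_cons]
  grind

theorem FullWalk.levelPath_congr {ts ts' : List (Tile n)} (h : FullWalk ts) (h' : FullWalk ts')
    (he : tilesOf ts = tilesOf ts') (m : ℕ) :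
    levelPath m (List.finRange n) ts = levelPath m (List.finRange n) ts' :=
  h'.eq_levelPath (he ▸ h.isCrossSection m)

/-- The weight of a full walk is the weight of the reduction of its level path. -/
theorem FullWalk.weight_eq_pathWeight_reduceList {k : ℕ} (hk : k + 1 ≤ n) {ts : List (Tile n)}
    (h : FullWalk ts) :
    weight k ts = pathWeight (reduceList (k + 1) (levelPath (k + 1) (List.finRange n) ts)) := by
  obtain ⟨us, -, hr, hred⟩ := h.exists_reduced hk
  rw [← (h.isPath hk).eq_reduceList hr hred, ((h.isPath hk).removes hr).2,
    Walk.pathWeight_levelPath h (List.nodup_finRange n)]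

/-- A move between full walks either preserves the reduction of the level path, or is a flip that
changes the level path and lowers the weight by one. -/
theorem FullWalk.move {a : Fin n → ℝ} (ha : StrictMono a) {k : ℕ} (hk : k + 1 ≤ n)
    {ts ts' : List (Tile n)} (h : FullWalk ts) (hM : Move ts ts') :
    reduceList (k + 1) (levelPath (k + 1) (List.finRange n) ts) =
        reduceList (k + 1) (levelPath (k + 1) (List.finRange n) ts') ∨
      levelPath (k + 1) (List.finRange n) ts ≠ levelPath (k + 1) (List.finRange n) ts' ∧
        weight k ts = weight k ts' + 1 ∧ IsFlip (lift a) (tilesOf ts) (tilesOf ts') := by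
  have hnd := List.nodup_finRange n
  have h' : FullWalk ts' := Walk.move hnd h hM
  cases hM with
  | @comm us vs s t hst =>
    exact .inl (by rw [h.levelPath_congr h' (tilesOf_comm us vs s t)])
  | @braid us vs A i j l hij hjl =>
    have hil := hij.trans hjl
    obtain ⟨-, hi, hj, -⟩ := h.mem_tile hnd (A := A) (i := i) (j := j) (by simp)
    obtain ⟨-, -, hl, -⟩ := h.mem_tile hnd (A := A) (i := j) (j := l) (by simp)
    have cj := Finset.card_insert_of_notMem hj
    have ci := Finset.card_insert_of_notMem hi
    have cl := Finset.card_insert_of_notMem hl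
    by_cases h1 : A.card + 1 = k + 1
    · left
      refine (h.isPath hk).reduceList_eq_of_remove ?_
      -- The vertex before the two steps `A ∪ {i} → A ∪ {j} → A ∪ {l}` is `A ∪ {i}`.
      obtain ⟨r, hr1, hr2⟩ := Walk.split h
      obtain ⟨α, β, rfl, rfl, -⟩ := hr2.cons_inv
      have hlast := hr1.getLast?_levelPath (m := k + 1) hnd
      have hα : α.length + 1 = k + 1 := by
        rw [← h1, List.toFinset_card_of_nodup]
        exact (List.nodup_append.1 (hr1.perm.nodup_iff.1 hnd)).1
      rw [toFinset_take_length hα] at hlast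
      obtain ⟨P, hP⟩ : ∃ P, levelPath (k + 1) (List.finRange n) us =
          P ++ [insert i α.toFinset] := by
        rw [List.getLast?_eq_some_iff] at hlast
        exact hlast
      refine ⟨P, vs.filterMap (tileTop (k + 1)), insert i α.toFinset, insert j α.toFinset,
        insert l α.toFinset, ?_, ?_, ?_⟩
      · have : insert i α.toFinset ∩ insert j α.toFinset ∩ insert l α.toFinset = α.toFinset := by
          rw [insert_inter_insert hij.ne]
          exact Finset.inter_eq_left.2 (Finset.subset_insert _ _)
        rw [this]
        omega
      · rw [levelPath] at hP ⊢
        rw [List.filterMap_append, ← List.cons_append, hP]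
        simp [tileTop, h1, cj]
      · rw [levelPath] at hP ⊢
        rw [List.filterMap_append, ← List.cons_append, hP]
        simp [tileTop, h1, ci, cl]
    · have h3 : A.card ≠ k := fun h => h1 (by omega)
      by_cases h2 : A.card + 1 = k
      · right
        refine ⟨fun he => ?_, ?_, h.isFlip_of_braid ha hij hjl h'⟩
        · have := congrArg List.length he
          simp [levelPath, tileTop, h2, cj, ci, cl] at this
        · have := tileWeight_braid k hij hjl hi hj hl
          rw [if_pos h2] at this
          simp only [weight, List.map_append, List.map_cons, List.sum_append, List.sum_cons]
          omega
      · left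
        simp [levelPath, tileTop, h2, h3, cj, ci, cl]

/-! ### Points on the paths of a walk -/

theorem proj_lift (a x : Fin n → ℝ) : proj (lift a) x = (∑ i, x i * a i, ∑ i, x i) :=
  sum_smul_lift

/-- The point at height `y` of the lift to the cube of the path of a permutation `p`: this lift goes
from `0` to `1` by raising the coordinates one after the other, in the order of `p`. -/
noncomputable def pathPoint (p : List (Fin n)) (y : ℝ) : Fin n → ℝ :=
  fun i => max 0 (min 1 (y - p.idxOf i))

theorem pathPoint_mem_cube (p : List (Fin n)) (y : ℝ) : pathPoint p y ∈ cube n :=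
  ⟨fun _ => le_max_left _ _, fun _ => max_le zero_le_one (min_le_left _ _)⟩

theorem sum_clamp_sub (N : ℕ) (y : ℝ) (hy : 0 ≤ y) :
    ∑ k ∈ Finset.range N, max 0 (min 1 (y - k)) = min y N := by
  induction N with
  | zero => simp [hy]
  | succ N ih =>
    rw [Finset.sum_range_succ, ih]
    push_cast
    grind

theorem sum_pathPoint {p : List (Fin n)} (hp : p.Perm (List.finRange n)) {y : ℝ} (h0 : 0 ≤ y)
    (hn : y ≤ n) : ∑ i, pathPoint p y i = y := by
  have hnd : p.Nodup := hp.nodup_iff.2 (List.nodup_finRange n)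
  have hmem : ∀ i, i ∈ p := fun i => hp.mem_iff.2 (List.mem_finRange i)
  have hlen : p.length = n := by simpa using hp.length_eq
  have h1 : ∑ i, pathPoint p y i = ∑ k ∈ Finset.range n, max 0 (min 1 (y - k)) := by
    refine Finset.sum_bij (fun i _ => p.idxOf i) ?_ ?_ ?_ ?_
    · exact fun i _ => by simpa [hlen] using List.idxOf_lt_length_iff.2 (hmem i)
    · exact fun i _ j _ he => (List.idxOf_inj (hmem i)).1 he
    · intro k hk
      have hk' : k < p.length := by simpa [hlen] using hk
      exact ⟨p[k], Finset.mem_univ _, hnd.idxOf_getElem k hk'⟩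
    · exact fun i _ => rfl
  rw [h1, sum_clamp_sub n y h0, min_eq_left hn]

theorem sum_mul_eq_of_agree {x x' : Fin n → ℝ} (b : Fin n → ℝ) {u v : Fin n} (huv : u ≠ v)
    (h : ∀ w, w ≠ u → w ≠ v → x w = x' w) :
    ∑ w, x w * b w = ∑ w, x' w * b w + (x u - x' u) * b u + (x v - x' v) * b v := by
  have := Fintype.sum_eq_add (f := fun w => (x w - x' w) * b w) u v huv
    fun w hw => by simp [h w hw.1 hw.2]
  simp only [sub_mul, Finset.sum_sub_distrib] at this
  linarith

theorem sum_eq_of_agree {x x' : Fin n → ℝ} {u v : Fin n} (huv : u ≠ v)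
    (h : ∀ w, w ≠ u → w ≠ v → x w = x' w) :
    ∑ w, x w = ∑ w, x' w + (x u - x' u) + (x v - x' v) := by
  simpa using sum_mul_eq_of_agree 1 huv h

/-- The positions in a list in which two neighbours are singled out. -/
theorem idxOf_append_pair {α β : List (Fin n)} {i j : Fin n} (hp : (α ++ i :: j :: β).Nodup) :
    (α ++ i :: j :: β).idxOf i = α.length ∧ (α ++ i :: j :: β).idxOf j = α.length + 1 ∧
      (∀ w ∈ α, (α ++ i :: j :: β).idxOf w + 1 ≤ α.length) ∧
      ∀ w, w ∉ α → w ≠ i → w ≠ j → α.length + 2 ≤ (α ++ i :: j :: β).idxOf w := by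
  have hi : i ∉ α := fun h => (List.nodup_append.1 hp).2.2 i h i (by simp) rfl
  have hj : j ∉ α := fun h => (List.nodup_append.1 hp).2.2 j h j (by simp) rfl
  have hij : i ≠ j := fun h => by simp [h, List.nodup_append] at hp
  refine ⟨?_, ?_, fun w hw => ?_, fun w hw hwi hwj => ?_⟩
  · rw [List.idxOf_append_of_notMem hi]
    simp
  · rw [List.idxOf_append_of_notMem hj, List.idxOf_cons_ne _ hij]
    simp
  · rw [List.idxOf_append_of_mem hw]
    exact List.idxOf_lt_length_iff.2 hw
  · rw [List.idxOf_append_of_notMem hw, List.idxOf_cons_ne _ hwi.symm, List.idxOf_cons_ne _ hwj.symm]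
    omega

theorem idxOf_append_swap {α β : List (Fin n)} {i j w : Fin n} (hwi : w ≠ i) (hwj : w ≠ j) :
    (α ++ i :: j :: β).idxOf w = (α ++ j :: i :: β).idxOf w := by
  by_cases hw : w ∈ α
  · rw [List.idxOf_append_of_mem hw, List.idxOf_append_of_mem hw]
  · rw [List.idxOf_append_of_notMem hw, List.idxOf_append_of_notMem hw,
      List.idxOf_cons_ne _ hwi.symm, List.idxOf_cons_ne _ hwj.symm, List.idxOf_cons_ne _ hwj.symm,
      List.idxOf_cons_ne _ hwi.symm]

theorem pathPoint_mem_cubeFace {α β : List (Fin n)} {i j : Fin n} (hp : (α ++ i :: j :: β).Nodup)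
    {y : ℝ} (h1 : α.length ≤ y) (h2 : y ≤ α.length + 2) :
    pathPoint (α ++ i :: j :: β) y ∈ cubeFace α.toFinset {i, j} := by
  obtain ⟨-, -, e3, e4⟩ := idxOf_append_pair hp
  refine ⟨pathPoint_mem_cube _ _, fun w hw => ?_, fun w hw => ?_⟩
  · have h3 : (((α ++ i :: j :: β).idxOf w + 1 : ℕ) : ℝ) ≤ α.length :=
      Nat.cast_le.2 (e3 w (by simpa using hw))
    push_cast at h3
    rw [pathPoint, min_eq_left (by linarith), max_eq_right zero_le_one]
  · simp at hw
    have h3 : ((α.length + 2 : ℕ) : ℝ) ≤ (α ++ i :: j :: β).idxOf w :=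
      Nat.cast_le.2 (e4 w (by tauto) (by tauto) (by tauto))
    push_cast at h3
    exact max_eq_left (min_le_of_right_le (by linarith))

theorem eq_of_mem_cubeFace_pair {A : Finset (Fin n)} {i j : Fin n} {x x' : Fin n → ℝ}
    (hx : x ∈ cubeFace A {i, j}) (hx' : x' ∈ cubeFace A {i, j}) {w : Fin n} (hwi : w ≠ i)
    (hwj : w ≠ j) : x w = x' w := by
  by_cases hw : w ∈ A
  · rw [hx.2.1 w hw, hx'.2.1 w hw]
  · rw [hx.2.2 w (by simp [hw, hwi, hwj]), hx'.2.2 w (by simp [hw, hwi, hwj])]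

/-- The projection is injective on the faces of the tiles. -/
theorem eq_of_proj_eq {a : Fin n → ℝ} (ha : StrictMono a) {A : Finset (Fin n)} {i j : Fin n}
    (hij : i ≠ j) {x x' : Fin n → ℝ} (hx : x ∈ cubeFace A {i, j}) (hx' : x' ∈ cubeFace A {i, j})
    (h : proj (lift a) x = proj (lift a) x') : x = x' := by
  have hag := fun w (hwi : w ≠ i) (hwj : w ≠ j) => eq_of_mem_cubeFace_pair hx hx' hwi hwj
  rw [proj_lift, proj_lift, Prod.mk_inj, sum_mul_eq_of_agree a hij hag,
    sum_eq_of_agree hij hag] at h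
  have h1 : x j - x' j = 0 := by
    have h2 : (x j - x' j) * (a j - a i) = 0 := by linear_combination h.1 - a i * h.2
    exact (mul_eq_zero.1 h2).resolve_right (sub_ne_zero.2 (ha.injective.ne hij.symm))
  ext w
  by_cases hwi : w = i
  · rw [hwi]
    linarith [h.2]
  by_cases hwj : w = j
  · rw [hwj]
    linarith
  exact hag w hwi hwj

theorem sum_of_mem_cubeFace {A : Finset (Fin n)} {i j : Fin n} (hij : i ≠ j) (hi : i ∉ A)
    (hj : j ∉ A) {x : Fin n → ℝ} (hx : x ∈ cubeFace A {i, j}) :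
    ∑ w, x w = A.card + x i + x j := by
  have h1 : (fun w => if w ∈ A then (1 : ℝ) else 0) ∈ cubeFace A {i, j} := by
    refine ⟨⟨fun w => ?_, fun w => ?_⟩, fun w hw => if_pos hw, fun w hw => if_neg fun h => hw ?_⟩
    · dsimp only
      split_ifs <;> simp
    · dsimp only
      split_ifs <;> simp
    · simp [h]
  rw [sum_eq_of_agree hij fun w hwi hwj => eq_of_mem_cubeFace_pair hx h1 hwi hwj]
  simp [hi, hj]

/-- Compared with a path that raises `u` and then `v` along a tile, any other point of the tile at
the same height moves some amount `d` from `u` to `v`. -/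
theorem exists_shift_of_mem_cubeFace (a : Fin n → ℝ) {α β : List (Fin n)} {u v : Fin n}
    (hp : (α ++ u :: v :: β).Nodup) {x : Fin n → ℝ} (hx : x ∈ cubeFace α.toFinset {u, v}) :
    ∃ d, 0 ≤ d ∧ ∑ i, x i * a i =
        ∑ i, pathPoint (α ++ u :: v :: β) (∑ i, x i) i * a i + d * (a v - a u) ∧
      (d = 0 → x = pathPoint (α ++ u :: v :: β) (∑ i, x i)) := by
  have huv : u ≠ v := fun h => by simp [h, List.nodup_append] at hp
  have hu : u ∉ α.toFinset := fun h =>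
    (List.nodup_append.1 hp).2.2 u (by simpa using h) u (by simp) rfl
  have hv : v ∉ α.toFinset := fun h =>
    (List.nodup_append.1 hp).2.2 v (by simpa using h) v (by simp) rfl
  have hcard : α.toFinset.card = α.length := List.toFinset_card_of_nodup (List.nodup_append.1 hp).1
  have hsum := sum_of_mem_cubeFace huv hu hv hx
  rw [hcard] at hsum
  have u0 : 0 ≤ x u := hx.1.1 u
  have u1 : x u ≤ 1 := hx.1.2 u
  have v0 : 0 ≤ x v := hx.1.1 v
  have v1 : x v ≤ 1 := hx.1.2 v
  have hy : pathPoint (α ++ u :: v :: β) (∑ i, x i) ∈ cubeFace α.toFinset {u, v} :=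
    pathPoint_mem_cubeFace hp (by linarith) (by linarith)
  obtain ⟨e1, e2, -⟩ := idxOf_append_pair hp
  have hu' : pathPoint (α ++ u :: v :: β) (∑ i, x i) u = max 0 (min 1 (x u + x v)) := by
    rw [pathPoint, e1, hsum]
    congr 2
    ring
  have hv' : pathPoint (α ++ u :: v :: β) (∑ i, x i) v = max 0 (min 1 (x u + x v - 1)) := by
    rw [pathPoint, e2, hsum]
    congr 2
    push_cast
    ring
  generalize pathPoint (α ++ u :: v :: β) (∑ i, x i) = y at hy hu' hv'
  have hag := fun w (hwu : w ≠ u) (hwv : w ≠ v) => eq_of_mem_cubeFace_pair hx hy hwu hwv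
  have huv' : x u - y u = - (x v - y v) := by
    rw [hu', hv']
    grind
  refine ⟨x v - y v, ?_, ?_, fun h => ?_⟩
  · rw [hv']
    grind
  · rw [sum_mul_eq_of_agree a huv hag, huv']
    ring
  · ext w
    by_cases hwu : w = u
    · rw [hwu]
      linarith
    by_cases hwv : w = v
    · rw [hwv]
      linarith
    exact hag w hwu hwv

/-- A swap does not move a point of the path, or moves it to the right. In the latter case, the tile
of the swap contains the segment between the two points. -/
theorem pathPoint_swap {a : Fin n → ℝ} (ha : StrictMono a) {α β : List (Fin n)} {i j : Fin n}
    (hij : i < j) (hp : (α ++ i :: j :: β).Nodup) (y : ℝ) :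
    pathPoint (α ++ i :: j :: β) y = pathPoint (α ++ j :: i :: β) y ∨
      ∑ w, pathPoint (α ++ i :: j :: β) y w * a w < ∑ w, pathPoint (α ++ j :: i :: β) y w * a w ∧
      α.length ≤ y ∧ y ≤ α.length + 2 := by
  have hp' := ((List.Perm.swap j i β).append_left α).nodup_iff.1 hp
  obtain ⟨e1, e2, -⟩ := idxOf_append_pair hp
  obtain ⟨e3, e4, -⟩ := idxOf_append_pair hp'
  have hag : ∀ w, w ≠ j → w ≠ i →
      pathPoint (α ++ j :: i :: β) y w = pathPoint (α ++ i :: j :: β) y w := fun w h1 h2 => by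
    rw [pathPoint, pathPoint, idxOf_append_swap h1 h2]
  have hi : pathPoint (α ++ i :: j :: β) y i = max 0 (min 1 (y - α.length)) := by
    rw [pathPoint, e1]
  have hj : pathPoint (α ++ i :: j :: β) y j = max 0 (min 1 (y - (α.length + 1))) := by
    rw [pathPoint, e2]
    push_cast
    rfl
  have hi' : pathPoint (α ++ j :: i :: β) y i = max 0 (min 1 (y - (α.length + 1))) := by
    rw [pathPoint, e4]
    push_cast
    rfl
  have hj' : pathPoint (α ++ j :: i :: β) y j = max 0 (min 1 (y - α.length)) := by
    rw [pathPoint, e3]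
  by_cases hy : α.length ≤ y ∧ y ≤ α.length + 2
  · rcases eq_or_ne (pathPoint (α ++ i :: j :: β) y j) (pathPoint (α ++ j :: i :: β) y j)
      with he | he
    · left
      ext w
      by_cases hwj : w = j
      · rw [hwj, he]
      by_cases hwi : w = i
      · rw [hwi, hi, hi', ← hj, ← hj', he]
      exact (hag w hwj hwi).symm
    · right
      refine ⟨?_, hy⟩
      rw [sum_mul_eq_of_agree a hij.ne' hag, hi, hj, hi', hj']
      rw [hj, hj'] at he
      have h1 : max 0 (min 1 (y - (α.length + 1))) ≤ max 0 (min 1 (y - α.length)) := by gcongr; simp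
      have h2 := mul_pos (sub_pos.2 (lt_of_le_of_ne h1 he)) (sub_pos.2 (ha hij))
      linarith
  · left
    have he : max 0 (min 1 (y - (α.length + 1))) = max 0 (min 1 (y - α.length)) := by
      rw [not_and_or, not_le, not_le] at hy
      grind
    ext w
    by_cases hwj : w = j
    · rw [hwj, hj, hj', he]
    by_cases hwi : w = i
    · rw [hwi, hi, hi', he]
    exact (hag w hwj hwi).symm

/-- If a path passes its entries in the order of increasing values of `b`, then it attains the
minimum of `∑ i, x i * b i` over all points of the cube of the given height, and no other point
does. -/
theorem eq_pathPoint_or_lt {b : Fin n → ℝ} {p : List (Fin n)} (hp : p.Perm (List.finRange n))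
    (hb : p.Pairwise fun i j => b i < b j) {x : Fin n → ℝ} (hx : x ∈ cube n) :
    x = pathPoint p (∑ i, x i) ∨
      ∑ i, pathPoint p (∑ i, x i) i * b i < ∑ i, x i * b i := by
  have hnd : p.Nodup := hp.nodup_iff.2 (List.nodup_finRange n)
  have hmem : ∀ i, i ∈ p := fun i => hp.mem_iff.2 (List.mem_finRange i)
  have hlen : p.length = n := by simpa using hp.length_eq
  have h0 : 0 ≤ ∑ i, x i := Finset.sum_nonneg fun i _ => hx.1 i
  have hn : ∑ i, x i ≤ n := by
    have := Finset.sum_le_sum fun i (_ : i ∈ Finset.univ) => hx.2 i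
    simpa using this
  have hsum := sum_pathPoint hp h0 hn
  set y := ∑ i, x i with hy
  have hlt : ∀ i, p.idxOf i < n := fun i =>
    (List.idxOf_lt_length_iff.2 (hmem i)).trans_eq hlen
  rcases hn.eq_or_lt with hn | hn
  · left
    have h1 : ∑ i, (1 - x i) = 0 := by simp [← hy, hn]
    have h1' := (Finset.sum_eq_zero_iff_of_nonneg fun i _ => sub_nonneg.2 (hx.2 i)).1 h1
    ext i
    have h2 : ((p.idxOf i + 1 : ℕ) : ℝ) ≤ n := Nat.cast_le.2 (hlt i)
    push_cast at h2
    rw [pathPoint, min_eq_left (by linarith), max_eq_right zero_le_one]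
    have h3 : 1 - x i = 0 := h1' i (Finset.mem_univ i)
    linarith
  · have hN : ⌊y⌋₊ < p.length := by
      rw [hlen]
      exact (Nat.floor_lt h0).2 hn
    set t := p[⌊y⌋₊] with ht
    have hle := Nat.floor_le h0
    have hfl := Nat.lt_floor_add_one y
    have hidx : p.idxOf t = ⌊y⌋₊ := hnd.idxOf_getElem _ hN
    have hget : ∀ i, p[p.idxOf i]'(List.idxOf_lt_length_iff.2 (hmem i)) = i := fun i => by simp
    have hterm : ∀ i, 0 ≤ (x i - pathPoint p y i) * (b i - b t) ∧
        (i ≠ t → (x i - pathPoint p y i) * (b i - b t) = 0 → x i = pathPoint p y i) := by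
      intro i
      rcases lt_trichotomy (p.idxOf i) ⌊y⌋₊ with h | h | h
      · have h1 : b i < b t := by
          have := List.pairwise_iff_getElem.1 hb _ _ (List.idxOf_lt_length_iff.2 (hmem i)) hN h
          rwa [hget] at this
        have h2 : pathPoint p y i = 1 := by
          have h3 : ((p.idxOf i + 1 : ℕ) : ℝ) ≤ ⌊y⌋₊ := Nat.cast_le.2 h
          push_cast at h3
          rw [pathPoint, min_eq_left (by linarith), max_eq_right zero_le_one]
        have h3 : x i ≤ 1 := hx.2 i
        rw [h2]
        exact ⟨mul_nonneg_of_nonpos_of_nonpos (by linarith) (by linarith), fun _ h4 => by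
          linarith [(mul_eq_zero.1 h4).resolve_right (by linarith)]⟩
      · have : i = t := (List.idxOf_inj (hmem i)).1 (h.trans hidx.symm)
        simp [this]
      · have h1 : b t < b i := by
          have := List.pairwise_iff_getElem.1 hb _ _ hN (List.idxOf_lt_length_iff.2 (hmem i)) h
          rwa [hget] at this
        have h2 : pathPoint p y i = 0 := by
          have h3 : ((⌊y⌋₊ + 1 : ℕ) : ℝ) ≤ p.idxOf i := Nat.cast_le.2 h
          push_cast at h3
          exact max_eq_left (min_le_of_right_le (by linarith))
        have h3 : 0 ≤ x i := hx.1 i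
        rw [h2]
        exact ⟨mul_nonneg (by linarith) (by linarith), fun _ h4 => by
          linarith [(mul_eq_zero.1 h4).resolve_right (by linarith)]⟩
    have hdiff : ∑ i, (x i - pathPoint p y i) * (b i - b t) =
        ∑ i, x i * b i - ∑ i, pathPoint p y i * b i := by
      have h1 : ∀ i, (x i - pathPoint p y i) * (b i - b t) =
          x i * b i - pathPoint p y i * b i - (x i - pathPoint p y i) * b t := fun i => by ring
      simp only [h1, Finset.sum_sub_distrib, ← Finset.sum_mul]
      rw [hsum, ← hy]
      ring
    have hnn := Finset.sum_nonneg fun i (_ : i ∈ Finset.univ) => (hterm i).1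
    rcases hnn.eq_or_lt with h | h
    · left
      have h1 := (Finset.sum_eq_zero_iff_of_nonneg fun i _ => (hterm i).1).1 h.symm
      have h2 : ∀ i, i ≠ t → x i = pathPoint p y i := fun i hi =>
        (hterm i).2 hi (h1 i (Finset.mem_univ i))
      ext i
      by_cases hi : i = t
      · have h3 : ∑ i, (x i - pathPoint p y i) = 0 := by
          rw [Finset.sum_sub_distrib, hsum, ← hy, sub_self]
        rw [Fintype.sum_eq_single t fun j hj => by rw [h2 j hj, sub_self]] at h3
        rw [hi]
        linarith
      · exact h2 i hi
    · right
      linarith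

/-! ### The tiling of a full walk -/

/-- The tiles of a walk lie to the right of its first path. -/
theorem Walk.eq_pathPoint_or_lt {a : Fin n → ℝ} (ha : StrictMono a) {p q : List (Fin n)}
    {ts : List (Tile n)} (h : Walk p ts q) (hp : p.Nodup) {A : Finset (Fin n)} {i j : Fin n}
    (ht : (A, i, j) ∈ ts) {x : Fin n → ℝ} (hx : x ∈ cubeFace A {i, j}) :
    x = pathPoint p (∑ w, x w) ∨
      ∑ w, pathPoint p (∑ w, x w) w * a w < ∑ w, x w * a w := by
  induction h with
  | nil p => simp at ht
  | @cons α β i' j' ts q hij h ih =>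
    have hp' := ((List.Perm.swap j' i' β).append_left α).nodup_iff.1 hp
    rcases List.mem_cons.1 ht with he | ht
    · cases he
      obtain ⟨d, h0, h1, h2⟩ := exists_shift_of_mem_cubeFace a hp hx
      rcases h0.eq_or_lt with h0 | h0
      · exact .inl (h2 h0.symm)
      · right
        rw [h1]
        exact lt_add_of_pos_right _ (mul_pos h0 (sub_pos.2 (ha hij)))
    · have h2 := ih hp' ht
      rcases pathPoint_swap ha hij hp (∑ w, x w) with h1 | ⟨h1, -⟩
      · rwa [h1]
      · rcases h2 with h2 | h2
        · exact .inr (h1.trans_eq (by rw [← h2]))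
        · exact .inr (h1.trans h2)

/-- A tile of a walk has only points of its face in common with the other tiles: a path of the walk
separates the two tiles. -/
theorem Walk.eq_of_proj_eq {a : Fin n → ℝ} (ha : StrictMono a) {p q : List (Fin n)}
    {ts : List (Tile n)} (h : Walk p ts q) (hp : p.Nodup) {A B : Finset (Fin n)} {i j i' j' : Fin n}
    (ht : (A, i, j) ∈ ts) (ht' : (B, i', j') ∈ ts) {x x' : Fin n → ℝ}
    (hx : x ∈ cubeFace A {i, j}) (hx' : x' ∈ cubeFace B {i', j'})
    (he : proj (lift a) x = proj (lift a) x') : x = x' := by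
  induction h with
  | nil p => simp at ht
  | @cons α β i₀ j₀ ts q hij h ih =>
    have hp' := ((List.Perm.swap j₀ i₀ β).append_left α).nodup_iff.1 hp
    have key : ∀ {B : Finset (Fin n)} {i' j' : Fin n} {x x' : Fin n → ℝ}, (B, i', j') ∈ ts →
        x ∈ cubeFace α.toFinset {i₀, j₀} → x' ∈ cubeFace B {i', j'} →
        proj (lift a) x = proj (lift a) x' → x = x' := by
      intro B i' j' x x' ht' hx hx' he
      rw [proj_lift, proj_lift, Prod.mk_inj] at he
      rw [Finset.pair_comm] at hx
      obtain ⟨d, h0, h1, h2⟩ := exists_shift_of_mem_cubeFace a hp' hx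
      have h3 := mul_nonneg h0 (sub_nonneg.2 (ha hij).le)
      rcases h.eq_pathPoint_or_lt ha hp' ht' hx' with h4 | h4
      · rw [← he.2] at h4
        rw [← h4, ← he.1] at h1
        have h5 : d * (a i₀ - a j₀) = 0 := by linarith
        rw [h2 ((mul_eq_zero.1 h5).resolve_right (sub_ne_zero.2 (ha.injective.ne hij.ne))), ← h4]
      · rw [← he.1, ← he.2] at h4
        linarith
    rcases List.mem_cons.1 ht with h1 | h1 <;> rcases List.mem_cons.1 ht' with h2 | h2
    · cases h1
      cases h2
      exact HyperTri.eq_of_proj_eq ha hij.ne hx hx' he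
    · cases h1
      exact key h2 hx hx' he
    · cases h2
      exact (key h1 hx' hx he.symm).symm
    · exact ih hp' h1 h2

theorem convex_cubeFace (A B : Finset (Fin n)) : Convex ℝ (cubeFace A B) := by
  intro x hx y hy s t hs ht hst
  refine ⟨convex_Icc (0 : Fin n → ℝ) 1 hx.1 hy.1 hs ht hst, fun i hi => ?_, fun i hi => ?_⟩
  · simp [hx.2.1 i hi, hy.2.1 i hi, hst]
  · simp [hx.2.2 i hi, hy.2.2 i hi]

/-- The tiles of a walk cover the points between its first and its last path. -/
theorem Walk.exists_mem_tile {a : Fin n → ℝ} (ha : StrictMono a) {p q : List (Fin n)}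
    {ts : List (Tile n)} (h : Walk p ts q) (hp : p.Perm (List.finRange n)) {X y : ℝ} (h0 : 0 ≤ y)
    (hn : y ≤ n) (h1 : ∑ w, pathPoint p y w * a w ≤ X) (h2 : X ≤ ∑ w, pathPoint q y w * a w) :
    pathPoint p y = pathPoint q y ∨
      ∃ A i j, (A, i, j) ∈ ts ∧ ∃ x ∈ cubeFace A {i, j}, proj (lift a) x = (X, y) := by
  induction h with
  | nil p => exact .inl rfl
  | @cons α β i j ts q hij h ih =>
    have hp' := ((List.Perm.swap j i β).append_left α).symm.trans hp
    have hnd := hp.nodup_iff.2 (List.nodup_finRange n)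
    have hnd' := hp'.nodup_iff.2 (List.nodup_finRange n)
    have rest : ∑ w, pathPoint (α ++ j :: i :: β) y w * a w ≤ X →
        pathPoint (α ++ j :: i :: β) y = pathPoint q y ∨ ∃ A i' j',
          (A, i', j') ∈ (α.toFinset, i, j) :: ts ∧
          ∃ x ∈ cubeFace A {i', j'}, proj (lift a) x = (X, y) := by
      intro hX
      obtain h3 | ⟨A, i', j', ht, hx⟩ := ih hp' hX h2
      · exact .inl h3
      · exact .inr ⟨A, i', j', List.mem_cons_of_mem _ ht, hx⟩
    rcases pathPoint_swap ha hij hnd y with h3 | ⟨h3, h4, h5⟩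
    · rw [h3] at h1 ⊢
      exact rest h1
    · right
      rcases le_or_gt X (∑ w, pathPoint (α ++ j :: i :: β) y w * a w) with h6 | h6
      · refine ⟨α.toFinset, i, j, List.mem_cons_self, ?_⟩
        set x := pathPoint (α ++ i :: j :: β) y with hx
        set x' := pathPoint (α ++ j :: i :: β) y with hx'
        have m1 : x ∈ cubeFace α.toFinset {i, j} := pathPoint_mem_cubeFace hnd h4 h5
        have m2 : x' ∈ cubeFace α.toFinset {i, j} := by
          rw [Finset.pair_comm]
          exact pathPoint_mem_cubeFace hnd' h4 h5
        set g := ∑ w, x w * a w with hg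
        set g' := ∑ w, x' w * a w with hg'
        have hgg : 0 < g' - g := sub_pos.2 h3
        refine ⟨x + ((X - g) / (g' - g)) • (x' - x), ?_, ?_⟩
        · exact (convex_cubeFace _ _).add_smul_sub_mem m1 m2
            ⟨div_nonneg (by linarith) hgg.le, (div_le_one hgg).2 (by linarith)⟩
        · have s1 : ∑ w, x w = y := sum_pathPoint hp h0 hn
          have s2 : ∑ w, x' w = y := sum_pathPoint hp' h0 hn
          rw [proj_lift, Prod.mk_inj]
          generalize hθ : (X - g) / (g' - g) = θ
          have e1 : ∀ w, (x + θ • (x' - x)) w * a w =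
              x w * a w + θ * (x' w * a w - x w * a w) := fun w => by
            simp
            ring
          have e2 : ∀ w, (x + θ • (x' - x)) w = x w + θ * (x' w - x w) := fun w => by simp
          constructor
          · simp only [e1, Finset.sum_add_distrib, ← Finset.mul_sum, Finset.sum_sub_distrib]
            rw [← hg, ← hg', ← hθ, div_mul_cancel₀ _ hgg.ne']
            ring
          · simp only [e2, Finset.sum_add_distrib, ← Finset.mul_sum, Finset.sum_sub_distrib]
            rw [s1, s2]
            ring
      · refine (rest h6.le).resolve_left fun h7 => ?_
        rw [h7] at h6
        linarith

theorem height_nonneg {x : Fin n → ℝ} (hx : x ∈ cube n) : 0 ≤ ∑ i, x i :=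
  Finset.sum_nonneg fun i _ => hx.1 i

theorem height_le {x : Fin n → ℝ} (hx : x ∈ cube n) : ∑ i, x i ≤ n := by
  have := Finset.sum_le_sum fun i (_ : i ∈ Finset.univ) => hx.2 i
  simpa using this

theorem pathPoint_finRange_ne {y : ℝ} (hn : 2 ≤ n) (h0 : 0 < y) (h1 : y < n) :
    pathPoint (List.finRange n) y ≠ pathPoint (List.finRange n).reverse y := by
  intro he
  have hnd := List.nodup_finRange n
  have h2 := congrFun he ⟨0, by omega⟩
  have e1 : (List.finRange n).idxOf ⟨0, by omega⟩ = 0 := by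
    simp
  have e2 : (List.finRange n).reverse.idxOf ⟨0, by omega⟩ = n - 1 := by
    have := (List.nodup_reverse.2 hnd).idxOf_getElem (n - 1) (by simp; omega)
    simpa [List.getElem_reverse] using this
  rw [pathPoint, pathPoint, e1, e2, Nat.cast_sub (by omega)] at h2
  have : (2 : ℝ) ≤ n := by exact_mod_cast hn
  push_cast at h2
  grind

/-- The tiles of a full walk cover the zonotope, every point of which lies between the first and the
last path of the walk. -/
theorem FullWalk.exists_mem_tile {a : Fin n → ℝ} (ha : StrictMono a) (hn : 2 ≤ n)
    {ts : List (Tile n)} (h : FullWalk ts) {x : Fin n → ℝ} (hx : x ∈ cube n) :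
    ∃ A i j, (A, i, j) ∈ ts ∧ ∃ x' ∈ cubeFace A {i, j}, proj (lift a) x' = proj (lift a) x := by
  have hperm : (List.finRange n).reverse.Perm (List.finRange n) := List.reverse_perm _
  have hnR : (2 : ℝ) ≤ n := by exact_mod_cast hn
  have key : ∀ {x : Fin n → ℝ}, x ∈ cube n → 0 < ∑ i, x i → ∑ i, x i < n →
      ∃ A i j, (A, i, j) ∈ ts ∧
        ∃ x' ∈ cubeFace A {i, j}, proj (lift a) x' = proj (lift a) x := by
    intro x hx h0 h1
    rw [proj_lift a x]
    refine (Walk.exists_mem_tile ha h (.refl _) h0.le h1.le ?_ ?_).resolve_left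
      (pathPoint_finRange_ne hn h0 h1)
    · rcases HyperTri.eq_pathPoint_or_lt (.refl _) (b := a)
        ((List.pairwise_lt_finRange n).imp fun h => ha h) hx with h | h
      · rw [← h]
      · exact h.le
    · rcases HyperTri.eq_pathPoint_or_lt hperm (b := fun i => - a i)
        (List.pairwise_reverse.2 ((List.pairwise_lt_finRange n).imp fun h => neg_lt_neg (ha h))) hx
        with h | h
      · rw [← h]
      · simp only [mul_neg, Finset.sum_neg_distrib] at h
        exact (neg_lt_neg_iff.1 h).le
  have h0 := height_nonneg hx
  have h1 := height_le hx
  have hcard : ∀ {A : Finset (Fin n)} {i j : Fin n}, (A, i, j) ∈ ts → A.card + 2 ≤ n ∧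
      (∀ x ∈ cubeFace A {i, j}, ∑ w, x w = A.card + x i + x j) ∧ i ∉ A ∧ j ∉ A ∧ i ≠ j := by
    intro A i j ht
    obtain ⟨hij, hi, hj, hc, -⟩ := h.mem_tile (List.nodup_finRange n) ht
    rw [List.length_finRange] at hc
    exact ⟨hc, fun x hx => sum_of_mem_cubeFace hij.ne hi hj hx, hi, hj, hij.ne⟩
  -- The lowest and the highest point are vertices of any tile that meets the height `1 / 2`,
  -- respectively `n - 1 / 2`.
  have hconst : ∀ c : ℝ, 0 ≤ c → c ≤ 1 → (fun _ => c : Fin n → ℝ) ∈ cube n :=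
    fun c h0 h1 => ⟨fun _ => h0, fun _ => h1⟩
  have hn0 : (n : ℝ) ≠ 0 := by linarith
  rcases h0.eq_or_lt with h0 | h0
  · have hx0 : x = fun _ => 0 := by
      ext i
      exact (Finset.sum_eq_zero_iff_of_nonneg fun i _ => hx.1 i).1 h0.symm i (Finset.mem_univ i)
    obtain ⟨A, i, j, ht, x', hx', he⟩ := key (hconst (1 / (2 * n)) (by positivity)
      (by rw [div_le_one] <;> linarith)) (by simp; positivity) (by simp; field_simp; linarith)
    obtain ⟨hc, hs, -⟩ := hcard ht
    have hs := hs x' hx'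
    rw [proj_lift, proj_lift, Prod.mk_inj] at he
    rw [he.2] at hs
    have hA : A = ∅ := by
      rw [← Finset.card_eq_zero]
      by_contra hA
      have h2 : (1 : ℝ) ≤ A.card := by exact_mod_cast Nat.one_le_iff_ne_zero.2 hA
      have h3 : 0 ≤ x' i := hx'.1.1 i
      have h4 : 0 ≤ x' j := hx'.1.1 j
      simp at hs
      field_simp at hs
      linarith
    refine ⟨A, i, j, ht, x, ⟨hx, by simp [hA], by simp [hx0]⟩, rfl⟩
  rcases h1.eq_or_lt with h1 | h1
  · have hx1 : x = fun _ => 1 := by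
      have h2 : ∑ i, (1 - x i) = 0 := by simp [h1]
      ext i
      have := (Finset.sum_eq_zero_iff_of_nonneg fun i _ => sub_nonneg.2 (hx.2 i)).1 h2 i
        (Finset.mem_univ i)
      have h3 : 1 - x i = 0 := this
      linarith
    obtain ⟨A, i, j, ht, x', hx', he⟩ := key (hconst (1 - 1 / (2 * n))
      (by rw [sub_nonneg, div_le_one] <;> linarith) (by
        have : 0 < 1 / (2 * (n : ℝ)) := by positivity
        linarith)) (by simp; field_simp; linarith) (by simp; field_simp; linarith)
    obtain ⟨hc, hs, hi, hj, hij⟩ := hcard ht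
    have hs := hs x' hx'
    rw [proj_lift, proj_lift, Prod.mk_inj] at he
    rw [he.2] at hs
    have hA : A ∪ {i, j} = Finset.univ := by
      rw [← Finset.card_eq_iff_eq_univ, Fintype.card_fin, Finset.card_union_of_disjoint
        (by simp [hi, hj]), Finset.card_pair hij]
      by_contra hA
      have h2 : ((A.card + 3 : ℕ) : ℝ) ≤ n := Nat.cast_le.2 (by omega)
      have h3 : x' i ≤ 1 := hx'.1.2 i
      have h4 : x' j ≤ 1 := hx'.1.2 j
      simp at hs h2
      have h5 : (n : ℝ) * (1 - (n : ℝ)⁻¹ * 2⁻¹) = n - 1 / 2 := by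
        field_simp
      linarith
    refine ⟨A, i, j, ht, x, ⟨hx, by simp [hx1], fun w hw => ?_⟩, rfl⟩
    rw [hA] at hw
    exact absurd (Finset.mem_univ w) hw
  exact key hx h0 h1

theorem tile_subset_zonotope {E : Type*} [AddCommGroup E] [Module ℝ E] (v : Fin n → E)
    (A B : Finset (Fin n)) : tile v A B ⊆ zonotope v :=
  Set.image_mono fun _ hx => hx.1

/-- The tiles of a full walk form a fine zonotopal tiling. -/
theorem FullWalk.isFineTiling {a : Fin n → ℝ} (ha : StrictMono a) (hn : 2 ≤ n)
    {ts : List (Tile n)} (h : FullWalk ts) : IsFineTiling (lift a) (tilesOf ts) := by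
  have hnd := List.nodup_finRange n
  refine ⟨?_, ?_, ?_, ?_, ?_⟩
  · rintro _ ⟨⟨A, i, j⟩, ht, rfl⟩
    obtain ⟨-, hi, hj, -⟩ := h.mem_tile hnd ht
    simp [hi, hj]
  · rintro _ ⟨⟨A, i, j⟩, ht, rfl⟩
    simp [Finset.card_pair (h.mem_tile hnd ht).1.ne]
  · rintro _ ⟨⟨A, i, j⟩, ht, rfl⟩
    simpa using linearIndepOn_lift_pair ha (h.mem_tile hnd ht).1.ne
  · refine subset_antisymm (Set.iUnion₂_subset fun p _ => tile_subset_zonotope _ _ _) ?_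
    rintro _ ⟨x, hx, rfl⟩
    obtain ⟨A, i, j, ht, x', hx', he⟩ := h.exists_mem_tile ha hn hx
    exact Set.mem_iUnion₂.2 ⟨(A, {i, j}), ⟨_, ht, rfl⟩, x', hx', he⟩
  · rintro _ ⟨⟨A, i, j⟩, ht, rfl⟩ _ ⟨⟨B, i', j'⟩, ht', rfl⟩
    refine subset_antisymm (Set.image_inter_subset _ _ _) ?_
    rintro z ⟨⟨x, hx, rfl⟩, x', hx', he⟩
    obtain rfl := h.eq_of_proj_eq ha hnd ht ht' hx hx' he.symm
    exact ⟨x, ⟨hx, hx'⟩, rfl⟩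

/-! ### The full walk of a tiling -/

theorem continuous_proj_lift (a : Fin n → ℝ) : Continuous (proj (lift a)) := by
  unfold proj
  fun_prop

theorem isCompact_cubeFace (A B : Finset (Fin n)) : IsCompact (cubeFace A B) := by
  have h : cubeFace A B = Set.Icc 0 1 ∩
      ((⋂ i ∈ A, {x | x i = 1}) ∩ ⋂ i ∈ {i | i ∉ A ∪ B}, {x : Fin n → ℝ | x i = 0}) := by
    ext x
    simp [cubeFace, cube]
  rw [h]
  refine isCompact_Icc.inter_right (IsClosed.inter ?_ ?_)
  · exact isClosed_biInter fun i _ => isClosed_eq (continuous_apply i) continuous_const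
  · exact isClosed_biInter fun i _ => isClosed_eq (continuous_apply i) continuous_const

theorem isClosed_tile (a : Fin n → ℝ) (A B : Finset (Fin n)) : IsClosed (tile (lift a) A B) :=
  ((isCompact_cubeFace A B).image (continuous_proj_lift a)).isClosed

theorem IsFineTiling.exists_pair {a : Fin n → ℝ} {T : Set (Finset (Fin n) × Finset (Fin n))}
    (hT : IsFineTiling (lift a) T) {Q : Finset (Fin n) × Finset (Fin n)} (hQ : Q ∈ T) :
    ∃ A i j, i < j ∧ i ∉ A ∧ j ∉ A ∧ Q = (A, {i, j}) := by
  obtain ⟨A, B⟩ := Q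
  have h1 := hT.card_eq _ hQ
  have h2 := hT.disjoint _ hQ
  simp only [Module.finrank_prod, Module.finrank_self] at h1 h2
  obtain ⟨i, j, hij, rfl⟩ := Finset.card_eq_two.1 h1
  simp only [Finset.disjoint_insert_right, Finset.disjoint_singleton_right] at h2
  rcases lt_or_gt_of_ne hij with h | h
  · exact ⟨A, i, j, h, h2.1, h2.2, rfl⟩
  · exact ⟨A, j, i, h, h2.2, h2.1, by rw [Finset.pair_comm]⟩

/-- A point of the zonotope has at most one preimage in the faces of a tiling. -/
theorem IsFineTiling.eq_of_proj_eq {a : Fin n → ℝ} (ha : StrictMono a)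
    {T : Set (Finset (Fin n) × Finset (Fin n))} (hT : IsFineTiling (lift a) T)
    {P Q : Finset (Fin n) × Finset (Fin n)} (hP : P ∈ T) (hQ : Q ∈ T) {x x' : Fin n → ℝ}
    (hx : x ∈ cubeFace P.1 P.2) (hx' : x' ∈ cubeFace Q.1 Q.2)
    (he : proj (lift a) x = proj (lift a) x') : x = x' := by
  have h1 : proj (lift a) x ∈ tile (lift a) P.1 P.2 ∩ tile (lift a) Q.1 Q.2 :=
    ⟨⟨x, hx, rfl⟩, x', hx', he.symm⟩
  rw [← hT.inter P hP Q hQ] at h1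
  obtain ⟨w, ⟨hw, hw'⟩, hwe⟩ := h1
  obtain ⟨A, i, j, hij, -, -, rfl⟩ := hT.exists_pair hP
  obtain ⟨A', i', j', hij', -, -, rfl⟩ := hT.exists_pair hQ
  rw [← HyperTri.eq_of_proj_eq ha hij.ne hw hx hwe,
    HyperTri.eq_of_proj_eq ha hij'.ne hw' hx' (hwe.trans he)]

/-- The point `x` of the cube is the only candidate for a preimage of its image under the projection
in the faces of the collection `T`. -/
def IsRigid (a : Fin n → ℝ) (T : Set (Finset (Fin n) × Finset (Fin n))) (x : Fin n → ℝ) : Prop :=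
  ∀ Q ∈ T, ∀ x' ∈ cubeFace Q.1 Q.2, proj (lift a) x' = proj (lift a) x → x' = x

theorem isRigid_pathPoint_finRange {a : Fin n → ℝ} (ha : StrictMono a)
    (T : Set (Finset (Fin n) × Finset (Fin n))) {y : ℝ} (h0 : 0 ≤ y) (hn : y ≤ n) :
    IsRigid a T (pathPoint (List.finRange n) y) := by
  intro Q _ x hx he
  rw [proj_lift, proj_lift, Prod.mk_inj, sum_pathPoint (.refl _) h0 hn] at he
  have h := HyperTri.eq_pathPoint_or_lt (.refl _) (b := a)
    ((List.pairwise_lt_finRange n).imp fun h => ha h) hx.1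
  rw [he.1, he.2] at h
  exact h.resolve_right (lt_irrefl _)

/-- The points on the last path of a walk through tiles of a tiling are rigid. -/
theorem IsFineTiling.isRigid_pathPoint {a : Fin n → ℝ} (ha : StrictMono a)
    {T : Set (Finset (Fin n) × Finset (Fin n))} (hT : IsFineTiling (lift a) T) {p q : List (Fin n)}
    {ts : List (Tile n)} (h : Walk p ts q) (hp : p.Nodup) (hts : tilesOf ts ⊆ T) {y : ℝ}
    (hy : IsRigid a T (pathPoint p y)) : IsRigid a T (pathPoint q y) := by
  induction h with
  | nil p => exact hy
  | @cons α β i j ts q hij h ih =>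
    have hp' := ((List.Perm.swap j i β).append_left α).nodup_iff.1 hp
    refine ih hp' (fun Q hQ => ?_) ?_
    · obtain ⟨t, ht, rfl⟩ := hQ
      exact hts ⟨t, List.mem_cons_of_mem _ ht, rfl⟩
    · rcases pathPoint_swap ha hij hp y with h1 | ⟨-, h1, h2⟩
      · rwa [← h1]
      · intro Q hQ x hx he
        have h3 := pathPoint_mem_cubeFace hp' h1 h2
        rw [Finset.pair_comm] at h3
        exact hT.eq_of_proj_eq ha hQ (hts ⟨_, List.mem_cons_self, rfl⟩) hx h3 he

/-- The midpoint of an edge of a path. -/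
theorem pathPoint_midpoint {α β : List (Fin n)} {i : Fin n} (hp : (α ++ i :: β).Nodup) :
    (∀ w ∈ α, pathPoint (α ++ i :: β) (α.length + 1 / 2) w = 1) ∧
      pathPoint (α ++ i :: β) (α.length + 1 / 2) i = 1 / 2 ∧
      ∀ w, w ∉ α → w ≠ i → pathPoint (α ++ i :: β) (α.length + 1 / 2) w = 0 := by
  have hi : i ∉ α := fun h => (List.nodup_append.1 hp).2.2 i h i (by simp) rfl
  refine ⟨fun w hw => ?_, ?_, fun w hw hwi => ?_⟩
  · have h1 : ((α.idxOf w + 1 : ℕ) : ℝ) ≤ α.length :=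
      Nat.cast_le.2 (List.idxOf_lt_length_iff.2 hw)
    push_cast at h1
    rw [pathPoint, List.idxOf_append_of_mem hw, min_eq_left (by linarith),
      max_eq_right zero_le_one]
  · rw [pathPoint, List.idxOf_append_of_notMem hi]
    norm_num
  · rw [pathPoint, List.idxOf_append_of_notMem hw, List.idxOf_cons_ne _ hwi.symm]
    push_cast
    refine max_eq_left (min_le_of_right_le ?_)
    have : (0 : ℝ) ≤ β.idxOf w := Nat.cast_nonneg _
    linarith

/-- Near a rigid point `x` of the cube from which one can move to the right, by lowering `x u` and
raising `x v`, there is a tile that contains `x` and points to the right of `x`. -/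
theorem IsFineTiling.exists_tile_right {a : Fin n → ℝ} (ha : StrictMono a)
    {T : Set (Finset (Fin n) × Finset (Fin n))} (hT : IsFineTiling (lift a) T) {x : Fin n → ℝ}
    (hx : x ∈ cube n) (hr : IsRigid a T x) {u v : Fin n} (huv : u < v) (hu : 0 < x u)
    (hv : x v < 1) : ∃ A i j, i < j ∧ i ∉ A ∧ j ∉ A ∧ (A, {i, j}) ∈ T ∧ x ∈ cubeFace A {i, j} ∧
      0 < x i ∧ x j < 1 := by
  have hauv := sub_pos.2 (ha huv)
  set y : ℝ → Fin n → ℝ := fun ε w => x w + ε * ((if w = v then 1 else 0) - if w = u then 1 else 0)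
    with hydef
  have hy0 : y 0 = x := by
    ext w
    simp [hydef]
  have hycont : Continuous y := by
    rw [hydef]
    fun_prop
  -- Being closed, a tile that contains points arbitrarily close to the image of `x` contains it.
  have hev : ∀ᶠ ε in nhdsWithin (0 : ℝ) (Set.Ioi 0), ∀ Q ∈ T,
      proj (lift a) (y ε) ∈ tile (lift a) Q.1 Q.2 → proj (lift a) x ∈ tile (lift a) Q.1 Q.2 := by
    rw [Filter.eventually_all_finite T.toFinite]
    intro Q _
    by_cases hQ : proj (lift a) x ∈ tile (lift a) Q.1 Q.2
    · exact Filter.Eventually.of_forall fun _ _ => hQ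
    · have h1 : ∀ᶠ ε in nhds (0 : ℝ), proj (lift a) (y ε) ∈ (tile (lift a) Q.1 Q.2)ᶜ := by
        refine ((continuous_proj_lift a).comp hycont).continuousAt.eventually_mem
          ((isClosed_tile a _ _).isOpen_compl.mem_nhds ?_)
        simpa [hy0] using hQ
      exact (h1.filter_mono nhdsWithin_le_nhds).mono fun ε h2 h3 => absurd h3 h2
  have hev2 : ∀ᶠ ε in nhdsWithin (0 : ℝ) (Set.Ioi 0), ε < min (x u) (1 - x v) :=
    (eventually_lt_nhds (lt_min hu (sub_pos.2 hv))).filter_mono nhdsWithin_le_nhds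
  obtain ⟨ε, ⟨h1, h2⟩, hε⟩ := ((hev.and hev2).and self_mem_nhdsWithin).exists
  replace hε : 0 < ε := hε
  rw [lt_min_iff] at h2
  have hyc : y ε ∈ cube n := by
    have key : ∀ w, 0 ≤ y ε w ∧ y ε w ≤ 1 := by
      intro w
      have l1 : 0 ≤ x w := hx.1 w
      have l2 : x w ≤ 1 := hx.2 w
      simp only [hydef]
      by_cases hwv : w = v
      · subst hwv
        rw [if_pos rfl, if_neg huv.ne']
        constructor <;> linarith
      · by_cases hwu : w = u
        · subst hwu
          rw [if_pos rfl, if_neg huv.ne]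
          constructor <;> linarith
        · rw [if_neg hwv, if_neg hwu]
          constructor <;> linarith
    exact ⟨fun w => (key w).1, fun w => (key w).2⟩
  have hcov : proj (lift a) (y ε) ∈ ⋃ p ∈ T, tile (lift a) p.1 p.2 := by
    rw [hT.cover]
    exact ⟨_, hyc, rfl⟩
  obtain ⟨Q, hQ, hyQ⟩ := Set.mem_iUnion₂.1 hcov
  obtain ⟨x', hx', he⟩ := h1 Q hQ hyQ
  obtain rfl := hr Q hQ x' hx' he
  obtain ⟨w, hw, hwe⟩ := hyQ
  obtain ⟨A, i, j, hij, hi, hj, rfl⟩ := hT.exists_pair hQ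
  refine ⟨A, i, j, hij, hi, hj, hQ, hx', ?_⟩
  have hag : ∀ z, z ≠ u → z ≠ v → y ε z = x' z := fun z hzu hzv => by simp [hydef, hzu, hzv]
  have hyu : y ε u = x' u - ε := by simp [hydef, huv.ne]; ring
  have hyv : y ε v = x' v + ε := by simp [hydef, huv.ne']
  rw [proj_lift, proj_lift, Prod.mk_inj, sum_mul_eq_of_agree a huv.ne hag,
    sum_eq_of_agree huv.ne hag, hyu, hyv] at hwe
  have hag' := fun z (hzi : z ≠ i) (hzj : z ≠ j) => eq_of_mem_cubeFace_pair hw hx' hzi hzj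
  rw [sum_mul_eq_of_agree a hij.ne hag', sum_eq_of_agree hij.ne hag'] at hwe
  have h3 : (w j - x' j) * (a j - a i) = ε * (a v - a u) := by
    linear_combination hwe.1 - a i * hwe.2
  have h4 : 0 < w j - x' j :=
    pos_of_mul_pos_left (h3 ▸ mul_pos hε hauv) (sub_pos.2 (ha hij)).le
  have h5 : 0 ≤ w i := hw.1.1 i
  have h6 : w j ≤ 1 := hw.1.2 j
  constructor <;> linarith [hwe.2]

/-- To the right of an edge `(A, i)` of a path of a tiling, there is a tile having this edge as its
lower left edge, or a tile having it as its upper left edge, provided that the edge does not lie on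
the right boundary of the zonotope. -/
theorem IsFineTiling.exists_tile_of_edge {a : Fin n → ℝ} (ha : StrictMono a)
    {T : Set (Finset (Fin n) × Finset (Fin n))} (hT : IsFineTiling (lift a) T)
    {α β : List (Fin n)} {i : Fin n} (hp : (α ++ i :: β).Perm (List.finRange n))
    (hr : IsRigid a T (pathPoint (α ++ i :: β) (α.length + 1 / 2))) {u v : Fin n} (huv : u < v)
    (hu : u ∈ α ∨ u = i) (hv : v ∈ β ∨ v = i) :
    (∃ x ∈ β, i < x ∧ (α.toFinset, {i, x}) ∈ T) ∨
      ∃ x ∈ α, x < i ∧ (α.toFinset.erase x, {x, i}) ∈ T := by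
  have hnd := hp.nodup_iff.2 (List.nodup_finRange n)
  obtain ⟨m1, m2, m3⟩ := pathPoint_midpoint hnd
  have hxc := pathPoint_mem_cube (α ++ i :: β) (α.length + 1 / 2)
  generalize pathPoint (α ++ i :: β) (α.length + 1 / 2) = x at hr m1 m2 m3 hxc
  have hiα : i ∉ α := fun h => (List.nodup_append.1 hnd).2.2 i h i (by simp) rfl
  have hu' : 0 < x u := by
    rcases hu with hu | rfl
    · rw [m1 u hu]; norm_num
    · rw [m2]; norm_num
  have hv' : x v < 1 := by
    rcases hv with hv | rfl
    · have h1 : v ∉ α := fun h => (List.nodup_append.1 hnd).2.2 v h v (by simp [hv]) rfl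
      by_cases h2 : v = i
      · rw [h2, m2]; norm_num
      · rw [m3 v h1 h2]; norm_num
    · rw [m2]; norm_num
  obtain ⟨A, s, t, hst, hs, ht, hQ, hxQ, hxs, hxt⟩ :=
    hT.exists_tile_right ha hxc hr huv hu' hv'
  have hA : ∀ w ∈ A, w ∈ α ∧ w ≠ i := fun w hw => by
    have h1 := hxQ.2.1 w hw
    have h2 : w ≠ i := fun h => by
      rw [h, m2] at h1
      norm_num at h1
    exact ⟨by_contra fun h3 => by rw [m3 w h3 h2] at h1; norm_num at h1, h2⟩
  have hout : ∀ w, w ∉ A → w ≠ s → w ≠ t → x w = 0 := fun w h1 h2 h3 =>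
    hxQ.2.2 w (by simp [h1, h2, h3])
  have hA' : ∀ w ∈ α, w ≠ s → w ≠ t → w ∈ A := fun w hw h1 h2 => by
    by_contra h3
    have h4 := hout w h3 h1 h2
    rw [m1 w hw] at h4
    norm_num at h4
  by_cases his : i = s
  · subst his
    have htα : t ∉ α := fun h => by
      rw [m1 t h] at hxt
      exact lt_irrefl _ hxt
    refine .inl ⟨t, ?_, hst, ?_⟩
    · have := hp.mem_iff.2 (List.mem_finRange t)
      simpa [htα, hst.ne'] using this
    · convert hQ
      ext w
      rw [List.mem_toFinset]
      exact ⟨fun h => hA' w h (fun h' => hiα (h' ▸ h)) (fun h' => htα (h' ▸ h)),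
        fun h => (hA w h).1⟩
  · have hit : i = t := by
      by_contra hit
      have h1 := hout i (fun h => (hA i h).2 rfl) his hit
      rw [m2] at h1
      norm_num at h1
    subst hit
    have hsα : s ∈ α := by
      by_contra h
      rw [m3 s h (Ne.symm his)] at hxs
      exact lt_irrefl _ hxs
    refine .inr ⟨s, hsα, hst, ?_⟩
    convert hQ
    ext w
    rw [Finset.mem_erase, List.mem_toFinset]
    exact ⟨fun h => hA' w h.2 h.1 (fun h' => hiα (h' ▸ h.2)),
      fun h => ⟨fun h' => hs (h' ▸ h), (hA w h).1⟩⟩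

/-- Two tiles with the same left vertex `S` are equal. -/
theorem IsFineTiling.eq_of_left_vertex {a : Fin n → ℝ} (ha : StrictMono a)
    {T : Set (Finset (Fin n) × Finset (Fin n))} (hT : IsFineTiling (lift a) T)
    {S : Finset (Fin n)} {i x i' x' : Fin n} (hi : i ∈ S) (hx : x ∉ S) (hi' : i' ∈ S) (hx' : x' ∉ S)
    (hix : i < x) (hix' : i' < x') (h : (S.erase i, {i, x}) ∈ T)
    (h' : (S.erase i', {i', x'}) ∈ T) : i = i' ∧ x = x' := by
  have mem : ∀ {i x : Fin n} {d : ℝ}, i ∈ S → x ∉ S → i < x → 0 ≤ d → d ≤ 1 →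
      (fun w => (if w ∈ S then (1 : ℝ) else 0) +
        d * ((if w = x then 1 else 0) - if w = i then 1 else 0)) ∈ cubeFace (S.erase i) {i, x} := by
    intro i x d hi hx hix h0 h1
    have hne : i ≠ x := hix.ne
    refine ⟨⟨fun w => ?_, fun w => ?_⟩, fun w hw => ?_, fun w hw => ?_⟩
    · simp only [Pi.zero_apply]
      split_ifs <;> simp_all
    · simp only [Pi.one_apply]
      split_ifs <;> simp_all
    · rw [Finset.mem_erase] at hw
      have : w ≠ x := fun h => hx (h ▸ hw.2)
      simp [hw.1, hw.2, this]
    · simp only [Finset.mem_union, Finset.mem_erase, Finset.mem_insert, Finset.mem_singleton,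
        not_or] at hw
      have : w ∉ S := fun h => hw.1 ⟨hw.2.1, h⟩
      simp [this, hw.2.1, hw.2.2]
  have hproj : ∀ (i x : Fin n) (d : ℝ), proj (lift a) (fun w => (if w ∈ S then (1 : ℝ) else 0) +
        d * ((if w = x then 1 else 0) - if w = i then 1 else 0)) =
      (∑ w ∈ S, a w + d * (a x - a i), (S.card : ℝ)) := by
    intro i x d
    rw [proj_lift, Prod.mk_inj]
    constructor
    · simp [add_mul, mul_assoc, sub_mul, Finset.sum_add_distrib, ← Finset.mul_sum]
    · simp [Finset.sum_add_distrib, ← Finset.mul_sum]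
  have c0 := sub_pos.2 (ha hix)
  have c0' := sub_pos.2 (ha hix')
  set c := a x - a i with hc
  set c' := a x' - a i' with hc'
  have hcc : 0 < c + c' := by linarith
  have d0 : 0 < c' / (c + c') := div_pos c0' hcc
  have d1 : c' / (c + c') ≤ 1 := (div_le_one hcc).2 (by linarith)
  have d0' : 0 < c / (c + c') := div_pos c0 hcc
  have d1' : c / (c + c') ≤ 1 := (div_le_one hcc).2 (by linarith)
  have he := hT.eq_of_proj_eq ha h h' (mem hi hx hix d0.le d1) (mem hi' hx' hix' d0'.le d1') (by
    rw [hproj, hproj, ← hc, ← hc']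
    congr 2
    ring)
  constructor
  · by_contra hne
    have h1 := congrFun he i
    have h2 : i ≠ x := hix.ne
    have h3 : i ≠ x' := fun h => hx' (h ▸ hi)
    simp [hi, hne, h2, h3] at h1
    rcases h1 with h1 | h1 <;> linarith
  · by_contra hne
    have h1 := congrFun he x
    have h2 : x ≠ i := hix.ne'
    have h3 : x ≠ i' := fun h => hx (h ▸ hi')
    simp [hx, hne, h2, h3] at h1
    rcases h1 with h1 | h1 <;> linarith

/-- If an edge of a path is the lower left edge of a tile, then this edge or a later one and its
successor are the two left edges of a tile: the last of the consecutive lower left edges is followed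
by an upper left edge, since the next edge cannot lie on the right boundary. -/
theorem IsFineTiling.exists_swap_of_lower {a : Fin n → ℝ} (ha : StrictMono a)
    {T : Set (Finset (Fin n) × Finset (Fin n))} (hT : IsFineTiling (lift a) T) {p : List (Fin n)}
    (hp : p.Perm (List.finRange n)) (hr : ∀ y : ℝ, 0 ≤ y → y ≤ n → IsRigid a T (pathPoint p y))
    {α β : List (Fin n)} {i : Fin n} (he : p = α ++ i :: β)
    (h : ∃ x ∈ β, i < x ∧ (α.toFinset, {i, x}) ∈ T) :
    ∃ α i j β, p = α ++ i :: j :: β ∧ i < j ∧ (α.toFinset, {i, j}) ∈ T := by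
  induction β generalizing α i with
  | nil => simp at h
  | cons j β ih =>
    obtain ⟨x, hx, hix, hxT⟩ := h
    have hnd : (α ++ i :: j :: β).Nodup := he ▸ hp.nodup_iff.2 (List.nodup_finRange n)
    have hlen : α.length + 2 ≤ n := by
      have := hp.length_eq
      simp [he] at this
      omega
    have he' : p = (α ++ [i]) ++ j :: β := by simp [he]
    have hlen' : ((α.length + 2 : ℕ) : ℝ) ≤ n := Nat.cast_le.2 hlen
    push_cast at hlen'
    have h1 := hT.exists_tile_of_edge ha (he' ▸ hp) (he' ▸ hr _ (by positivity)
      (by simp; linarith)) hix (u := i) (v := x) (by simp)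
      (by simpa [or_comm] using hx)
    rcases h1 with h1 | ⟨x', hx', hxj, hxT'⟩
    · exact ih he' h1
    · -- The two tiles have the same left vertex `α ∪ {i}`.
      have hi : i ∉ α := fun h => (List.nodup_append.1 hnd).2.2 i h i (by simp) rfl
      have hsub : ∀ z ∈ j :: β, z ∉ α.toFinset ∪ {i} := by
        intro z hz h
        rw [← List.append_cons] at he'
        simp only [List.nodup_append, List.nodup_cons] at hnd
        simp only [Finset.mem_union, List.mem_toFinset, Finset.mem_singleton] at h
        rcases h with h | rfl
        · exact hnd.2.2 z h z (by simp [List.mem_cons.1 hz]) rfl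
        · exact hnd.2.1.1 hz
      have e1 : (α.toFinset ∪ {i}).erase i = α.toFinset := by
        ext w
        simp
        grind
      rw [List.toFinset_append, List.toFinset_cons, List.toFinset_nil, insert_empty_eq] at hxT'
      obtain ⟨rfl, rfl⟩ := hT.eq_of_left_vertex ha (S := α.toFinset ∪ {i}) (by simp) (hsub x hx)
        (by simpa [or_comm] using hx') (hsub j (by simp)) hix hxj (by rwa [e1]) hxT'
      exact ⟨α, i, x, β, he, hix, hxT⟩

/-- If an edge of a path is the upper left edge of a tile, then there are two consecutive edges of
the path that are the left edges of a tile. -/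
theorem IsFineTiling.exists_swap_of_upper {a : Fin n → ℝ} (ha : StrictMono a)
    {T : Set (Finset (Fin n) × Finset (Fin n))} (hT : IsFineTiling (lift a) T) {p : List (Fin n)}
    (hp : p.Perm (List.finRange n)) (hr : ∀ y : ℝ, 0 ≤ y → y ≤ n → IsRigid a T (pathPoint p y))
    {α β : List (Fin n)} {i : Fin n} (he : p = α ++ i :: β)
    (h : ∃ x ∈ α, x < i ∧ (α.toFinset.erase x, {x, i}) ∈ T) :
    ∃ α i j β, p = α ++ i :: j :: β ∧ i < j ∧ (α.toFinset, {i, j}) ∈ T := by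
  induction α using List.reverseRecOn generalizing i β with
  | nil => simp at h
  | append_singleton α j ih =>
    obtain ⟨x, hx, hxi, -⟩ := h
    have he' : p = α ++ j :: i :: β := by simp [he]
    have hlen : α.length + 2 ≤ n := by
      have := hp.length_eq
      simp [he'] at this
      omega
    have hlen' : ((α.length + 2 : ℕ) : ℝ) ≤ n := Nat.cast_le.2 hlen
    push_cast at hlen'
    have h1 := hT.exists_tile_of_edge ha (he' ▸ hp) (he' ▸ hr _ (by positivity)
      (by linarith)) hxi (u := x) (v := i) (by simpa using hx) (by simp)
    rcases h1 with h1 | h1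
    · exact hT.exists_swap_of_lower ha hp hr he' h1
    · exact ih he' h1

/-- A path of a tiling that is not the right boundary of the zonotope passes along the left side of
a tile. -/
theorem IsFineTiling.exists_swap {a : Fin n → ℝ} (ha : StrictMono a)
    {T : Set (Finset (Fin n) × Finset (Fin n))} (hT : IsFineTiling (lift a) T) {p : List (Fin n)}
    (hp : p.Perm (List.finRange n)) (hr : ∀ y : ℝ, 0 ≤ y → y ≤ n → IsRigid a T (pathPoint p y))
    (hne : p ≠ (List.finRange n).reverse) :
    ∃ α i j β, p = α ++ i :: j :: β ∧ i < j ∧ (α.toFinset, {i, j}) ∈ T := by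
  have hnd := hp.nodup_iff.2 (List.nodup_finRange n)
  have hnp : ¬ p.Pairwise (· > ·) := fun h => hne <|
    (hp.trans (List.reverse_perm _).symm).eq_of_pairwise
      (fun _ _ _ _ h h' => absurd h (lt_asymm h')) h
      (List.pairwise_reverse.2 (List.pairwise_lt_finRange n))
  rw [List.pairwise_iff_getElem] at hnp
  push Not at hnp
  obtain ⟨s, t, hs, ht, hst, hle⟩ := hnp
  have hlt : p[s] < p[t] := lt_of_le_of_ne hle fun h => hst.ne ((hnd.getElem_inj_iff).1 h)
  have he : p = p.take s ++ p[s] :: p.drop (s + 1) := by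
    rw [List.getElem_cons_drop, List.take_append_drop]
  have hmem : p[t] ∈ p.drop (s + 1) := by
    rw [List.mem_drop_iff_getElem]
    exact ⟨t - (s + 1), by omega, by congr 1; omega⟩
  have hlen : s + 1 ≤ n := by
    have := hp.length_eq
    simp at this
    omega
  have hlen' : ((s + 1 : ℕ) : ℝ) ≤ n := Nat.cast_le.2 hlen
  push_cast at hlen'
  have hmin : (p.take s).length = s := by
    rw [List.length_take]
    omega
  rcases hT.exists_tile_of_edge ha (he ▸ hp) (he ▸ hr _ (by positivity)
      (by rw [hmin]; linarith)) hlt (.inr rfl) (.inl hmem) with h | h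
  · exact hT.exists_swap_of_lower ha hp hr he h
  · exact hT.exists_swap_of_upper ha hp hr he h

/-- Every walk through tiles of a tiling extends to a full walk through tiles of the tiling. -/
theorem IsFineTiling.exists_fullWalk_subset {a : Fin n → ℝ} (ha : StrictMono a)
    {T : Set (Finset (Fin n) × Finset (Fin n))} (hT : IsFineTiling (lift a) T)
    {p : List (Fin n)} {us : List (Tile n)} (h : Walk (List.finRange n) us p)
    (hus : tilesOf us ⊆ T) : ∃ ts, FullWalk ts ∧ tilesOf ts ⊆ T := by
  induction hN : n * n - us.length using Nat.strong_induction_on generalizing us p with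
  | _ N ih =>
    have hnd := List.nodup_finRange n
    by_cases hpr : p = (List.finRange n).reverse
    · subst hpr
      exact ⟨us, h, hus⟩
    · obtain ⟨α, i, j, β, rfl, hij, hA⟩ := hT.exists_swap ha h.perm.symm (fun y h0 h1 =>
        hT.isRigid_pathPoint ha h hnd hus (isRigid_pathPoint_finRange ha T h0 h1)) hpr
      have h' := h.append (.single α β hij)
      refine ih _ ?_ h' ?_ rfl
      · have h1 := (h'.nodup_pairs hnd).1.length_le_card
        simp at h1 ⊢
        omega
      · rintro _ ⟨t, ht, rfl⟩
        rcases List.mem_append.1 ht with ht | ht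
        · exact hus ⟨t, ht, rfl⟩
        · rw [List.mem_singleton.1 ht]
          exact hA

/-- Every fine zonotopal tiling consists of the tiles of a full walk. -/
theorem IsFineTiling.exists_fullWalk {a : Fin n → ℝ} (ha : StrictMono a) (hn : 2 ≤ n)
    {T : Set (Finset (Fin n) × Finset (Fin n))} (hT : IsFineTiling (lift a) T) :
    ∃ ts, FullWalk ts ∧ T = tilesOf ts := by
  obtain ⟨ts, h, hts⟩ := hT.exists_fullWalk_subset ha (.nil _) (us := []) (by simp [tilesOf])
  refine ⟨ts, h, subset_antisymm (fun Q hQ => ?_) hts⟩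
  obtain ⟨A, i, j, hij, hi, hj, rfl⟩ := hT.exists_pair hQ
  -- The centre of a tile of `T` lies in a tile of the walk, and in the interior of only one tile.
  set x : Fin n → ℝ := fun w => if w ∈ A then 1 else if w = i ∨ w = j then 1 / 2 else 0 with hxdef
  have hx : x ∈ cubeFace A {i, j} := by
    refine ⟨⟨fun w => ?_, fun w => ?_⟩, fun w hw => if_pos hw, fun w hw => ?_⟩
    · simp only [hxdef, Pi.zero_apply]
      split_ifs <;> norm_num
    · simp only [hxdef, Pi.one_apply]
      split_ifs <;> norm_num
    · simp only [Finset.mem_union, Finset.mem_insert, Finset.mem_singleton, not_or] at hw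
      simp [hxdef, hw.1, hw.2.1, hw.2.2]
  obtain ⟨B, i', j', ht, x', hx', he⟩ := h.exists_mem_tile ha hn hx.1
  have hmem : (B, {i', j'}) ∈ tilesOf ts := ⟨_, ht, rfl⟩
  obtain rfl := hT.eq_of_proj_eq ha (hts hmem) hQ hx' hx he
  have hij' := (h.mem_tile (List.nodup_finRange n) ht).1
  have hhalf : ∀ w, w ∉ A → (w = i ∨ w = j) → w = i' ∨ w = j' := by
    intro w hw hwij
    have hxw : x w = 1 / 2 := by simp only [hxdef, if_neg hw, if_pos hwij]
    by_contra hw'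
    rw [not_or] at hw'
    by_cases hwB : w ∈ B
    · rw [hx'.2.1 w hwB] at hxw
      norm_num at hxw
    · rw [hx'.2.2 w (by simp [hwB, hw'.1, hw'.2])] at hxw
      norm_num at hxw
  have e1 := hhalf i hi (.inl rfl)
  have e2 := hhalf j hj (.inr rfl)
  obtain ⟨rfl, rfl⟩ : i = i' ∧ j = j' := by
    rcases e1 with rfl | rfl <;> rcases e2 with rfl | rfl
    · exact absurd hij (lt_irrefl _)
    · exact ⟨rfl, rfl⟩
    · exact absurd hij hij'.asymm
    · exact absurd hij (lt_irrefl _)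
  obtain ⟨-, hi', hj', -⟩ := h.mem_tile (List.nodup_finRange n) ht
  suffices A = B by rwa [this]
  ext w
  constructor
  · intro hw
    by_contra hwB
    have h1 := hx.2.1 w hw
    rw [hx'.2.2 w (by
      have h2 : w ≠ i := fun h => hi (h ▸ hw)
      have h3 : w ≠ j := fun h => hj (h ▸ hw)
      simp [hwB, h2, h3])] at h1
    norm_num at h1
  · intro hw
    by_contra hwA
    have h1 := hx'.2.1 w hw
    rw [hx.2.2 w (by
      have h2 : w ≠ i := fun h => hi' (h ▸ hw)
      have h3 : w ≠ j := fun h => hj' (h ▸ hw)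
      simp [hwA, h2, h3])] at h1
    norm_num at h1

/-! ### The diameter of the flip graph -/

theorem FullWalk.reducesTo {a : Fin n → ℝ} (ha : StrictMono a) (hn : 2 ≤ n) {m : ℕ} (hm : m ≤ n)
    {ts : List (Tile n)} (h : FullWalk ts) :
    ReducesTo a m (levelPath m (List.finRange n) ts)
      (reduceList m (levelPath m (List.finRange n) ts)) := by
  obtain ⟨us, hus, hr, hred⟩ := h.exists_reduced hm
  rw [← (h.isPath hm).eq_reduceList hr hred]
  exact ⟨hr, ⟨_, hus.isFineTiling ha hn, hus.isCrossSection m⟩, hred⟩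

theorem IsReducedLifting.exists_fullWalk {a : Fin n → ℝ} (ha : StrictMono a) (hn : 2 ≤ n) {m : ℕ}
    {R : List (Finset (Fin n))} (hR : IsReducedLifting a m R) :
    ∃ ts, FullWalk ts ∧ reduceList m (levelPath m (List.finRange n) ts) = R := by
  obtain ⟨⟨T, hT, hTR⟩, hred⟩ := hR
  obtain ⟨ts, h, rfl⟩ := hT.exists_fullWalk ha hn
  obtain rfl := h.eq_levelPath hTR
  exact ⟨ts, h, reduceList_eq_self hred⟩

/-- The reduced lifting hypertriangulation of a full walk, as a vertex of the flip graph. -/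
noncomputable def FullWalk.vert {a : Fin n → ℝ} (ha : StrictMono a) (hn : 2 ≤ n) {m : ℕ}
    (hm : m ≤ n) {ts : List (Tile n)} (h : FullWalk ts) :
    {R : List (Finset (Fin n)) // IsReducedLifting a m R} :=
  ⟨reduceList m (levelPath m (List.finRange n) ts), (h.reducesTo ha hn hm).2⟩

/-- Every move lowers the weight at least by the distance of the two vertices. -/
theorem FullWalk.edist_add_weight_le {a : Fin n → ℝ} (ha : StrictMono a) (hn : 2 ≤ n) {k : ℕ}
    (hk : k + 1 ≤ n) {ts ts' : List (Tile n)} (h : FullWalk ts) (hM : Moves ts ts') :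
    ∃ h' : FullWalk ts', (reducedFlipGraph a (k + 1)).edist (h.vert ha hn hk) (h'.vert ha hn hk) +
      weight k ts' ≤ weight k ts := by
  induction hM with
  | refl => exact ⟨h, by simp⟩
  | @tail us vs _ hM ih =>
    obtain ⟨hus, hle⟩ := ih
    have hvs : FullWalk vs := Walk.move (List.nodup_finRange n) hus hM
    refine ⟨hvs, ?_⟩
    suffices hstep : (reducedFlipGraph a (k + 1)).edist (hus.vert ha hn hk) (hvs.vert ha hn hk) +
        weight k vs ≤ weight k us by
      calc (reducedFlipGraph a (k + 1)).edist (h.vert ha hn hk) (hvs.vert ha hn hk) + weight k vs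
          ≤ (reducedFlipGraph a (k + 1)).edist (h.vert ha hn hk) (hus.vert ha hn hk) +
            (reducedFlipGraph a (k + 1)).edist (hus.vert ha hn hk) (hvs.vert ha hn hk) +
              weight k vs := by
            gcongr
            exact SimpleGraph.edist_triangle
        _ ≤ (reducedFlipGraph a (k + 1)).edist (h.vert ha hn hk) (hus.vert ha hn hk) +
            weight k us := by
            rw [add_assoc]
            gcongr
        _ ≤ weight k ts := hle
    rcases hus.move ha hk hM with he | ⟨hne, hw, hflip⟩
    · have hv : hus.vert ha hn hk = hvs.vert ha hn hk := Subtype.ext he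
      rw [hv, SimpleGraph.edist_self, zero_add, hus.weight_eq_pathWeight_reduceList hk,
        hvs.weight_eq_pathWeight_reduceList hk, he]
    · have h1 : (reducedFlipGraph a (k + 1)).edist (hus.vert ha hn hk) (hvs.vert ha hn hk) ≤ 1 := by
        rw [SimpleGraph.edist_le_one_iff_adj_or_eq, or_iff_not_imp_right]
        exact fun hv => ⟨hv, _, _, ⟨hne, _, _, hus.isFineTiling ha hn, hvs.isFineTiling ha hn,
          hflip, hus.isCrossSection _, hvs.isCrossSection _⟩, hus.reducesTo ha hn hk,
          hvs.reducesTo ha hn hk⟩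
      rw [hw, Nat.cast_add, Nat.cast_one, add_comm (weight k vs : ℕ∞)]
      gcongr

theorem pathWeight_le_of_adj {a : Fin n → ℝ} (ha : StrictMono a) (hn : 2 ≤ n) {k : ℕ}
    (hk : k + 1 ≤ n) {R R' : {R : List (Finset (Fin n)) // IsReducedLifting a (k + 1) R}}
    (h : (reducedFlipGraph a (k + 1)).Adj R R') : pathWeight R.1 ≤ pathWeight R'.1 + 1 := by
  obtain ⟨-, L, L', ⟨-, T, T', hT, hT', hf, hL, hL'⟩, hr, hr'⟩ := h
  obtain ⟨ts, hts, rfl⟩ := hT.exists_fullWalk ha hn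
  obtain ⟨ts', hts', rfl⟩ := hT'.exists_fullWalk ha hn
  obtain rfl := hts.eq_levelPath hL
  obtain rfl := hts'.eq_levelPath hL'
  rw [((hts.isPath hk).removes hr.1).2, ((hts'.isPath hk).removes hr'.1).2,
    Walk.pathWeight_levelPath hts (List.nodup_finRange n),
    Walk.pathWeight_levelPath hts' (List.nodup_finRange n)]
  exact hts.weight_le_of_isFlip ha hts' hf k

theorem pathWeight_le_add_edist {a : Fin n → ℝ} (ha : StrictMono a) (hn : 2 ≤ n) {k : ℕ}
    (hk : k + 1 ≤ n) (R R' : {R : List (Finset (Fin n)) // IsReducedLifting a (k + 1) R}) :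
    (pathWeight R.1 : ℕ∞) ≤ pathWeight R'.1 + (reducedFlipGraph a (k + 1)).edist R R' := by
  by_cases htop : (reducedFlipGraph a (k + 1)).edist R R' = ⊤
  · simp [htop]
  · obtain ⟨w, hw⟩ := SimpleGraph.exists_walk_of_edist_ne_top htop
    rw [← hw]
    have key : ∀ {R R' : {R : List (Finset (Fin n)) // IsReducedLifting a (k + 1) R}}
        (w : (reducedFlipGraph a (k + 1)).Walk R R'),
        pathWeight R.1 ≤ pathWeight R'.1 + w.length := by
      intro R R' w
      induction w with
      | nil => simp
      | cons hadj w ih =>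
        have := pathWeight_le_of_adj ha hn hk hadj
        rw [SimpleGraph.Walk.length_cons]
        omega
    exact_mod_cast key w

theorem ediam_reducedFlipGraph {a : Fin n → ℝ} (ha : StrictMono a) {k : ℕ} (hk : k + 2 ≤ n) :
    (reducedFlipGraph a (k + 1)).ediam = ((k * (n - k - 1) : ℕ) : ℕ∞) := by
  have hn : 2 ≤ n := by omega
  have hk1 : k + 1 ≤ n := by omega
  obtain ⟨c, hc, hcw, hcM⟩ := exists_greatest_walk k (List.finRange n) (List.pairwise_lt_finRange n)
  obtain ⟨d, hd, hdw, hdM⟩ := exists_least_walk (List.finRange n).reverse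
    (List.pairwise_reverse.2 (List.pairwise_lt_finRange n))
  rw [List.reverse_reverse] at hd hdM
  replace hc : FullWalk c := hc
  replace hd : FullWalk d := hd
  rw [List.length_finRange] at hcw
  have hdw' : weight k d = 0 := by
    refine List.sum_eq_zero fun x hx => ?_
    obtain ⟨t, ht, rfl⟩ := List.mem_map.1 hx
    rw [tileWeight, Finset.filter_false_of_mem (hdw t ht)]
    simp
  refine le_antisymm (SimpleGraph.ediam_le_of_edist_le fun R R' => ?_) ?_
  · obtain ⟨ts, h, hR⟩ := R.2.exists_fullWalk ha hn
    obtain ⟨ts', h', hR'⟩ := R'.2.exists_fullWalk ha hn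
    obtain rfl : h.vert ha hn hk1 = R := Subtype.ext hR
    obtain rfl : h'.vert ha hn hk1 = R' := Subtype.ext hR'
    obtain ⟨_, h1⟩ := hc.edist_add_weight_le ha hn hk1 (hcM ts h)
    obtain ⟨_, h2⟩ := hc.edist_add_weight_le ha hn hk1 (hcM ts' h')
    obtain ⟨_, h3⟩ := h.edist_add_weight_le ha hn hk1 (hdM ts h)
    obtain ⟨_, h4⟩ := h'.edist_add_weight_le ha hn hk1 (hdM ts' h')
    -- The distances through the greatest and through the least vertex add up to at most twice the
    -- weight of the greatest one.
    have t1 := SimpleGraph.edist_triangle (G := reducedFlipGraph a (k + 1))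
      (u := h.vert ha hn hk1) (v := hc.vert ha hn hk1) (w := h'.vert ha hn hk1)
    have t2 := SimpleGraph.edist_triangle (G := reducedFlipGraph a (k + 1))
      (u := h.vert ha hn hk1) (v := hd.vert ha hn hk1) (w := h'.vert ha hn hk1)
    rw [SimpleGraph.edist_comm (u := h.vert ha hn hk1) (v := hc.vert ha hn hk1)] at t1
    rw [SimpleGraph.edist_comm (u := hd.vert ha hn hk1) (v := h'.vert ha hn hk1)] at t2
    rw [hcw] at h1 h2
    rw [hdw', Nat.cast_zero, add_zero] at h3 h4
    generalize (reducedFlipGraph a (k + 1)).edist (hc.vert ha hn hk1) (h.vert ha hn hk1) = x1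
      at h1 t1
    generalize (reducedFlipGraph a (k + 1)).edist (hc.vert ha hn hk1) (h'.vert ha hn hk1) = x2
      at h2 t1
    generalize (reducedFlipGraph a (k + 1)).edist (h.vert ha hn hk1) (hd.vert ha hn hk1) = x3
      at h3 t2
    generalize (reducedFlipGraph a (k + 1)).edist (h'.vert ha hn hk1) (hd.vert ha hn hk1) = x4
      at h4 t2
    generalize (reducedFlipGraph a (k + 1)).edist (h.vert ha hn hk1) (h'.vert ha hn hk1) = e
      at t1 t2 ⊢
    generalize k * (n - k - 1) = N at h1 h2 ⊢
    clear hcw hdw' hR hR'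
    lift x1 to ℕ using fun h => by simp [h] at h1
    lift x2 to ℕ using fun h => by simp [h] at h2
    lift x3 to ℕ using fun h => by simp [h] at h3
    lift x4 to ℕ using fun h => by simp [h] at h4
    lift e to ℕ using fun h => by
      rw [h] at t1
      exact absurd (top_le_iff.1 t1) (by exact_mod_cast ENat.natCast_ne_top (x1 + x2))
    norm_cast at *
    omega
  · have h1 := pathWeight_le_add_edist ha hn hk1 (hc.vert ha hn hk1) (hd.vert ha hn hk1)
    have e1 : pathWeight (hc.vert ha hn hk1).1 = k * (n - k - 1) :=
      (hc.weight_eq_pathWeight_reduceList hk1).symm.trans hcw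
    have e2 : pathWeight (hd.vert ha hn hk1).1 = 0 :=
      (hd.weight_eq_pathWeight_reduceList hk1).symm.trans hdw'
    rw [e1, e2, Nat.cast_zero, zero_add] at h1
    exact h1.trans SimpleGraph.edist_le_ediam

end HyperTri

theorem mainTheorem4 (n : ℕ) (a : Fin n → ℝ) (ha : StrictMono a) (k : ℕ)
    (hk1 : 1 ≤ k) (hk2 : k + 2 ≤ n) :
    (HyperTri.reducedFlipGraph a (k + 1)).ediam = ((k * (n - k - 1) : ℕ) : ℕ∞) := by
  exact HyperTri.ediam_reducedFlipGraph ha hk2
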